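/- \textbf{Setting.} Let $(\Omega,d)$ be a separable complete metric space with a Borel probability measure $P$, and let $\mathsf X,\mathsf Y$ be separable metric spaces. A \emph{$P$-lower-measurable set} is an equivalence class of sequences $(U_n)$ of open subsets of $\Omega$ with $U_m\subset U_n$ and $P(U_m)\ge P(U_n)-2^{-n}$ for $m>n$, where $(U_n)\sim(V_n)$ if for every $\epsilon>0$ one has $P(U_m\cap V_m)\ge\max(P(U_m),P(V_m))-\epsilon$ for all large $m$. Its measure is $\sup_n(P(U_n)-2^{-n})$. Finite intersections and countable unions of these sets are defined through the sequences. A \emph{random variable} $Z:\mathcal R(\mathsf Z)$ in a separable metric space $\mathsf Z$ is a map $Z^{-1}$ from open subsets of $\mathsf Z$ to $P$-lower-measurable sets which preserves $\emptyset$, the whole space, finite intersections and finite unions, and is continuous (i.e. preserves unions of increasing sequences). A sequence $Z_n$ \emph{converges} to $Z$ if $\liminf_n P(Z_n\in U\wedge Z\in U)\ge P(Z\in U)$ for every open $U$. $Z$ is \emph{simple} if it takes finitely many values. A \emph{measure-topology} $\mathcal X$ is a set of $P$-lower-measurable sets containing $\emptyset,\Omega$ and closed under finite intersections and countable unions. $X:\mathcal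 R(\mathsf X)$ is \emph{$\mathcal X$-measurable} if $X^{-1}(U)\in\mathcal X$ for all open $U$. A \emph{conditional random variable} is a continuous map $Y|:\mathsf X\to\mathcal R(\mathsf Y)$ (if $x_n\to x$ then $Y|x_n\to Y|x$). It is \emph{$\mathcal X$-independent} if $P\bigl(\bigcap_{i=1}^k (Y|x_i)^{-1}(V_i)\cap A\bigr)=P\bigl(\bigcap_{i=1}^k(Y|x_i)^{-1}(V_i)\bigr)P(A)$ for all $k$, all $x_i\in\mathsf X$, all open $V_i\subset\mathsf Y$ and all $A\in\mathcal X$. If $X$ is simple with values $x_i$, the \emph{joint random variable} $X\rtimes Y|:\mathcal R(\mathsf X\times\mathsf Y)$ is defined by $$(X\rtimes Y|)^{-1}(U\times V)=\bigcup_{x_i\in U}X^{-1}(x_i)\cap(Y|x_i)^{-1}(V).$$ For general $\mathcal X$-measurable $X$ it is defined as $\lim_{n\to\infty}X_n\rtimes Y|$, where $(X_n)$ is a sequence of $\mathcal X$-measurable simple random variables converging to $X$. \textbf{Theorem.} (1) Let $\mathcal X$ be a measure-topology, let $X:\mathcal R(\mathsf X)$ be $\mathcal X$-measurable and let $Y|:\mathsf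 X\to\mathcal R(\mathsf Y)$ be an $\mathcal X$-independent conditional random variable. Then sequences of $\mathcal X$-measurable simple random variables converging to $X$ exist; for every $\mathcal X$-measurable simple random variable $S$ in $\mathsf X$, the joint random variable $S\rtimes Y|$ exists and is unique; and there is a random variable $Z:\mathcal R(\mathsf X\times\mathsf Y)$ such that for every sequence $(X_n)$ of $\mathcal X$-measurable simple random variables converging to $X$, the random variable $Z$ is the unique limit of $X_n\rtimes Y|$. So $X\rtimes Y|$ is well defined and independent of the sequence $(X_n)$. (2) $X\rtimes Y|$ is computable from $X$ and $Y|$ in the sense of type-two effectivity: suppose that $\Omega,\mathsf X,\mathsf Y$ are equipped with dense sequences whose mutual distances are uniformly computable reals, and that $P$ is computable as a map from open subsets of $\Omega$ to $[0,\infty]$ with the lower topology. Then there is one type-two machine which, for all $\mathcal X$, $X$ and $Y|$ as in (1), maps any pair consisting of a name of $X$ and a name of $Y|$ to a name of $X\rtimes Y|$. Here points are named by fast Cauchy sequences in the dense sequence, points of $\mathsf X\times\mathsf Y$ by pairs of names, open sets as maps to the Sierpi\'nski space, lower-measurable sets by names of the open sets $U_n$ of a representing sequence, random variables as maps from open sets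 to lower-measurable sets, and conditional random variables as maps from points to random variables; a name of a map is a program (with infinite-sequence parameter) that transforms names of arguments into names of values. -/

import Mathlib

open MeasureTheory TopologicalSpace Filter
open scoped ENNReal Topology

set_option linter.unusedSectionVars false

noncomputable section

namespace CondRV

/-! ## Lower-measurable sets -/

section LowerMeasurable

variable {Ω : Type*} [TopologicalSpace Ω] [MeasurableSpace Ω]

/-- A fast monotone lower-Cauchy sequence of open sets: `U m ⊆ U n` and
`P (U m) ≥ P (U n) - 2⁻ⁿ` whenever `m > n`. -/
structure FastSeq (P : Measure Ω) where
  seq : ℕ → Opens Ω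
  anti : ∀ n m, n < m → seq m ≤ seq n
  fast : ∀ n m, n < m → P (seq n) ≤ P (seq m) + (2⁻¹ : ℝ≥0∞) ^ n

namespace FastSeq

variable {P : Measure Ω}

/-- Two lower-Cauchy sequences are equivalent if for every `ε > 0`, eventually
`P (U m ∩ V m) ≥ max (P (U m)) (P (V m)) - ε`. -/
def Equiv (S T : FastSeq P) : Prop :=
  ∀ ε : ℝ≥0∞, 0 < ε → ∃ n, ∀ m, n ≤ m →
    max (P (S.seq m)) (P (T.seq m)) ≤ P ((S.seq m ⊓ T.seq m : Opens Ω) : Set Ω) + ε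

/-- The lower measure `sup_n (P (U n) - 2⁻ⁿ)`. -/
def lowerMeasure (S : FastSeq P) : ℝ≥0∞ := ⨆ n, (P (S.seq n) - (2⁻¹ : ℝ≥0∞) ^ n)

/-- The `Gδ` set that is the intersection of a sequence (used for the proofs of the helper
facts only). -/
def inter (S : FastSeq P) : Set Ω := ⋂ n, (S.seq n : Set Ω)

theorem antitone (S : FastSeq P) : Antitone fun n => (S.seq n : Set Ω) := by
  intro n m h
  rcases h.eq_or_lt with rfl | h
  · exact le_rfl
  · exact S.anti n m h

theorem inter_subset (S : FastSeq P) (n : ℕ) : S.inter ⊆ S.seq n := Set.iInter_subset _ n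

theorem pow_tendsto : Tendsto (fun n : ℕ => (2⁻¹ : ℝ≥0∞) ^ n) atTop (𝓝 0) :=
  ENNReal.tendsto_pow_atTop_nhds_zero_of_lt_one (by simp)

variable [OpensMeasurableSpace Ω]

theorem measurableSet_inter (S : FastSeq P) : MeasurableSet S.inter :=
  MeasurableSet.iInter fun n => (S.seq n).isOpen.measurableSet

variable [IsFiniteMeasure P]

theorem tendsto_measure (S : FastSeq P) :
    Tendsto (fun n => P (S.seq n)) atTop (𝓝 (P S.inter)) :=
  tendsto_measure_iInter_atTop (fun n => (S.seq n).isOpen.measurableSet.nullMeasurableSet)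
    S.antitone ⟨0, measure_ne_top _ _⟩

theorem measure_le (S : FastSeq P) (n : ℕ) : P (S.seq n) ≤ P S.inter + (2⁻¹ : ℝ≥0∞) ^ n := by
  refine ge_of_tendsto (S.tendsto_measure.add_const _) ?_
  filter_upwards [eventually_gt_atTop n] with m hm using S.fast n m hm

theorem measure_diff_le (S : FastSeq P) (n : ℕ) :
    P ((S.seq n : Set Ω) \ S.inter) ≤ (2⁻¹ : ℝ≥0∞) ^ n := by
  rw [measure_sdiff (S.inter_subset n) S.measurableSet_inter.nullMeasurableSet
    (measure_ne_top _ _)]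
  exact tsub_le_iff_left.2 (S.measure_le n)

theorem lowerMeasure_eq (S : FastSeq P) : S.lowerMeasure = P S.inter := by
  refine le_antisymm (iSup_le fun n => tsub_le_iff_right.2 (S.measure_le n)) ?_
  have h : Tendsto (fun n => P S.inter - (2⁻¹ : ℝ≥0∞) ^ n) atTop (𝓝 (P S.inter - 0)) :=
    ENNReal.Tendsto.sub tendsto_const_nhds pow_tendsto (Or.inl (measure_ne_top _ _))
  rw [tsub_zero] at h
  refine le_of_tendsto h (Eventually.of_forall fun n => ?_)
  exact (tsub_le_tsub_right (measure_mono (S.inter_subset n)) _).trans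
    (le_iSup (fun n => P (S.seq n) - (2⁻¹ : ℝ≥0∞) ^ n) n)

theorem ae_le_of_equiv {S T : FastSeq P} (h : S.Equiv T) : P (S.inter \ T.inter) = 0 := by
  have key : ∀ n, P (S.inter \ T.seq n) = 0 := by
    intro n
    refine le_antisymm (ENNReal.le_of_forall_pos_le_add fun ε hε _ => ?_) bot_le
    obtain ⟨k, hk⟩ := h ε (by exact_mod_cast hε)
    have h1 := hk (max k n) (le_max_left _ _)
    have h2 : P (S.inter \ T.seq n) ≤
        P ((S.seq (max k n) : Set Ω) \ ((S.seq (max k n) ⊓ T.seq (max k n) : Opens Ω) : Set Ω)) := by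
      refine measure_mono ?_
      rintro ω ⟨h1, h2⟩
      exact ⟨S.inter_subset _ h1, fun h3 => h2 (T.antitone (le_max_right k n) h3.2)⟩
    refine h2.trans ?_
    rw [measure_sdiff (show ((S.seq (max k n) ⊓ T.seq (max k n) : Opens Ω) : Set Ω) ⊆ S.seq (max k n) from
        fun ω hω => (show ω ∈ (S.seq (max k n) : Set Ω) ∩ T.seq (max k n) from hω).1)
      (Opens.isOpen _).measurableSet.nullMeasurableSet (measure_ne_top _ _), zero_add]
    exact tsub_le_iff_left.2 ((le_max_left _ _).trans h1)
  have : S.inter \ T.inter = ⋃ n, S.inter \ T.seq n := by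
    rw [inter, inter, Set.sdiff_iInter]
  rw [this]
  exact measure_iUnion_null key

theorem Equiv.symm {S T : FastSeq P} (h : S.Equiv T) : T.Equiv S := by
  intro ε hε
  obtain ⟨n, hn⟩ := h ε hε
  exact ⟨n, fun m hm => by rw [max_comm, inf_comm]; exact hn m hm⟩

theorem equiv_iff {S T : FastSeq P} : S.Equiv T ↔ S.inter =ᵐ[P] T.inter := by
  constructor
  · intro h
    exact (ae_le_set.2 (ae_le_of_equiv h)).antisymm (ae_le_set.2 (ae_le_of_equiv h.symm))
  · intro h ε hε
    have h1 : P (S.inter ∩ T.inter) = P S.inter :=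
      measure_congr (((ae_eq_refl S.inter).inter h.symm).trans
        (by rw [Set.inter_self]; exact ae_eq_refl _))
    have h2 : P S.inter = P T.inter := measure_congr h
    obtain ⟨n, hn⟩ := (pow_tendsto.eventually (gt_mem_nhds hε)).exists_forall_of_atTop
    refine ⟨n, fun m hm => ?_⟩
    have h3 : P (S.inter ∩ T.inter) ≤ P ((S.seq m ⊓ T.seq m : Opens Ω) : Set Ω) :=
      measure_mono fun ω hω => ⟨S.inter_subset m hω.1, T.inter_subset m hω.2⟩
    refine max_le ?_ ?_
    · exact (S.measure_le m).trans (add_le_add (h1 ▸ h3) (hn m hm).le)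
    · exact (T.measure_le m).trans (add_le_add (h2 ▸ h1 ▸ h3) (hn m hm).le)

/-- Helper constructor: a decreasing sequence of open sets containing a set `L` up to an excess
of `2⁻ⁿ`. -/
def ofBound (L : Set Ω) (U : ℕ → Opens Ω) (hU : ∀ n m, n < m → U m ≤ U n)
    (hL : ∀ n, L ⊆ U n) (h : ∀ n, P (U n) ≤ P L + (2⁻¹ : ℝ≥0∞) ^ n) : FastSeq P where
  seq := U
  anti := hU
  fast := fun n m _ => (h n).trans (by gcongr; exact hL m)

theorem ofBound_inter (L : Set Ω) (U : ℕ → Opens Ω) (hU : ∀ n m, n < m → U m ≤ U n)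
    (hL : ∀ n, L ⊆ U n) (h : ∀ n, P (U n) ≤ P L + (2⁻¹ : ℝ≥0∞) ^ n) (hm : MeasurableSet L) :
    (ofBound L U hU hL h).inter =ᵐ[P] L := by
  have h0 : P ((ofBound L U hU hL h).inter \ L) = 0 := by
    refine le_antisymm (ge_of_tendsto' pow_tendsto fun n => ?_) bot_le
    have : P ((U n : Set Ω) \ L) ≤ (2⁻¹ : ℝ≥0∞) ^ n := by
      rw [measure_sdiff (hL n) hm.nullMeasurableSet (measure_ne_top _ _)]
      exact tsub_le_iff_left.2 (h n)
    refine (measure_mono ?_).trans this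
    exact Set.sdiff_subset_sdiff_left (Set.iInter_subset _ n)
  exact (ae_le_set.2 h0).antisymm (Set.subset_iInter hL).eventuallyLE

theorem two_mul_pow (n : ℕ) :
    (2⁻¹ : ℝ≥0∞) ^ (n + 1) + (2⁻¹ : ℝ≥0∞) ^ (n + 1) = (2⁻¹ : ℝ≥0∞) ^ n := by
  rw [pow_succ, ← mul_add, ENNReal.inv_two_add_inv_two, mul_one]

/-- The constant sequence at an open set. -/
def ofOpen (P : Measure Ω) (U : Opens Ω) : FastSeq P where
  seq := fun _ => U
  anti := fun _ _ _ => le_rfl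
  fast := fun _ _ _ => le_self_add

/-- Intersection of lower-measurable sets: `(U ∩ V) n = U (n+1) ∩ V (n+1)`. -/
def inf (S T : FastSeq P) : FastSeq P :=
  ofBound (S.inter ∩ T.inter) (fun n => S.seq (n + 1) ⊓ T.seq (n + 1))
    (fun n m h => inf_le_inf (S.anti _ _ (by lia)) (T.anti _ _ (by lia)))
    (fun n => Set.inter_subset_inter (S.inter_subset _) (T.inter_subset _))
    (fun n => by
      have : ((S.seq (n + 1) ⊓ T.seq (n + 1) : Opens Ω) : Set Ω) ⊆ (S.inter ∩ T.inter) ∪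
          (((S.seq (n + 1) : Set Ω) \ S.inter) ∪ ((T.seq (n + 1) : Set Ω) \ T.inter)) := by
        rintro ω ⟨h1, h2⟩
        by_cases h3 : ω ∈ S.inter <;> by_cases h4 : ω ∈ T.inter
        · exact Or.inl ⟨h3, h4⟩
        · exact Or.inr (Or.inr ⟨h2, h4⟩)
        · exact Or.inr (Or.inl ⟨h1, h3⟩)
        · exact Or.inr (Or.inl ⟨h1, h3⟩)
      refine (measure_mono this).trans ((measure_union_le _ _).trans ?_)
      gcongr
      rw [← two_mul_pow]
      exact (measure_union_le _ _).trans
        (add_le_add (S.measure_diff_le _) (T.measure_diff_le _)))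

/-- Union of lower-measurable sets: `(U ∪ V) n = U (n+1) ∪ V (n+1)`. -/
def sup (S T : FastSeq P) : FastSeq P :=
  ofBound (S.inter ∪ T.inter) (fun n => S.seq (n + 1) ⊔ T.seq (n + 1))
    (fun n m h => sup_le_sup (S.anti _ _ (by lia)) (T.anti _ _ (by lia)))
    (fun n => Set.union_subset_union (S.inter_subset _) (T.inter_subset _))
    (fun n => by
      have : ((S.seq (n + 1) ⊔ T.seq (n + 1) : Opens Ω) : Set Ω) ⊆ (S.inter ∪ T.inter) ∪
          (((S.seq (n + 1) : Set Ω) \ S.inter) ∪ ((T.seq (n + 1) : Set Ω) \ T.inter)) := by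
        rintro ω (h1 | h1)
        · by_cases h3 : ω ∈ S.inter
          · exact Or.inl (Or.inl h3)
          · exact Or.inr (Or.inl ⟨h1, h3⟩)
        · by_cases h3 : ω ∈ T.inter
          · exact Or.inl (Or.inr h3)
          · exact Or.inr (Or.inr ⟨h1, h3⟩)
      refine (measure_mono this).trans ((measure_union_le _ _).trans ?_)
      gcongr
      rw [← two_mul_pow]
      exact (measure_union_le _ _).trans
        (add_le_add (S.measure_diff_le _) (T.measure_diff_le _)))

/-- Countable union of lower-measurable sets: `(⋃ k, U k) n = ⋃ k, U k (n+k+1)`. -/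
def iUnion (S : ℕ → FastSeq P) : FastSeq P :=
  ofBound (⋃ k, (S k).inter) (fun n => ⨆ k, (S k).seq (n + k + 1))
    (fun n m h => iSup_mono fun k => (S k).anti _ _ (by lia))
    (fun n => by
      rw [Opens.coe_iSup]
      exact Set.iUnion_mono fun k => (S k).inter_subset _)
    (fun n => by
      have : ((⨆ k, (S k).seq (n + k + 1) : Opens Ω) : Set Ω) ⊆ (⋃ k, (S k).inter) ∪
          ⋃ k, (((S k).seq (n + k + 1) : Set Ω) \ (S k).inter) := by
        intro ω hω
        rw [Opens.coe_iSup, Set.mem_iUnion] at hω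
        obtain ⟨k, hk⟩ := hω
        by_cases h3 : ω ∈ (S k).inter
        · exact Or.inl (Set.mem_iUnion.2 ⟨k, h3⟩)
        · exact Or.inr (Set.mem_iUnion.2 ⟨k, hk, h3⟩)
      refine (measure_mono this).trans ((measure_union_le _ _).trans ?_)
      gcongr
      refine (measure_iUnion_le _).trans ?_
      calc ∑' k, P (((S k).seq (n + k + 1) : Set Ω) \ (S k).inter)
          ≤ ∑' k : ℕ, (2⁻¹ : ℝ≥0∞) ^ n * (2⁻¹ : ℝ≥0∞) ^ (k + 1) :=
            ENNReal.tsum_le_tsum fun k => by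
              rw [← pow_add, ← add_assoc]
              exact (S k).measure_diff_le _
        _ = (2⁻¹ : ℝ≥0∞) ^ n := by
            rw [ENNReal.tsum_mul_left, ENNReal.tsum_geometric_add_one]
            simp [ENNReal.one_sub_inv_two, ENNReal.inv_mul_cancel])

theorem ofOpen_inter (U : Opens Ω) : (ofOpen P U).inter = U := by
  simp [inter, ofOpen, Set.iInter_const]

theorem inf_inter (S T : FastSeq P) : (S.inf T).inter =ᵐ[P] (S.inter ∩ T.inter : Set Ω) :=
  ofBound_inter _ _ _ _ _ (S.measurableSet_inter.inter T.measurableSet_inter)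

theorem sup_inter (S T : FastSeq P) : (S.sup T).inter =ᵐ[P] (S.inter ∪ T.inter : Set Ω) :=
  ofBound_inter _ _ _ _ _ (S.measurableSet_inter.union T.measurableSet_inter)

theorem iUnion_inter (S : ℕ → FastSeq P) :
    (iUnion S).inter =ᵐ[P] (⋃ k, (S k).inter : Set Ω) :=
  ofBound_inter _ _ _ _ _ (MeasurableSet.iUnion fun k => (S k).measurableSet_inter)

/-- Equivalence of lower-Cauchy sequences, as a setoid. -/
instance setoid (P : Measure Ω) [IsFiniteMeasure P] : Setoid (FastSeq P) where
  r := Equiv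
  iseqv :=
    { refl := fun _ => equiv_iff.2 (ae_eq_refl _)
      symm := fun h => h.symm
      trans := fun h1 h2 => equiv_iff.2 ((equiv_iff.1 h1).trans (equiv_iff.1 h2)) }

end FastSeq

variable [OpensMeasurableSpace Ω]

/-- `P`-lower-measurable sets: equivalence classes of fast monotone lower-Cauchy sequences of
open sets. -/
def LowerMeas (P : Measure Ω) [IsFiniteMeasure P] : Type _ := Quotient (FastSeq.setoid P)

namespace LowerMeas

variable {P : Measure Ω} [IsFiniteMeasure P]

/-- The lower-measurable set represented by a sequence. -/
def mk (S : FastSeq P) : LowerMeas P := Quotient.mk _ S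

/-- The lower measure of a lower-measurable set. -/
def prob (A : LowerMeas P) : ℝ≥0∞ :=
  Quotient.lift FastSeq.lowerMeasure (fun S T h => by
    rw [S.lowerMeasure_eq, T.lowerMeasure_eq]
    exact measure_congr (FastSeq.equiv_iff.1 h)) A

/-- The almost-everywhere class of the intersection of a representing sequence (used to transport
the order structure). -/
def toGerm (A : LowerMeas P) : Germ (ae P) Prop :=
  Quotient.lift (fun S : FastSeq P => ((fun ω => ω ∈ S.inter : Ω → Prop) : Germ (ae P) Prop))
    (fun _ _ h => Germ.coe_eq.2 (FastSeq.equiv_iff.1 h)) A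

theorem toGerm_injective : Function.Injective (toGerm (P := P)) := by
  intro A B
  induction A using Quotient.ind
  induction B using Quotient.ind
  intro h
  exact Quotient.sound (FastSeq.equiv_iff.2 (Germ.coe_eq.1 h))

/-- The intersection of lower-measurable sets. -/
def inter : LowerMeas P → LowerMeas P → LowerMeas P :=
  Quotient.map₂ FastSeq.inf fun S S' h T T' h' => FastSeq.equiv_iff.2 <|
    (S.inf_inter T).trans <| ((FastSeq.equiv_iff.1 h).inter (FastSeq.equiv_iff.1 h')).trans
      (S'.inf_inter T').symm

/-- The union of lower-measurable sets. -/
def union : LowerMeas P → LowerMeas P → LowerMeas P :=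
  Quotient.map₂ FastSeq.sup fun S S' h T T' h' => FastSeq.equiv_iff.2 <|
    (S.sup_inter T).trans <| ((FastSeq.equiv_iff.1 h).union (FastSeq.equiv_iff.1 h')).trans
      (S'.sup_inter T').symm

theorem toGerm_inter (A B : LowerMeas P) : toGerm (inter A B) = toGerm A ⊓ toGerm B := by
  induction A using Quotient.ind
  induction B using Quotient.ind
  exact Germ.coe_eq.2 (FastSeq.inf_inter _ _)

theorem toGerm_union (A B : LowerMeas P) : toGerm (union A B) = toGerm A ⊔ toGerm B := by
  induction A using Quotient.ind
  induction B using Quotient.ind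
  exact Germ.coe_eq.2 (FastSeq.sup_inter _ _)

/-- Lower-measurable sets under intersection and union, ordered by inclusion up to null sets. -/
instance : DistribLattice (LowerMeas P) where
  le A B := toGerm A ≤ toGerm B
  le_refl A := le_refl (toGerm A)
  le_trans A B C h h' := le_trans (b := toGerm B) h h'
  le_antisymm A B h h' := toGerm_injective (le_antisymm h h')
  inf := inter
  sup := union
  inf_le_left A B := by rw [toGerm_inter]; exact inf_le_left
  inf_le_right A B := by rw [toGerm_inter]; exact inf_le_right
  le_inf A B C h h' := by rw [toGerm_inter]; exact le_inf h h'
  le_sup_left A B := by rw [toGerm_union]; exact le_sup_left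
  le_sup_right A B := by rw [toGerm_union]; exact le_sup_right
  sup_le A B C h h' := by rw [toGerm_union]; exact sup_le h h'
  le_sup_inf A B C := by
    change toGerm (inter (union A B) (union A C)) ≤ toGerm (union A (inter B C))
    simp only [toGerm_inter, toGerm_union]
    exact le_sup_inf

/-- The least element is the empty set and the greatest element is the whole space. -/
instance : BoundedOrder (LowerMeas P) where
  bot := mk (FastSeq.ofOpen P ⊥)
  top := mk (FastSeq.ofOpen P ⊤)
  bot_le A := by
    have h : toGerm (mk (FastSeq.ofOpen P ⊥)) = ⊥ :=
      Germ.coe_eq.2 (Eventually.of_forall fun ω => by simp [FastSeq.ofOpen_inter])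
    change toGerm (mk (FastSeq.ofOpen P ⊥)) ≤ toGerm A
    rw [h]
    exact bot_le
  le_top A := by
    have h : toGerm (mk (FastSeq.ofOpen P ⊤)) = ⊤ :=
      Germ.coe_eq.2 (Eventually.of_forall fun ω => by simp [FastSeq.ofOpen_inter])
    change toGerm A ≤ toGerm (mk (FastSeq.ofOpen P ⊤))
    rw [h]
    exact le_top

/-- Countable union of lower-measurable sets. -/
def iUnion (A : ℕ → LowerMeas P) : LowerMeas P := mk (FastSeq.iUnion fun k => (A k).out)

/-- The countable union does not depend on the chosen representatives. -/
theorem iUnion_mk (S : ℕ → FastSeq P) : iUnion (fun k => mk (S k)) = mk (FastSeq.iUnion S) :=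
  Quotient.sound <| FastSeq.equiv_iff.2 <| (FastSeq.iUnion_inter _).trans <|
    (Filter.EventuallyEq.countable_iUnion fun k =>
      FastSeq.equiv_iff.1 (Quotient.mk_out (S k))).trans (FastSeq.iUnion_inter _).symm

end LowerMeas

/-! ## Random variables -/

variable (P : Measure Ω) [IsFiniteMeasure P]

/-- A random variable with values in `X`: a map from open subsets of `X` to lower-measurable
subsets of `Ω` which preserves `∅`, `X`, intersections and unions and is continuous, that is
(for separable metrizable `X`) preserves unions of increasing sequences. -/
@[ext]
structure RandomVariable (X : Type*) [TopologicalSpace X] where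
  pre : Opens X → LowerMeas P
  pre_bot : pre ⊥ = ⊥
  pre_top : pre ⊤ = ⊤
  pre_inf : ∀ U V, pre (U ⊓ V) = pre U ⊓ pre V
  pre_sup : ∀ U V, pre (U ⊔ V) = pre U ⊔ pre V
  pre_iSup : ∀ U : ℕ → Opens X, Monotone U → pre (⨆ n, U n) = LowerMeas.iUnion fun n => pre (U n)

/-- A `P`-topology (measure-topology). -/
structure MeasureTopology where
  carrier : Set (LowerMeas P)
  bot_mem : ⊥ ∈ carrier
  top_mem : ⊤ ∈ carrier
  inf_mem : ∀ A ∈ carrier, ∀ B ∈ carrier, A ⊓ B ∈ carrier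
  iUnion_mem : ∀ A : ℕ → LowerMeas P, (∀ n, A n ∈ carrier) → LowerMeas.iUnion A ∈ carrier

variable {P}

/-- Convergence of random variables: `liminf P(Z_n ∈ U ∧ Z ∈ U) ≥ P(Z ∈ U)` for every open
`U`. -/
def Converges {X : Type*} [TopologicalSpace X] (Zs : ℕ → RandomVariable P X)
    (Z : RandomVariable P X) : Prop :=
  ∀ U : Opens X,
    (Z.pre U).prob ≤ liminf (fun n => ((Zs n).pre U ⊓ Z.pre U).prob) atTop

namespace RandomVariable

variable {X : Type*} [TopologicalSpace X]

/-- `Z` is measurable with respect to the measure-topology `T`. -/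
def MeasurableWrt (Z : RandomVariable P X) (T : MeasureTopology P) : Prop :=
  ∀ U, Z.pre U ∈ T.carrier

open Classical in
/-- `Z` takes the finitely many distinct values `x i`, with `A i = Z⁻¹(x i)`. -/
def TakesValues (Z : RandomVariable P X) {k : ℕ} (x : Fin k → X) (A : Fin k → LowerMeas P) :
    Prop :=
  Function.Injective x ∧ ∀ U : Opens X, Z.pre U = (Finset.univ.filter fun i => x i ∈ U).sup A

/-- A simple random variable takes finitely many values. -/
def IsSimple (Z : RandomVariable P X) : Prop :=
  ∃ (k : ℕ) (x : Fin k → X) (A : Fin k → LowerMeas P), Z.TakesValues x A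

end RandomVariable

variable (P) in
/-- A conditional random variable `Y| : X → R(Y)`: a continuous map into random variables. -/
structure ConditionalRV (X Y : Type*) [TopologicalSpace X] [TopologicalSpace Y] where
  toFun : X → RandomVariable P Y
  continuous : ∀ (xs : ℕ → X) (x : X), Tendsto xs atTop (𝓝 x) →
    Converges (fun n => toFun (xs n)) (toFun x)

/-- The product `U × V` of open sets. -/
def prodOpens {X Y : Type*} [TopologicalSpace X] [TopologicalSpace Y] (U : Opens X)
    (V : Opens Y) : Opens (X × Y) :=
  ⟨(U : Set X) ×ˢ (V : Set Y), U.isOpen.prod V.isOpen⟩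

section Joint

variable {X Y : Type*} [TopologicalSpace X] [TopologicalSpace Y]

/-- The random variables `Y|x` are jointly independent of `T`: each finite product of them is
independent of `T`. -/
def ConditionalRV.IndependentOf (Yc : ConditionalRV P X Y) (T : MeasureTopology P) : Prop :=
  ∀ (k : ℕ) (x : Fin k → X) (V : Fin k → Opens Y), ∀ A ∈ T.carrier,
    ((Finset.univ.inf fun i => (Yc.toFun (x i)).pre (V i)) ⊓ A).prob =
      (Finset.univ.inf fun i => (Yc.toFun (x i)).pre (V i)).prob * A.prob

open Classical in
/-- `Z` is the joint random variable `Z₀ ⋊ Y|` of a simple random variable `Z₀` and a conditional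
random variable: `Z⁻¹(U × V) = ⋃_{x_i ∈ U} Z₀⁻¹(x_i) ∩ (Y|x_i)⁻¹(V)`. -/
def IsSimpleJoint (Z₀ : RandomVariable P X) (Yc : ConditionalRV P X Y)
    (Z : RandomVariable P (X × Y)) : Prop :=
  ∃ (k : ℕ) (x : Fin k → X) (A : Fin k → LowerMeas P), Z₀.TakesValues x A ∧
    ∀ (U : Opens X) (V : Opens Y), Z.pre (prodOpens U V) =
      (Finset.univ.filter fun i => x i ∈ U).sup fun i => A i ⊓ (Yc.toFun (x i)).pre V

/-- `Xs` is a sequence of `T`-measurable simple random variables converging to `Z`. -/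
structure IsApproximation (T : MeasureTopology P) (Xs : ℕ → RandomVariable P X)
    (Z : RandomVariable P X) : Prop where
  simple : ∀ n, (Xs n).IsSimple
  measurable : ∀ n, (Xs n).MeasurableWrt T
  converges : Converges Xs Z

/-- `Z` is a joint random variable `X₀ ⋊ Y|`: the limit of `X_n ⋊ Y|` for some sequence `X_n` of
`T`-measurable simple random variables converging to `X₀`. -/
def IsJoint (T : MeasureTopology P) (X₀ : RandomVariable P X) (Yc : ConditionalRV P X Y)
    (Z : RandomVariable P (X × Y)) : Prop :=
  ∃ (Xs : ℕ → RandomVariable P X) (Zs : ℕ → RandomVariable P (X × Y)),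
    IsApproximation T Xs X₀ ∧ (∀ n, IsSimpleJoint (Xs n) Yc (Zs n)) ∧ Converges Zs Z

end Joint

end LowerMeasurable

/-! ## Type-two computability -/

/-- The first `n` symbols of an infinite sequence. -/
def pref (p : ℕ → ℕ) (n : ℕ) : List ℕ := (List.range n).map p

/-- `Apply a p q`: the type-two machine with program `a` maps the infinite input `p` to the
infinite output `q`. The machine determines the output symbol at position `k` by reading longer
and longer prefixes `p|n` of the input: `a (k, p|n) = 0` means that more input is requested, and
`a (k, p|n) = v + 1` that the symbol is `v`. A (partial) map on infinite sequences is computed by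
a type-two Turing machine if and only if it is `Apply a` on its domain for a computable `a`, and
it is continuous if and only if it is `Apply a` on its domain for some `a`. -/
def Apply (a p q : ℕ → ℕ) : Prop :=
  ∀ k, ∃ n, a (Encodable.encode (k, pref p n)) = q k + 1 ∧
    ∀ m < n, a (Encodable.encode (k, pref p m)) = 0

/-- The pairing of two infinite sequences. -/
def pairSeq (p q : ℕ → ℕ) : ℕ → ℕ := fun n => Nat.pair (p n) (q n)

/-- The `n`-th of a sequence of infinite sequences coded by one. -/
def slice (p : ℕ → ℕ) (n : ℕ) : ℕ → ℕ := fun k => p (Nat.pair n k)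

/-- A representation: `δ p a` means that the infinite sequence `p` is a name of `a`. -/
abbrev Rep (A : Type*) := (ℕ → ℕ) → A → Prop

namespace Rep

variable {A B C : Type*}

/-- Names in a type are the names of the image under a map. -/
def comap (f : C → A) (δ : Rep A) : Rep C := fun p c => δ p (f c)

/-- The product type. -/
def prod (δA : Rep A) (δB : Rep B) : Rep (A × B) := fun r z =>
  ∃ p q, r = pairSeq p q ∧ δA p z.1 ∧ δB q z.2

/-- The type of sequences. -/
def seq (δ : Rep A) : Rep (ℕ → A) := fun p s => ∀ n, δ (slice p n) (s n)

/-- The exponential type: a name of a function is a program which maps every name of an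
argument to a name of the value. -/
def arrow (δA : Rep A) (δB : Rep B) : Rep (A → B) := fun r f =>
  ∀ p a, δA p a → ∃ q, Apply r p q ∧ δB q (f a)

/-- The Sierpinski type. -/
def sierpinski : Rep Prop := fun p b => (∃ k, p k ≠ 0) ↔ b

/-- The open subsets of a type, identified with maps into the Sierpinski type. -/
def opens [TopologicalSpace A] (δ : Rep A) : Rep (Opens A) :=
  comap (fun (U : Opens A) (a : A) => a ∈ U) (arrow δ sierpinski)

/-- The nonnegative rational number with code `n`. -/
def nnrat (n : ℕ) : ℝ≥0∞ := (n.unpair.1 : ℝ≥0∞) / ((n.unpair.2 : ℝ≥0∞) + 1)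

/-- The positive reals with infinity under the lower topology: a name encodes an increasing
sequence of rationals with the desired limit. -/
def lower : Rep ℝ≥0∞ := fun p r => Monotone (fun n => nnrat (p n)) ∧ ⨆ n, nnrat (p n) = r

end Rep

/-- The structure of an effectively separable computable metric space: a dense sequence with
computable distances. -/
structure ComputableMetric (X : Type*) [MetricSpace X] where
  pt : ℕ → X
  dense : DenseRange pt
  dist_computable : ∃ f : ℕ × ℕ × ℕ → ℕ, Computable f ∧
    ∀ i j n, |dist (pt i) (pt j) - (f (i, j, n) : ℝ) / 2 ^ n| ≤ 1 / 2 ^ n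

/-- The points of a computable metric space: a name is a fast sequence of points of the dense
sequence. -/
def ComputableMetric.rep {X : Type*} [MetricSpace X] (c : ComputableMetric X) : Rep X :=
  fun p x => ∀ n, dist (c.pt (p n)) x < 1 / 2 ^ n

section Computability

variable {Ω : Type*} [TopologicalSpace Ω] [MeasurableSpace Ω] (P : Measure Ω)

/-- The measure is computable as a valuation, that is as an element of the type of maps from open
sets to `[0, ∞]` with the lower topology. -/
def ComputableMeasure (δ : Rep Ω) : Prop :=
  ∃ a : ℕ → ℕ, Computable a ∧ Rep.arrow (Rep.opens δ) Rep.lower a fun U => P U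

variable [OpensMeasurableSpace Ω] [IsFiniteMeasure P]

/-- Lower-measurable sets: a name encodes a fast monotone lower-Cauchy sequence of open sets. -/
def Rep.lowerMeas (δ : Rep Ω) : Rep (LowerMeas P) := fun p A =>
  ∃ S : FastSeq P, LowerMeas.mk S = A ∧ Rep.seq (Rep.opens δ) p S.seq

/-- Random variables, as maps from open sets to lower-measurable sets. -/
def Rep.randomVariable {X : Type*} [TopologicalSpace X] (δ : Rep Ω) (δX : Rep X) :
    Rep (RandomVariable P X) :=
  Rep.comap RandomVariable.pre (Rep.arrow (Rep.opens δX) (Rep.lowerMeas P δ))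

/-- Conditional random variables, as maps from points to random variables. -/
def Rep.conditionalRV {X Y : Type*} [TopologicalSpace X] [TopologicalSpace Y] (δ : Rep Ω)
    (δX : Rep X) (δY : Rep Y) : Rep (ConditionalRV P X Y) :=
  Rep.comap ConditionalRV.toFun (Rep.arrow δX (Rep.randomVariable P δ δY))

end Computability

end CondRV

end

/-! Modulo null sets, lower-measurable sets are measurable sets, and by outer regularity every
measurable set occurs. Let `X'` be the completion of `X`. A random variable in `X` amounts to a
measurable function into `X'` for which open sets with the same trace on `X` have almost surely
equal preimages (`RandomVariable.exists_fun`, `exists_realizes`). This trace condition stands in for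
"takes values in `X`", since `X` need not be measurable in `X'`. Convergence of random variables
becomes convergence in measure of these functions (`converges_iff_tendstoInMeasure`), which gives
uniqueness of limits and completeness on the level of functions.

Simple approximations come from cutting `X'` into differences of balls whose spheres are null sets,
so that the pieces are preimages of open sets up to null sets (`exists_isApproximation`). A joint
random variable of a simple one is the function which equals `(x, y x ω)` where the simple variable
has the value `x`. Continuity of `Y|` says that `y x` and `y x'` are close in measure when `x` and
`x'` are close. Since `y x` and `y x'` are jointly independent of the pieces, which lie in the
measure-topology, the bad probabilities are averaged over disjoint pieces and stay small however
many pieces there are (`measure_biUnion_inter_le_of_indep`, `JointApprox.measure_le_of_indep`).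
Hence any two sequences of joints are Cauchy in measure relative to each other
(`JointApprox.cauchy`). The same averaging shows that the limit avoids every closed set disjoint
from `X × Y` (`JointApprox.measure_eq_zero`). As differences of open sets are countable unions of
closed sets, the limit satisfies the trace condition and represents a random variable in `X × Y`.

For computability, the accuracy `2⁻ᵏ` is reached by a finite list of balls in `X`. Each ball lies in
the set of points with names beginning with some `τ`. Whatever the program for `Y|` accepts after
reading only `τ` is accepted for all points of the ball, so if the accepted part of `Ω` (the `core`)
has probability near one, then `Y|` is nearly constant on the ball (`measure_osc_le`). That a list
is good is semidecidable because the measure is computable from below, and good lists exist by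
continuity (`exists_core`, `exists_entries`). The search selects one list per level
(`RE.uniformize`). A pair of pieces is kept if a box around its centres is visibly inside the given
open set, with a margin that shrinks with the level; the kept pairs form an open set which
approximates the preimage up to a multiple of `2⁻ᵏ`. Borel–Cantelli identifies the limit inferior of
these sets with the preimage, and windows of consecutive levels turn them into a fast decreasing
sequence (`exists_fastSeq_window`, `Level.exists_fastSeq`). All conditions on the way are
semidecidable in the input names, and a semidecidable description of open sets yields a machine for
their names (`RE.exists_machine`). -/

namespace CondRV

/-! ### Lower-measurable sets as sets modulo null sets, and functions that represent random
variables -/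

section Representation

variable {Ω : Type*} [TopologicalSpace Ω] [MeasurableSpace Ω] [OpensMeasurableSpace Ω]
  {P : Measure Ω} [IsFiniteMeasure P]

namespace LowerMeas

/-- The lower-measurable set `A` is represented by the set `s`, up to a null set. -/
def Is (A : LowerMeas P) (s : Set Ω) : Prop :=
  toGerm A = ((fun ω => ω ∈ s : Ω → Prop) : Germ (ae P) Prop)

theorem is_mk {S : FastSeq P} {s : Set Ω} : (mk S).Is s ↔ S.inter =ᵐ[P] s := Germ.coe_eq

theorem Is.ae_eq {A : LowerMeas P} {s t : Set Ω} (h : A.Is s) (h' : A.Is t) : s =ᵐ[P] t :=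
  Germ.coe_eq.1 (h.symm.trans h')

theorem Is.congr {A : LowerMeas P} {s t : Set Ω} (h : A.Is s) (h' : s =ᵐ[P] t) : A.Is t :=
  h.trans (Germ.coe_eq.2 h')

theorem Is.eq {A B : LowerMeas P} {s : Set Ω} (h : A.Is s) (h' : B.Is s) : A = B :=
  toGerm_injective (h.trans h'.symm)

theorem Is.prob_eq {A : LowerMeas P} {s : Set Ω} (h : A.Is s) : A.prob = P s := by
  induction A using Quotient.ind with
  | _ S =>
    change S.lowerMeasure = _
    rw [S.lowerMeasure_eq]
    exact measure_congr (is_mk.1 h)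

theorem Is.le_iff {A B : LowerMeas P} {s t : Set Ω} (h : A.Is s) (h' : B.Is t) :
    A ≤ B ↔ s ≤ᵐ[P] t := by
  change toGerm A ≤ toGerm B ↔ _
  rw [h, h']
  exact Germ.coe_le

theorem Is.inf {A B : LowerMeas P} {s t : Set Ω} (h : A.Is s) (h' : B.Is t) :
    (A ⊓ B).Is (s ∩ t) := by
  change toGerm (inter A B) = _
  rw [toGerm_inter, h, h']
  rfl

theorem Is.sup {A B : LowerMeas P} {s t : Set Ω} (h : A.Is s) (h' : B.Is t) :
    (A ⊔ B).Is (s ∪ t) := by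
  change toGerm (union A B) = _
  rw [toGerm_union, h, h']
  rfl

theorem is_bot : (⊥ : LowerMeas P).Is ∅ :=
  is_mk.2 (by rw [FastSeq.ofOpen_inter]; rfl)

theorem is_top : (⊤ : LowerMeas P).Is Set.univ :=
  is_mk.2 (by rw [FastSeq.ofOpen_inter]; rfl)

/-- A measurable representative of a lower-measurable set. -/
noncomputable def toSet (A : LowerMeas P) : Set Ω := A.out.inter

theorem measurableSet_toSet (A : LowerMeas P) : MeasurableSet A.toSet :=
  A.out.measurableSet_inter

theorem is_toSet (A : LowerMeas P) : A.Is A.toSet := by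
  have h : mk A.out = A := Quotient.out_eq A
  conv_lhs => rw [← h]
  exact is_mk.2 (ae_eq_refl _)

theorem Is.iUnion {A : ℕ → LowerMeas P} {s : ℕ → Set Ω} (h : ∀ n, (A n).Is (s n)) :
    (iUnion A).Is (⋃ n, s n) :=
  is_mk.2 ((FastSeq.iUnion_inter _).trans
    (Filter.EventuallyEq.countable_iUnion fun n => (is_toSet (A n)).ae_eq (h n)))

theorem Is.finset_sup {ι : Type*} {F : Finset ι} {A : ι → LowerMeas P} {s : ι → Set Ω}
    (h : ∀ i ∈ F, (A i).Is (s i)) : (F.sup A).Is (⋃ i ∈ F, s i) := by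
  classical
  induction F using Finset.induction_on with
  | empty => simpa using is_bot
  | insert a F ha ih =>
    rw [Finset.sup_insert, Finset.set_biUnion_insert]
    exact (h a (Finset.mem_insert_self a F)).sup
      (ih fun i hi => h i (Finset.mem_insert_of_mem hi))

/-- By outer regularity every measurable set represents a lower-measurable set. -/
theorem exists_is [P.OuterRegular] {L : Set Ω} (hL : MeasurableSet L) :
    ∃ A : LowerMeas P, A.Is L := by
  have h1 : ∀ n : ℕ, ∃ U : Opens Ω, L ⊆ U ∧ P U ≤ P L + (2⁻¹ : ℝ≥0∞) ^ n := by
    intro n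
    obtain ⟨U, hU, hU', h⟩ := L.exists_isOpen_le_add P
      (ε := (2⁻¹ : ℝ≥0∞) ^ n) (by simp)
    exact ⟨⟨U, hU'⟩, hU, h⟩
  choose U hU h using h1
  -- Finite intersections make the outer approximations decreasing and keep their bounds.
  let V : ℕ → Opens Ω := fun n => (Finset.range (n + 1)).inf U
  have hV : ∀ n, V n ≤ U n := fun n => Finset.inf_le (by simp)
  have hLV : ∀ n, L ⊆ V n := by
    intro n ω hω
    have : ∀ F : Finset ℕ, ω ∈ F.inf U := by
      intro F
      induction F using Finset.induction_on with
      | empty => simp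
      | insert a F ha ih =>
        rw [Finset.inf_insert]
        exact ⟨hU a hω, ih⟩
    exact this _
  have hanti : ∀ n m, n < m → V m ≤ V n := fun n m hnm =>
    Finset.inf_mono (Finset.range_mono (by lia))
  have hb : ∀ n, P (V n) ≤ P L + (2⁻¹ : ℝ≥0∞) ^ n := fun n =>
    (measure_mono (hV n)).trans (h n)
  exact ⟨mk (FastSeq.ofBound L V hanti hLV hb),
    is_mk.2 (FastSeq.ofBound_inter L V hanti hLV hb hL)⟩

end LowerMeas

open LowerMeas

namespace RandomVariable

variable {S : Type*} [TopologicalSpace S]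

theorem pre_mono (Z : RandomVariable P S) : Monotone Z.pre := by
  intro U V h
  have := Z.pre_inf U V
  rw [inf_eq_left.2 h] at this
  exact inf_eq_left.1 this.symm

/-- Continuity covers increasing sequences only; partial suprema together with `pre_sup` reduce an
arbitrary sequence to that case. -/
theorem is_pre_iSup (Z : RandomVariable P S) {U : ℕ → Opens S} {s : ℕ → Set Ω}
    (h : ∀ n, (Z.pre (U n)).Is (s n)) : (Z.pre (⨆ n, U n)).Is (⋃ n, s n) := by
  have h1 : ∀ n, (Z.pre (partialSups U n)).Is (partialSups s n) := by
    intro n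
    induction n with
    | zero => simpa using h 0
    | succ n ih =>
      rw [partialSups_add_one, partialSups_add_one, Z.pre_sup]
      exact ih.sup (h (n + 1))
  rw [← iSup_partialSups_eq U, Z.pre_iSup _ (partialSups U).monotone]
  have h2 := Is.iUnion h1
  have h3 : (⋃ n, partialSups s n) = ⋃ n, s n := iSup_partialSups_eq s
  rwa [h3] at h2

variable {S' : Type*} [TopologicalSpace S'] [MeasurableSpace S']

/-- The measurable function `g` into a larger space represents the random variable `Z`. -/
structure Realizes (i : S → S') (g : Ω → S') (Z : RandomVariable P S) : Prop where
  measurable : Measurable g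
  is_pre : ∀ (U : Opens S) (O : Set S'), IsOpen O → (U : Set S) = i ⁻¹' O →
    (Z.pre U).Is (g ⁻¹' O)

theorem Realizes.congr {i : S → S'} {g g' : Ω → S'} {Z : RandomVariable P S}
    (h : Realizes i g Z) (hg' : Measurable g') (hgg : g =ᵐ[P] g') : Realizes i g' Z where
  measurable := hg'
  is_pre U O hO hU := (h.is_pre U O hO hU).congr (hgg.preimage O)

/-- Both preimages represent the value of `Z` at the same open subset of `S`. This is the usable
form of the claim that `g` stays in the image of `i`, which may fail to be measurable. -/
theorem Realizes.measure_trace {i : S → S'} {g : Ω → S'} {Z : RandomVariable P S}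
    (h : Realizes i g Z) (hi : Continuous i) {O₁ O₂ : Set S'} (h1 : IsOpen O₁) (h2 : IsOpen O₂)
    (h12 : i ⁻¹' O₁ = i ⁻¹' O₂) : P (g ⁻¹' (O₂ \ O₁)) = 0 := by
  have := (h.is_pre ⟨i ⁻¹' O₁, h1.preimage hi⟩ O₁ h1 rfl).ae_eq
    (h.is_pre ⟨i ⁻¹' O₁, h1.preimage hi⟩ O₂ h2 h12)
  rw [Set.preimage_sdiff]
  exact ae_le_set.1 this.symm.le

theorem Realizes.unique {i : S → S'} (hi : Topology.IsInducing i) {g : Ω → S'}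
    {Z Z' : RandomVariable P S} (h : Realizes i g Z) (h' : Realizes i g Z') : Z = Z' := by
  ext U
  obtain ⟨O, hO, hU⟩ := hi.isOpen_iff.1 U.isOpen
  exact congrFun (funext fun _ => (h.is_pre U O hO hU.symm).eq (h'.is_pre U O hO hU.symm)) U

/-- A measurable function into a larger space represents a random variable if open sets with the
same trace have almost surely equal preimages. -/
theorem exists_realizes [P.OuterRegular] [OpensMeasurableSpace S'] {i : S → S'}
    (hi : Topology.IsInducing i) {g : Ω → S'} (hg : Measurable g)
    (h : ∀ O₁ O₂ : Set S', IsOpen O₁ → IsOpen O₂ → O₁ ⊆ O₂ → i ⁻¹' O₁ = i ⁻¹' O₂ →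
      P (g ⁻¹' (O₂ \ O₁)) = 0) :
    ∃ Z : RandomVariable P S, Realizes i g Z := by
  have hle : ∀ O₁ O₂ : Set S', IsOpen O₁ → IsOpen O₂ → i ⁻¹' O₁ = i ⁻¹' O₂ →
      g ⁻¹' O₂ ≤ᵐ[P] g ⁻¹' O₁ := by
    intro O₁ O₂ h1 h2 h12
    -- The hypothesis is about nested open sets, and `O₁ ∪ O₂` has the same trace as `O₁`.
    have := h O₁ (O₁ ∪ O₂) h1 (h1.union h2) Set.subset_union_left (by
      rw [Set.preimage_union, h12, Set.union_self])
    rw [Set.union_sdiff_left, Set.preimage_sdiff] at this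
    exact ae_le_set.2 this
  have heq : ∀ O₁ O₂ : Set S', IsOpen O₁ → IsOpen O₂ → i ⁻¹' O₁ = i ⁻¹' O₂ →
      g ⁻¹' O₁ =ᵐ[P] g ⁻¹' O₂ := fun O₁ O₂ h1 h2 h12 =>
    (hle O₂ O₁ h2 h1 h12.symm).antisymm (hle O₁ O₂ h1 h2 h12)
  have hext : ∀ U : Opens S, ∃ O : Set S', IsOpen O ∧ i ⁻¹' O = U := fun U =>
    hi.isOpen_iff.1 U.isOpen
  choose e he heU using hext
  have hpre : ∀ U : Opens S, ∃ A : LowerMeas P, A.Is (g ⁻¹' e U) := fun U =>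
    exists_is (hg (he U).measurableSet)
  choose pre hpre using hpre
  -- The chosen extensions need not respect unions and intersections, but any extension gives the
  -- same lower-measurable set. So `e U ∩ e V` can be used in place of `e (U ⊓ V)`, and so on.
  have key : ∀ (U : Opens S) (O : Set S'), IsOpen O → (U : Set S) = i ⁻¹' O →
      (pre U).Is (g ⁻¹' O) := fun U O hO hU =>
    (hpre U).congr (heq _ _ (he U) hO ((heU U).trans hU))
  refine ⟨⟨pre, ?_, ?_, ?_, ?_, ?_⟩, ⟨hg, key⟩⟩
  · exact (key ⊥ ∅ isOpen_empty (by simp)).eq (by simpa using is_bot)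
  · exact (key ⊤ Set.univ isOpen_univ (by simp)).eq (by simpa using is_top)
  · intro U V
    exact (key (U ⊓ V) (e U ∩ e V) ((he U).inter (he V)) (by simp [heU])).eq
      ((hpre U).inf (hpre V))
  · intro U V
    exact (key (U ⊔ V) (e U ∪ e V) ((he U).union (he V)) (by simp [heU])).eq
      ((hpre U).sup (hpre V))
  · intro U _
    have := key (⨆ n, U n) (⋃ n, e (U n)) (isOpen_iUnion fun n => he (U n)) (by simp [heU])
    rw [Set.preimage_iUnion] at this
    exact this.eq (Is.iUnion fun n => hpre (U n))

end RandomVariable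

end Representation

/-! ### Measurable representatives in complete separable spaces -/

section Realization

open LowerMeas RandomVariable

variable {Ω : Type*} [TopologicalSpace Ω] [MeasurableSpace Ω] [OpensMeasurableSpace Ω]
  {P : Measure Ω} [IsFiniteMeasure P]
  {S : Type*} [TopologicalSpace S] {S' : Type*} [MetricSpace S'] [CompleteSpace S']
  [SeparableSpace S'] [MeasurableSpace S'] [BorelSpace S']

/-- Every random variable in a space which embeds into a complete separable metric space is
represented by a measurable function into the latter. -/
theorem RandomVariable.exists_fun [Nonempty S'] {i : S → S'} (hi : Continuous i)
    (Z : RandomVariable P S) : ∃ g : Ω → S', Realizes i g Z := by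
  classical
  let c : Opens S' → Opens S := fun O => ⟨i ⁻¹' O, O.isOpen.preimage hi⟩
  let Q : Opens S' → Set Ω := fun O => (Z.pre (c O)).toSet
  let u := denseSeq S'
  let r : ℕ → ℝ := fun n => (1 / 2) ^ n
  have hr : ∀ n, 0 < r n := fun n => by positivity
  have hr0 : Tendsto r atTop (𝓝 0) :=
    tendsto_pow_atTop_nhds_zero_of_lt_one (by norm_num) (by norm_num)
  -- At scale `n`, each `ω` gets the centre of the first ball whose preimage contains it. These
  -- centres form almost surely a Cauchy sequence, whose limit is the function sought.
  let B : ℕ → ℕ → Opens S' := fun n a => ⟨Metric.ball (u a) (r n), Metric.isOpen_ball⟩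
  have hQ : ∀ O, (Z.pre (c O)).Is (Q O) := fun O => is_toSet _
  have hcover : ∀ n, ∀ᵐ ω ∂P, ∃ a, ω ∈ Q (B n a) := by
    intro n
    have h1 := Z.is_pre_iSup (U := fun a => c (B n a)) fun a => hQ (B n a)
    have h2 : (⨆ a, c (B n a)) = ⊤ := by
      ext x
      simp only [Opens.coe_iSup, Set.mem_iUnion, Opens.coe_top, Set.mem_univ, iff_true]
      obtain ⟨a, ha⟩ := (denseRange_denseSeq S').exists_dist_lt (i x) (hr n)
      exact ⟨a, ha⟩
    rw [h2, Z.pre_top] at h1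
    have h3 := h1.ae_eq is_top
    filter_upwards [h3] with ω hω
    exact Set.mem_iUnion.1 ((iff_of_eq hω).2 trivial)
  have hmono : ∀ O₁ O₂ : Opens S', O₁ ≤ O₂ → ∀ᵐ ω ∂P, ω ∈ Q O₁ → ω ∈ Q O₂ := by
    intro O₁ O₂ h
    exact ((hQ O₁).le_iff (hQ O₂)).1 (Z.pre_mono fun x hx => h hx)
  have hmeet : ∀ n a m b, ∀ᵐ ω ∂P, ω ∈ Q (B n a) → ω ∈ Q (B m b) →
      dist (u a) (u b) < r n + r m := by
    intro n a m b
    by_cases hd : dist (u a) (u b) < r n + r m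
    · exact Eventually.of_forall fun _ _ _ => hd
    · have h1 := (hQ (B n a)).inf (hQ (B m b))
      have h2 : c (B n a) ⊓ c (B m b) = ⊥ := by
        ext x
        simp only [Opens.coe_inf, Set.mem_inter_iff, Opens.coe_bot, Set.mem_empty_iff_false,
          iff_false, not_and]
        intro hx hx'
        have e1 : dist (i x) (u a) < r n := hx
        have e2 : dist (i x) (u b) < r m := hx'
        exact hd ((dist_triangle_left _ _ (i x)).trans_lt (add_lt_add e1 e2))
      rw [← Z.pre_inf, h2, Z.pre_bot] at h1
      filter_upwards [h1.ae_eq is_bot] with ω hω h3 h4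
      have : (Q (B n a) ∩ Q (B m b)) ω := ⟨h3, h4⟩
      rw [hω] at this
      exact this.elim
  -- The complement, a null set by `hcover`, is added so that a first index exists for every `ω`.
  let Q' : ℕ → ℕ → Set Ω := fun n a => Q (B n a) ∪ (⋃ a, Q (B n a))ᶜ
  have hQ' : ∀ n ω, ∃ a, ω ∈ Q' n a := by
    intro n ω
    by_cases h : ω ∈ ⋃ a, Q (B n a)
    · obtain ⟨a, ha⟩ := Set.mem_iUnion.1 h
      exact ⟨a, Or.inl ha⟩
    · exact ⟨0, Or.inr h⟩
  let j : ℕ → Ω → ℕ := fun n ω => Nat.find (hQ' n ω)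
  have hj : ∀ n, Measurable (j n) := fun n => measurable_find (hQ' n) fun a =>
    (measurableSet_toSet _).union (MeasurableSet.iUnion fun a => measurableSet_toSet _).compl
  have hjmem : ∀ᵐ ω ∂P, ∀ n, ω ∈ Q (B n (j n ω)) := by
    filter_upwards [ae_all_iff.2 hcover] with ω hω n
    rcases Nat.find_spec (hQ' n ω) with h | h
    · exact h
    · exact (h (Set.mem_iUnion.2 (hω n))).elim
  have hmeet' : ∀ᵐ ω ∂P, ∀ n a m b, ω ∈ Q (B n a) → ω ∈ Q (B m b) →
      dist (u a) (u b) < r n + r m := by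
    simp only [ae_all_iff]
    exact hmeet
  have hlim : ∀ᵐ ω ∂P, ∃ l, Tendsto (fun n => u (j n ω)) atTop (𝓝 l) := by
    filter_upwards [hjmem, hmeet'] with ω h1 h2
    refine cauchySeq_tendsto_of_complete (Metric.cauchySeq_iff'.2 fun ε hε => ?_)
    obtain ⟨N, hN⟩ := (hr0.eventually (gt_mem_nhds (half_pos hε))).exists
    refine ⟨N, fun n hn => (h2 n _ N _ (h1 n) (h1 N)).trans_le ?_⟩
    have : r n ≤ r N := pow_le_pow_of_le_one (by norm_num) (by norm_num) hn
    linarith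
  obtain ⟨g, hg, hglim⟩ := measurable_limit_of_tendsto_metrizable_ae (L := atTop)
    (f := fun n ω => u (j n ω)) (fun n => ((measurable_from_top (f := u)).comp (hj n)).aemeasurable) hlim
  have hgd : ∀ᵐ ω ∂P, ∀ n a, ω ∈ Q (B n a) → dist (g ω) (u a) ≤ r n := by
    filter_upwards [hjmem, hmeet', hglim] with ω h1 h2 h3 n a h4
    refine le_of_tendsto_of_tendsto' (h3.dist tendsto_const_nhds)
      (by simpa using hr0.add_const (r n)) fun m => (h2 m _ n a (h1 m) h4).le
  refine ⟨g, hg, fun U O hO hU => ?_⟩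
  obtain rfl : U = c ⟨O, hO⟩ := Opens.ext hU
  refine (hQ ⟨O, hO⟩).congr ?_
  -- `O` is the union of the balls whose closures are still inside `O`. Closed balls are needed
  -- because the limit `g ω` satisfies `hgd` with `≤` only.
  have hsub : ∀ᵐ ω ∂P, ω ∈ Q ⟨O, hO⟩ →
      ∃ n a, Metric.closedBall (u a) (r n) ⊆ O ∧ ω ∈ Q (B n a) := by
    let V : ℕ → Opens S' := fun k =>
      if Metric.closedBall (u k.unpair.2) (r k.unpair.1) ⊆ O then B k.unpair.1 k.unpair.2 else ⊥
    have h1 := Z.is_pre_iSup (U := fun k => c (V k)) fun k => hQ (V k)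
    have h2 : (⨆ k, c (V k)) = c ⟨O, hO⟩ := by
      ext x
      simp only [Opens.coe_iSup, Set.mem_iUnion]
      constructor
      · rintro ⟨k, hk⟩
        have hk : i x ∈ V k := hk
        by_cases h : Metric.closedBall (u k.unpair.2) (r k.unpair.1) ⊆ O
        · simp only [V, h, if_true] at hk
          exact h (Metric.ball_subset_closedBall hk)
        · simp [V, h] at hk
      · intro hx
        obtain ⟨ε, hε, h⟩ := Metric.isOpen_iff.1 hO (i x) hx
        obtain ⟨n, hn⟩ := (hr0.eventually (gt_mem_nhds (half_pos hε))).exists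
        obtain ⟨a, ha⟩ := (denseRange_denseSeq S').exists_dist_lt (i x) (hr n)
        have hc : Metric.closedBall (u a) (r n) ⊆ O := by
          refine (fun y hy => h ?_)
          have e1 : dist y (u a) ≤ r n := hy
          have e2 : dist y (i x) ≤ dist y (u a) + dist (u a) (i x) := dist_triangle _ _ _
          have e3 : dist (u a) (i x) < r n := by rw [dist_comm]; exact ha
          exact Metric.mem_ball.2 (by linarith)
        refine ⟨Nat.pair n a, ?_⟩
        change i x ∈ V _
        simp only [V, Nat.unpair_pair, hc, if_true]
        exact ha
    rw [h2] at h1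
    -- The representative chosen for the empty set need not be empty, only null.
    have h3 : (Z.pre (c ⊥)).Is ∅ := by
      have : c ⊥ = ⊥ := Opens.ext rfl
      rw [this, Z.pre_bot]
      exact is_bot
    filter_upwards [h1.ae_eq (hQ ⟨O, hO⟩), (hQ ⊥).ae_eq h3] with ω hω hbot h3
    obtain ⟨k, hk⟩ := Set.mem_iUnion.1 ((iff_of_eq hω).2 h3)
    by_cases h : Metric.closedBall (u k.unpair.2) (r k.unpair.1) ⊆ O
    · simp only [V, h, if_true] at hk
      exact ⟨_, _, h, hk⟩
    · simp only [V, h, if_false] at hk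
      exact ((iff_of_eq hbot).1 hk).elim
  have hsup : ∀ᵐ ω ∂P, ∀ n a, B n a ≤ ⟨O, hO⟩ → ω ∈ Q (B n a) → ω ∈ Q ⟨O, hO⟩ := by
    simp only [ae_all_iff]
    intro n a h
    exact hmono _ _ h
  filter_upwards [hsub, hsup, hgd, hjmem] with ω h1 h2 h3 h4
  refine propext ⟨fun h => ?_, fun h => ?_⟩
  · obtain ⟨n, a, hna, ha⟩ := h1 h
    exact hna (h3 n a ha)
  · obtain ⟨ε, hε, hε'⟩ := Metric.isOpen_iff.1 hO (g ω) h
    obtain ⟨n, hn⟩ := (hr0.eventually (gt_mem_nhds (half_pos hε))).exists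
    refine h2 n (j n ω) (fun y hy => hε' ?_) (h4 n)
    have e1 : dist y (u (j n ω)) < r n := hy
    have e2 := h3 n _ (h4 n)
    have e3 := dist_triangle_right y (g ω) (u (j n ω))
    exact Metric.mem_ball.2 (by linarith)

end Realization

end CondRV

namespace CondRV

/-! ### Convergence of random variables as convergence in measure -/

section Convergence

open LowerMeas RandomVariable

variable {Ω : Type*} [MeasurableSpace Ω] {P : Measure Ω} [IsFiniteMeasure P]
  {S' : Type*} [MetricSpace S'] [MeasurableSpace S'] [BorelSpace S']

/-- A point of an open set has positive distance from the complement, so the margins decrease to the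
empty set. The extended distance also covers an empty complement. -/
theorem tendsto_measure_margin {g : Ω → S'} (hg : Measurable g) {O : Set S'} (hO : IsOpen O) :
    Tendsto (fun k : ℕ => P (g ⁻¹' {x | x ∈ O ∧ Metric.infEDist x Oᶜ < (2⁻¹ : ℝ≥0∞) ^ k}))
      atTop (𝓝 0) := by
  have hm : ∀ k : ℕ, MeasurableSet {x | x ∈ O ∧ Metric.infEDist x Oᶜ < (2⁻¹ : ℝ≥0∞) ^ k} :=
    fun k => hO.measurableSet.inter (measurable_infEDist measurableSet_Iio)
  have h := tendsto_measure_iInter_atTop (μ := P)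
    (s := fun k : ℕ => g ⁻¹' {x | x ∈ O ∧ Metric.infEDist x Oᶜ < (2⁻¹ : ℝ≥0∞) ^ k})
    (fun k => (hg (hm k)).nullMeasurableSet)
    (fun k l hkl ω hω => ⟨hω.1, hω.2.trans_le
      (pow_le_pow_of_le_one (by simp) (by simp) hkl)⟩) ⟨0, measure_ne_top _ _⟩
  have h0 : (⋂ k : ℕ, g ⁻¹' {x | x ∈ O ∧ Metric.infEDist x Oᶜ < (2⁻¹ : ℝ≥0∞) ^ k}) = ∅ := by
    refine Set.eq_empty_of_forall_notMem fun ω hω => ?_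
    have hω := Set.mem_iInter.1 hω
    have h1 : 0 < Metric.infEDist (g ω) Oᶜ := by
      rw [Metric.infEDist_pos_iff_notMem_closure, hO.isClosed_compl.closure_eq]
      exact fun h => h (hω 0).1
    obtain ⟨k, hk⟩ := (FastSeq.pow_tendsto.eventually (gt_mem_nhds h1)).exists
    exact lt_asymm hk (hω k).2
  rw [h0, measure_empty] at h
  exact h

/-- If `g ω` is in `O` but `gs n ω` is not, then `g ω` is in a thin margin of `O` or the two values
are far apart. -/
theorem TendstoInMeasure.tendsto_measure_sdiff {gs : ℕ → Ω → S'} {g : Ω → S'}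
    (hg : Measurable g) (h : TendstoInMeasure P gs atTop g) {O : Set S'} (hO : IsOpen O) :
    Tendsto (fun n => P (g ⁻¹' O \ gs n ⁻¹' O)) atTop (𝓝 0) := by
  refine ENNReal.tendsto_nhds_zero.2 fun ε hε => ?_
  have hε2 : 0 < ε / 2 := ENNReal.half_pos hε.ne'
  obtain ⟨k, hk⟩ := ((ENNReal.tendsto_nhds_zero.1 (tendsto_measure_margin (P := P) hg hO)) _
    hε2).exists
  filter_upwards [(ENNReal.tendsto_nhds_zero.1
    (h ((2⁻¹ : ℝ≥0∞) ^ k) (ENNReal.pow_pos (by simp) k))) _ hε2] with n hn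
  calc P (g ⁻¹' O \ gs n ⁻¹' O)
      ≤ P (g ⁻¹' {x | x ∈ O ∧ Metric.infEDist x Oᶜ < (2⁻¹ : ℝ≥0∞) ^ k} ∪
        {ω | (2⁻¹ : ℝ≥0∞) ^ k ≤ edist (gs n ω) (g ω)}) := by
        refine measure_mono ?_
        rintro ω ⟨h1, h2⟩
        by_cases h3 : Metric.infEDist (g ω) Oᶜ < (2⁻¹ : ℝ≥0∞) ^ k
        · exact Or.inl ⟨h1, h3⟩
        · refine Or.inr ((not_lt.1 h3).trans ?_)
          rw [edist_comm]
          exact Metric.infEDist_le_edist_of_mem h2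
    _ ≤ ε / 2 + ε / 2 := (measure_union_le _ _).trans (add_le_add hk hn)
    _ = ε := ENNReal.add_halves ε

/-- Finitely many balls of radius `δ / 2` contain `g` up to a small probability. Where `gs n`
follows `g` into such a ball, the two values differ by less than `δ`. -/
theorem tendstoInMeasure_of_tendsto_measure_sdiff [SeparableSpace S'] {gs : ℕ → Ω → S'}
    {g : Ω → S'} (hg : Measurable g)
    (h : ∀ O : Set S', IsOpen O → Tendsto (fun n => P (g ⁻¹' O \ gs n ⁻¹' O)) atTop (𝓝 0)) :
    TendstoInMeasure P gs atTop g := by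
  rcases isEmpty_or_nonempty S' with hS | hS
  · have : IsEmpty Ω := ⟨fun ω => hS.elim (g ω)⟩
    intro ε hε
    have : ∀ s : Set Ω, P s = 0 := fun s => by rw [Set.eq_empty_of_isEmpty s, measure_empty]
    simp [this]
  rw [tendstoInMeasure_iff_dist]
  intro δ hδ
  refine ENNReal.tendsto_nhds_zero.2 fun ε hε => ?_
  have hε2 : 0 < ε / 2 := ENNReal.half_pos hε.ne'
  let B : ℕ → Set S' := fun a => Metric.ball (denseSeq S' a) (δ / 2)
  have h1 := tendsto_measure_iInter_atTop (μ := P)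
    (s := fun N : ℕ => ⋂ a ∈ Finset.range N, (g ⁻¹' B a)ᶜ)
    (fun N => (Finset.measurableSet_biInter _ fun a _ =>
      (hg Metric.isOpen_ball.measurableSet).compl).nullMeasurableSet)
    (fun N M hNM => Set.biInter_subset_biInter_left fun a ha => by
      simp only [Finset.coe_range, Set.mem_Iio] at ha ⊢
      exact lt_of_lt_of_le ha hNM) ⟨0, measure_ne_top _ _⟩
  have h0 : (⋂ N : ℕ, ⋂ a ∈ Finset.range N, (g ⁻¹' B a)ᶜ) = ∅ := by
    refine Set.eq_empty_of_forall_notMem fun ω hω => ?_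
    obtain ⟨a, ha⟩ := (denseRange_denseSeq S').exists_dist_lt (g ω) (half_pos hδ)
    have h2 := Set.mem_iInter₂.1 (Set.mem_iInter.1 hω (a + 1)) a (by simp)
    exact h2 ha
  rw [h0, measure_empty] at h1
  obtain ⟨N, hN⟩ := (ENNReal.tendsto_nhds_zero.1 h1 _ hε2).exists
  have h2 : Tendsto (fun n => ∑ a ∈ Finset.range N, P (g ⁻¹' B a \ gs n ⁻¹' B a)) atTop (𝓝 0) := by
    simpa using tendsto_finsetSum (Finset.range N) fun a _ => h (B a) Metric.isOpen_ball
  filter_upwards [ENNReal.tendsto_nhds_zero.1 h2 _ hε2] with n hn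
  calc P {ω | δ ≤ dist (gs n ω) (g ω)}
      ≤ P ((⋂ a ∈ Finset.range N, (g ⁻¹' B a)ᶜ) ∪
          ⋃ a ∈ Finset.range N, (g ⁻¹' B a \ gs n ⁻¹' B a)) := by
        refine measure_mono fun ω hω => ?_
        by_cases h3 : ω ∈ ⋂ a ∈ Finset.range N, (g ⁻¹' B a)ᶜ
        · exact Or.inl h3
        · simp only [Set.mem_iInter, not_forall] at h3
          obtain ⟨a, ha, h3⟩ := h3
          have h3 : g ω ∈ B a := not_not.1 h3
          refine Or.inr (Set.mem_biUnion ha ⟨h3, fun h4 => ?_⟩)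
          have h4 : dist (gs n ω) (denseSeq S' a) < δ / 2 := h4
          have h3 : dist (g ω) (denseSeq S' a) < δ / 2 := h3
          have h5 := dist_triangle_right (gs n ω) (g ω) (denseSeq S' a)
          have h6 : δ ≤ dist (gs n ω) (g ω) := hω
          linarith
    _ ≤ ε / 2 + ε / 2 := (measure_union_le _ _).trans
        (add_le_add hN ((measure_biUnion_finset_le _ _).trans hn))
    _ = ε := ENNReal.add_halves ε

/-- A sequence of measurable functions which is Cauchy in measure converges in measure. -/
theorem exists_tendstoInMeasure_of_cauchy [CompleteSpace S'] [SeparableSpace S']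
    {gs : ℕ → Ω → S'} (hgs : ∀ n, Measurable (gs n))
    (h : ∀ δ : ℝ, 0 < δ → ∀ ε : ℝ≥0∞, 0 < ε →
      ∃ N, ∀ n m, N ≤ n → N ≤ m → P {ω | δ ≤ dist (gs n ω) (gs m ω)} ≤ ε) :
    ∃ g : Ω → S', Measurable g ∧ TendstoInMeasure P gs atTop g := by
  have h1 : ∀ k : ℕ, ∃ N, ∀ n m, N ≤ n → N ≤ m →
      P {ω | (1 / 2 : ℝ) ^ k ≤ dist (gs n ω) (gs m ω)} ≤ (2⁻¹ : ℝ≥0∞) ^ k := fun k =>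
    h _ (by positivity) _ (ENNReal.pow_pos (by simp) k)
  choose N hN using h1
  -- The maximum guarantees `N k ≤ φ l` for all `l ≥ k`; the summand `k` makes `φ` tend to infinity.
  -- Borel–Cantelli then gives almost sure convergence along `φ`.
  let φ : ℕ → ℕ := fun k => (Finset.range (k + 1)).sup N + k
  have hφN : ∀ k l, k ≤ l → N k ≤ φ l := fun k l hkl =>
    (Finset.le_sup (f := N) (Finset.mem_range.2 (by lia))).trans (Nat.le_add_right _ _)
  have hφ : Tendsto φ atTop atTop := tendsto_atTop_mono (fun k => Nat.le_add_left _ _) tendsto_id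
  have hbc := ae_eventually_notMem (μ := P)
    (s := fun k => {ω | (1 / 2 : ℝ) ^ k ≤ dist (gs (φ k) ω) (gs (φ (k + 1)) ω)}) (by
      refine ne_top_of_le_ne_top ?_
        (ENNReal.tsum_le_tsum fun k => hN k _ _ (hφN k k le_rfl) (hφN k (k + 1) (by lia)))
      rw [ENNReal.tsum_geometric]
      simp [ENNReal.one_sub_inv_two])
  have hlim : ∀ᵐ ω ∂P, ∃ l, Tendsto (fun k => gs (φ k) ω) atTop (𝓝 l) := by
    filter_upwards [hbc] with ω hω
    refine cauchySeq_tendsto_of_complete (cauchySeq_of_summable_dist ?_)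
    refine Summable.of_norm_bounded_eventually_nat (g := fun k : ℕ => (1 / 2 : ℝ) ^ k)
      summable_geometric_two ?_
    filter_upwards [hω] with k hk
    rw [Real.norm_of_nonneg dist_nonneg]
    exact (not_le.1 hk).le
  obtain ⟨g, hg, hglim⟩ := measurable_limit_of_tendsto_metrizable_ae (L := atTop)
    (f := fun k ω => gs (φ k) ω) (fun k => (hgs _).aemeasurable) hlim
  refine ⟨g, hg, tendstoInMeasure_iff_dist.2 fun δ hδ => ENNReal.tendsto_nhds_zero.2
    fun ε hε => ?_⟩
  have hε2 : 0 < ε / 2 := ENNReal.half_pos hε.ne'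
  have h2 := tendstoInMeasure_iff_dist.1 (tendstoInMeasure_of_tendsto_ae (μ := P)
    (fun k => (hgs (φ k)).aestronglyMeasurable) hglim) (δ / 2) (half_pos hδ)
  obtain ⟨M, hM⟩ := h (δ / 2) (half_pos hδ) _ hε2
  obtain ⟨k, hk, hk'⟩ := ((ENNReal.tendsto_nhds_zero.1 h2 _ hε2).and
    (hφ.eventually_ge_atTop M)).exists
  filter_upwards [eventually_ge_atTop M] with n hn
  calc P {ω | δ ≤ dist (gs n ω) (g ω)}
      ≤ P ({ω | δ / 2 ≤ dist (gs n ω) (gs (φ k) ω)} ∪ {ω | δ / 2 ≤ dist (gs (φ k) ω) (g ω)}) := by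
        refine measure_mono fun ω hω => ?_
        by_contra h3
        simp only [Set.mem_union, not_or] at h3
        have h4 : dist (gs n ω) (gs (φ k) ω) < δ / 2 := not_le.1 h3.1
        have h5 : dist (gs (φ k) ω) (g ω) < δ / 2 := not_le.1 h3.2
        have h6 := dist_triangle (gs n ω) (gs (φ k) ω) (g ω)
        have h7 : δ ≤ dist (gs n ω) (g ω) := hω
        linarith
    _ ≤ ε / 2 + ε / 2 := (measure_union_le _ _).trans (add_le_add (hM n _ hn hk') hk)
    _ = ε := ENNReal.add_halves ε

variable [TopologicalSpace Ω] [OpensMeasurableSpace Ω] {S : Type*} [TopologicalSpace S]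

/-- The finite measure of `g ⁻¹' O` splits into the part shared with `gs n ⁻¹' O` and the
difference. The lower limit of the former attains the total exactly if the latter vanishes in the
limit. -/
theorem converges_iff_tendsto_measure_sdiff {i : S → S'} (hi : Topology.IsInducing i)
    {Zs : ℕ → RandomVariable P S} {Z : RandomVariable P S} {gs : ℕ → Ω → S'} {g : Ω → S'}
    (hgs : ∀ n, Realizes i (gs n) (Zs n)) (hg : Realizes i g Z) :
    Converges Zs Z ↔
      ∀ O : Set S', IsOpen O → Tendsto (fun n => P (g ⁻¹' O \ gs n ⁻¹' O)) atTop (𝓝 0) := by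
  have key : ∀ (U : Opens S) (O : Set S'), IsOpen O → (U : Set S) = i ⁻¹' O →
      ((Z.pre U).prob ≤ liminf (fun n => ((Zs n).pre U ⊓ Z.pre U).prob) atTop ↔
        Tendsto (fun n => P (g ⁻¹' O \ gs n ⁻¹' O)) atTop (𝓝 0)) := by
    intro U O hO hU
    have h1 : ∀ n, ((Zs n).pre U ⊓ Z.pre U).prob = P (gs n ⁻¹' O ∩ g ⁻¹' O) := fun n =>
      (((hgs n).is_pre U O hO hU).inf (hg.is_pre U O hO hU)).prob_eq
    have h2 : ∀ n, P (g ⁻¹' O) = P (gs n ⁻¹' O ∩ g ⁻¹' O) + P (g ⁻¹' O \ gs n ⁻¹' O) := by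
      intro n
      rw [Set.inter_comm]
      exact (measure_inter_add_sdiff _ ((hgs n).measurable hO.measurableSet)).symm
    simp only [h1, (hg.is_pre U O hO hU).prob_eq]
    constructor
    · intro h
      refine ENNReal.tendsto_nhds_zero.2 fun ε hε => ?_
      rcases eq_or_ne (P (g ⁻¹' O)) 0 with h0 | h0
      · refine Eventually.of_forall fun n => ?_
        have : P (g ⁻¹' O \ gs n ⁻¹' O) = 0 := measure_mono_null Set.sdiff_subset h0
        rw [this]
        exact bot_le
      · have h3 : P (g ⁻¹' O) - ε < P (g ⁻¹' O) :=
          ENNReal.sub_lt_self (measure_ne_top _ _) h0 hε.ne'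
        filter_upwards [eventually_lt_of_lt_liminf (h3.trans_le h)] with n hn
        have h4 : P (g ⁻¹' O) ≤ P (gs n ⁻¹' O ∩ g ⁻¹' O) + ε := tsub_le_iff_right.1 hn.le
        rw [h2 n] at h4
        exact (ENNReal.add_le_add_iff_left (measure_ne_top _ _)).1 h4
    · intro h
      refine ENNReal.le_of_forall_pos_le_add fun ε hε _ => ?_
      rw [← tsub_le_iff_right]
      refine le_liminf_of_le (by isBoundedDefault) ?_
      filter_upwards [ENNReal.tendsto_nhds_zero.1 h ε (by exact_mod_cast hε)] with n hn
      rw [tsub_le_iff_right, h2 n]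
      exact add_le_add le_rfl hn
  constructor
  · intro h O hO
    exact (key ⟨i ⁻¹' O, hO.preimage hi.continuous⟩ O hO rfl).1 (h _)
  · intro h U
    obtain ⟨O, hO, hU⟩ := hi.isOpen_iff.1 U.isOpen
    exact (key U O hO hU.symm).2 (h O hO)

/-- Convergence of random variables is convergence in measure of the representing functions. -/
theorem converges_iff_tendstoInMeasure [SeparableSpace S'] {i : S → S'}
    (hi : Topology.IsInducing i) {Zs : ℕ → RandomVariable P S} {Z : RandomVariable P S}
    {gs : ℕ → Ω → S'} {g : Ω → S'} (hgs : ∀ n, Realizes i (gs n) (Zs n)) (hg : Realizes i g Z) :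
    Converges Zs Z ↔ TendstoInMeasure P gs atTop g :=
  (converges_iff_tendsto_measure_sdiff hi hgs hg).trans
    ⟨fun h => tendstoInMeasure_of_tendsto_measure_sdiff hg.measurable h,
      fun h _ hO => TendstoInMeasure.tendsto_measure_sdiff hg.measurable h hO⟩

end Convergence

end CondRV

namespace CondRV

/-! ### Simple random variables and their joint random variables -/

section Simple

open LowerMeas RandomVariable

/-- The exceptional null set may depend on the open set; a countable basis gives one null set for
all, and points are separated by open sets. -/
theorem ae_eq_of_forall_isOpen {Ω : Type*} [MeasurableSpace Ω] {P : Measure Ω}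
    {S' : Type*} [TopologicalSpace S'] [SecondCountableTopology S'] [T0Space S'] {f g : Ω → S'}
    {s : Set Ω} (h : ∀ O : Set S', IsOpen O → ∀ᵐ ω ∂P, ω ∈ s → (f ω ∈ O ↔ g ω ∈ O)) :
    ∀ᵐ ω ∂P, ω ∈ s → f ω = g ω := by
  have hb := isBasis_countableBasis S'
  have h1 : ∀ᵐ ω ∂P, ∀ O ∈ countableBasis S', ω ∈ s → (f ω ∈ O ↔ g ω ∈ O) :=
    (ae_ball_iff (countable_countableBasis S')).2 fun O hO => h O (hb.isOpen hO)
  filter_upwards [h1] with ω hω hs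
  exact (hb.inseparable_iff.2 fun O hO => hω O hO hs).eq

variable {Ω : Type*} [TopologicalSpace Ω] [MeasurableSpace Ω] [OpensMeasurableSpace Ω]
  {P : Measure Ω} [IsProbabilityMeasure P]
  {X Y X' Y' : Type*} [MetricSpace X] [MetricSpace Y] [MetricSpace X'] [MetricSpace Y']
  [MeasurableSpace X'] [BorelSpace X'] [MeasurableSpace Y'] [BorelSpace Y']
  {iX : X → X'} {iY : Y → Y'}

namespace RandomVariable

/-- Finite sets are closed, so the complement of any set of values is open. Removing all values
leaves a null set, and removing all but one isolates `A j`, as the values are distinct. -/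
theorem TakesValues.is_value (hi : Isometry iX) {S : RandomVariable P X} {g : Ω → X'}
    (hg : Realizes iX g S) {k : ℕ} {x : Fin k → X} {A : Fin k → LowerMeas P}
    (h : S.TakesValues x A) :
    (∀ᵐ ω ∂P, ∃ j, g ω = iX (x j)) ∧ ∀ j, (A j).Is {ω | g ω = iX (x j)} := by
  classical
  have h1 : ∀ (F : Finset (Fin k)) (U : Opens X),
      (U : Set X) = iX ⁻¹' (((fun j => iX (x j)) '' (F : Set (Fin k)))ᶜ) →
        (Finset.univ.filter fun j => x j ∈ U) = Fᶜ := by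
    intro F U hU
    ext j
    have h2 : x j ∈ U ↔ x j ∈ (U : Set X) := Iff.rfl
    simp only [Finset.mem_filter, Finset.mem_univ, true_and, Finset.mem_compl]
    rw [h2, hU]
    simp only [Set.mem_preimage, Set.mem_compl_iff, Set.mem_image, Finset.mem_coe, not_exists,
      not_and]
    exact ⟨fun h3 hj => h3 j hj rfl, fun h3 j' hj' h4 => h3 (h.1 (hi.injective h4) ▸ hj')⟩
  have h2 : ∀ F : Finset (Fin k),
      (Fᶜ.sup A).Is (g ⁻¹' (((fun j => iX (x j)) '' (F : Set (Fin k)))ᶜ)) := by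
    intro F
    have hO : IsOpen (((fun j => iX (x j)) '' (F : Set (Fin k)))ᶜ) :=
      (F.finite_toSet.image _).isClosed.isOpen_compl
    have := hg.is_pre ⟨_, hO.preimage hi.continuous⟩ _ hO rfl
    rwa [h.2, h1 F _ rfl] at this
  have h3 : ∀ᵐ ω ∂P, ∃ j, g ω = iX (x j) := by
    have h4 := h2 Finset.univ
    rw [Finset.compl_univ, Finset.sup_empty] at h4
    filter_upwards [h4.ae_eq is_bot] with ω hω
    by_contra h5
    refine (iff_of_eq hω).1 ?_
    rintro ⟨j, -, hj⟩
    exact h5 ⟨j, hj.symm⟩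
  refine ⟨h3, fun j => ?_⟩
  have h4 := h2 ({j}ᶜ)
  rw [compl_compl, Finset.sup_singleton] at h4
  refine h4.congr ?_
  filter_upwards [h3] with ω hω
  refine propext ⟨fun h5 => ?_, fun h5 => ?_⟩
  · obtain ⟨j', hj'⟩ := hω
    by_cases hjj : j' = j
    · rw [← hjj]; exact hj'
    · exact (h5 ⟨j', by simpa using hjj, hj'.symm⟩).elim
  · rintro ⟨j', hj', h6⟩
    have h5 : g ω = iX (x j) := h5
    have h6 : iX (x j') = g ω := h6
    have := h.1 (hi.injective (h6.trans h5))
    simp [this] at hj'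

theorem IsSimple.exists_finset (hi : Isometry iX) {S : RandomVariable P X} {g : Ω → X'}
    (hg : Realizes iX g S) (h : S.IsSimple) : ∃ F : Finset X, ∀ᵐ ω ∂P, ∃ x ∈ F, g ω = iX x := by
  classical
  obtain ⟨k, x, A, h⟩ := h
  refine ⟨Finset.univ.image x, ?_⟩
  filter_upwards [(h.is_value hi hg).1] with ω ⟨j, hj⟩
  exact ⟨x j, by simp, hj⟩

/-- Measurability speaks of open sets only, but a level set is almost surely the preimage of the
open complement of the finitely many other values. -/
theorem IsSimple.exists_mem (hi : Isometry iX) {S : RandomVariable P X} {g : Ω → X'}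
    (hg : Realizes iX g S) (h : S.IsSimple) {T : MeasureTopology P} (hT : S.MeasurableWrt T)
    (x : X) : ∃ A ∈ T.carrier, A.Is {ω | g ω = iX x} := by
  classical
  obtain ⟨F, hF⟩ := h.exists_finset hi hg
  have hO : IsOpen ((iX '' (F.erase x : Set X))ᶜ) :=
    ((F.erase x).finite_toSet.image _).isClosed.isOpen_compl
  refine ⟨S.pre ⟨_, hO.preimage hi.continuous⟩, hT _, (hg.is_pre _ _ hO rfl).congr ?_⟩
  filter_upwards [hF] with ω ⟨x', hx', h1⟩
  refine propext ⟨fun h2 => ?_, ?_⟩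
  · by_contra h3
    refine h2 ⟨x', ?_, h1.symm⟩
    refine Finset.mem_coe.2 (Finset.mem_erase.2 ⟨?_, hx'⟩)
    rintro rfl
    exact h3 h1
  · rintro h2 ⟨x'', h3, h4⟩
    have h2 : g ω = iX x := h2
    exact (Finset.mem_erase.1 (Finset.mem_coe.1 h3)).1 (hi.injective (h4.trans h2))

end RandomVariable

variable [SeparableSpace X'] [SeparableSpace Y']

section Joint

variable {S : RandomVariable P X} {Yc : ConditionalRV P X Y} {g : Ω → X'} {y : X → Ω → Y'}

/-- The defining formula on rectangles determines the coordinates: rectangles `O × Y'` give the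
first one, and rectangles `X' × V` the second one on each level set. -/
theorem IsSimpleJoint.ae_eq (hiX : Isometry iX) (hiY : Isometry iY) {Z : RandomVariable P (X × Y)}
    {G : Ω → X' × Y'} (hg : Realizes iX g S) (hy : ∀ x, Realizes iY (y x) (Yc.toFun x))
    (hG : Realizes (Prod.map iX iY) G Z) (h : IsSimpleJoint S Yc Z) :
    (∀ᵐ ω ∂P, (G ω).1 = g ω) ∧ ∀ x, ∀ᵐ ω ∂P, g ω = iX x → (G ω).2 = y x ω := by
  classical
  have : SecondCountableTopology X' := UniformSpace.secondCountable_of_separable X'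
  have : SecondCountableTopology Y' := UniformSpace.secondCountable_of_separable Y'
  obtain ⟨k, x, A, hS, hZ⟩ := h
  obtain ⟨hval, hA⟩ := hS.is_value hiX hg
  have key : ∀ (O : Set X') (V : Set Y'), IsOpen O → IsOpen V →
      ∀ᵐ ω ∂P, ((G ω).1 ∈ O ∧ (G ω).2 ∈ V) ↔
        ∃ j, iX (x j) ∈ O ∧ g ω = iX (x j) ∧ y (x j) ω ∈ V := by
    intro O V hO hV
    let O' : Opens X := ⟨_, hO.preimage hiX.continuous⟩
    let V' : Opens Y := ⟨_, hV.preimage hiY.continuous⟩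
    have h1 := hG.is_pre (prodOpens O' V') (O ×ˢ V) (hO.prod hV)
      (Set.preimage_prod_map_prod _ _ _ _).symm
    rw [hZ] at h1
    have h2 := h1.ae_eq (Is.finset_sup fun j _ =>
      (hA j).inf ((hy (x j)).is_pre V' V hV rfl))
    filter_upwards [h2] with ω hω
    refine (iff_of_eq hω).trans ?_
    refine Iff.trans (b := ω ∈ ⋃ j ∈ Finset.univ.filter fun j => x j ∈ O',
      ({ω | g ω = iX (x j)} ∩ y (x j) ⁻¹' V)) Iff.rfl ?_
    simp only [Finset.mem_filter, Finset.mem_univ, true_and, Set.mem_iUnion, exists_prop]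
    exact Iff.rfl
  constructor
  · have h1 := ae_eq_of_forall_isOpen (P := P) (f := fun ω => (G ω).1) (g := g) (s := Set.univ)
      (fun O hO => by
        filter_upwards [key O Set.univ hO isOpen_univ, hval] with ω h1 ⟨j, hj⟩ _
        simp only [Set.mem_univ, and_true] at h1
        rw [h1]
        refine ⟨fun ⟨j, hj, hj'⟩ => hj' ▸ hj, fun h2 => ⟨j, hj ▸ h2, hj⟩⟩)
    filter_upwards [h1] with ω hω using hω trivial
  · intro x₀
    refine ae_eq_of_forall_isOpen (P := P) (f := fun ω => (G ω).2) (g := y x₀)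
      (s := {ω | g ω = iX x₀}) fun V hV => ?_
    filter_upwards [key Set.univ V isOpen_univ hV, hval] with ω h1 ⟨j, hj⟩ (h2 : g ω = iX x₀)
    simp only [Set.mem_univ, true_and] at h1
    rw [h1]
    constructor
    · rintro ⟨j', hj', h3⟩
      rwa [← hiX.injective (hj'.symm.trans h2)]
    · intro h3
      refine ⟨j, hj, ?_⟩
      rwa [hiX.injective (hj.symm.trans h2)]

/-- Two representing functions agree almost surely on each of finitely many level sets, by
`IsSimpleJoint.ae_eq`. -/
theorem isSimpleJoint_unique [CompleteSpace X'] [CompleteSpace Y'] [Nonempty X'] [Nonempty Y']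
    (hiX : Isometry iX) (hiY : Isometry iY) (hS : S.IsSimple) {Z Z' : RandomVariable P (X × Y)}
    (h : IsSimpleJoint S Yc Z) (h' : IsSimpleJoint S Yc Z') : Z = Z' := by
  have : SecondCountableTopology X' := UniformSpace.secondCountable_of_separable X'
  have : SecondCountableTopology Y' := UniformSpace.secondCountable_of_separable Y'
  obtain ⟨g, hg⟩ := RandomVariable.exists_fun (S' := X') hiX.continuous S
  choose y hy using fun x => RandomVariable.exists_fun (S' := Y') hiY.continuous (Yc.toFun x)
  have hi : Topology.IsInducing (Prod.map iX iY) :=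
    (hiX.isUniformInducing.isInducing).prodMap hiY.isUniformInducing.isInducing
  obtain ⟨G, hG⟩ := RandomVariable.exists_fun (S' := X' × Y') hi.continuous Z
  obtain ⟨G', hG'⟩ := RandomVariable.exists_fun (S' := X' × Y') hi.continuous Z'
  obtain ⟨h1, h2⟩ := h.ae_eq hiX hiY hg hy hG
  obtain ⟨h1', h2'⟩ := h'.ae_eq hiX hiY hg hy hG'
  obtain ⟨F, hF⟩ := hS.exists_finset hiX hg
  have h3 : G' =ᵐ[P] G := by
    have h4 : ∀ᵐ ω ∂P, ∀ x ∈ F, (g ω = iX x → (G ω).2 = y x ω) ∧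
        (g ω = iX x → (G' ω).2 = y x ω) :=
      (ae_ball_iff F.countable_toSet).2 fun x _ => (h2 x).and (h2' x)
    filter_upwards [h1, h1', hF, h4] with ω e1 e1' ⟨x, hx, e2⟩ e3
    exact Prod.ext (e1'.trans e1.symm) (((e3 x hx).2 e2).trans ((e3 x hx).1 e2).symm)
  exact hG.unique hi (hG'.congr hG.measurable h3)

/-- The function `ω ↦ (x, y x ω)`, with `x` the value at `ω`, is glued from finitely many pieces.
Its trace condition reduces to that of each `y x`. -/
theorem exists_isSimpleJoint [P.OuterRegular] [CompleteSpace X'] [CompleteSpace Y'] [Nonempty X']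
    [Nonempty Y'] (hiX : Isometry iX) (hiY : Isometry iY) (hS : S.IsSimple) :
    ∃ Z, IsSimpleJoint S Yc Z := by
  classical
  have : SecondCountableTopology X' := UniformSpace.secondCountable_of_separable X'
  have : SecondCountableTopology Y' := UniformSpace.secondCountable_of_separable Y'
  obtain ⟨g, hg⟩ := RandomVariable.exists_fun (S' := X') hiX.continuous S
  choose y hy using fun x => RandomVariable.exists_fun (S' := Y') hiY.continuous (Yc.toFun x)
  have hi : Topology.IsInducing (Prod.map iX iY) :=
    (hiX.isUniformInducing.isInducing).prodMap hiY.isUniformInducing.isInducing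
  obtain ⟨k, x, A, h⟩ := hS
  obtain ⟨hval, hA⟩ := h.is_value hiX hg
  -- In a probability space an almost sure event is nonempty, which provides a default index.
  obtain ⟨ω₀, j₀, -⟩ := hval.exists
  let c : X' → Fin k := fun z => if h : ∃ j, z = iX (x j) then h.choose else j₀
  have hc : Measurable c := by
    -- `c` differs from a constant only at the finitely many values.
    refine (measurable_const (a := j₀)).measurable_of_countable_ne
      ((Set.countable_range fun j => iX (x j)).mono fun z hz => ?_)
    by_contra h1
    refine hz ?_
    have h2 : ¬ ∃ j, z = iX (x j) := fun ⟨j, hj⟩ => h1 ⟨j, hj.symm⟩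
    simp [c, h2]
  have hcx : ∀ j, c (iX (x j)) = j := by
    intro j
    have h1 : ∃ j', iX (x j) = iX (x j') := ⟨j, rfl⟩
    have h2 : c (iX (x j)) = h1.choose := dif_pos h1
    rw [h2]
    exact (h.1 (hiX.injective h1.choose_spec)).symm
  let G : Ω → X' × Y' := fun ω => (g ω, y (x (c (g ω))) ω)
  have hG : Measurable G := by
    refine hg.measurable.prodMk ?_
    have h1 : Measurable fun p : Fin k × Ω => y (x p.1) p.2 :=
      measurable_from_prod_countable_right fun j => (hy (x j)).measurable
    exact h1.comp ((hc.comp hg.measurable).prodMk measurable_id)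
  have hGj : ∀ ω j, g ω = iX (x j) → G ω = (iX (x j), y (x j) ω) := by
    intro ω j hj
    simp only [G, hj, hcx]
  obtain ⟨Z, hZ⟩ := exists_realizes (P := P) hi hG (fun O₁ O₂ h1 h2 _ h12 => by
    -- The sections of `O₁` and `O₂` over a point of `X` are open and have the same trace on `Y`.
    have h3 : ∀ j, P (y (x j) ⁻¹' ({v | (iX (x j), v) ∈ O₂} \ {v | (iX (x j), v) ∈ O₁})) = 0 :=
      fun j => (hy (x j)).measure_trace hiY.continuous
        (h1.preimage (Continuous.prodMk_right _)) (h2.preimage (Continuous.prodMk_right _)) (by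
          ext v
          have : (x j, v) ∈ Prod.map iX iY ⁻¹' O₁ ↔ (x j, v) ∈ Prod.map iX iY ⁻¹' O₂ := by
            rw [h12]
          exact this)
    refine measure_mono_null ?_ (measure_union_null (measure_iUnion_null h3) (ae_iff.1 hval))
    intro ω hω
    by_cases h4 : ∃ j, g ω = iX (x j)
    · obtain ⟨j, hj⟩ := h4
      have h5 : G ω ∈ O₂ \ O₁ := hω
      rw [hGj ω j hj] at h5
      exact Or.inl (Set.mem_iUnion.2 ⟨j, h5⟩)
    · exact Or.inr h4)
  refine ⟨Z, k, x, A, h, fun U V => ?_⟩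
  obtain ⟨O, hO, hU⟩ := hiX.isUniformInducing.isInducing.isOpen_iff.1 U.isOpen
  obtain ⟨W, hW, hV⟩ := hiY.isUniformInducing.isInducing.isOpen_iff.1 V.isOpen
  refine (hZ.is_pre (prodOpens U V) (O ×ˢ W) (hO.prod hW) ?_).eq ((Is.finset_sup fun j _ =>
    (hA j).inf ((hy (x j)).is_pre V W hW hV.symm)).congr ?_)
  · rw [Set.preimage_prod_map_prod, hU, hV]; rfl
  · filter_upwards [hval] with ω ⟨j, hj⟩
    refine propext ?_
    refine Iff.trans (b := ω ∈ ⋃ j ∈ Finset.univ.filter fun j => x j ∈ U,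
      ({ω | g ω = iX (x j)} ∩ y (x j) ⁻¹' W)) Iff.rfl (Iff.trans (b := G ω ∈ O ×ˢ W) ?_ Iff.rfl)
    rw [hGj ω j hj]
    simp only [Finset.mem_filter, Finset.mem_univ, true_and, Set.mem_iUnion, exists_prop,
      Set.mem_prod]
    have hxU : ∀ j, x j ∈ U ↔ iX (x j) ∈ O := fun j => by
      have : x j ∈ U ↔ x j ∈ (U : Set X) := Iff.rfl
      rw [this, ← hU]; rfl
    constructor
    · rintro ⟨j', h1, h2, h3⟩
      have h2 : g ω = iX (x j') := h2
      obtain rfl := h.1 (hiX.injective (hj.symm.trans h2))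
      exact ⟨(hxU _).1 h1, h3⟩
    · rintro ⟨h1, h2⟩
      exact ⟨j, (hxU _).2 h1, hj, h2⟩

end Joint

end Simple

end CondRV

namespace CondRV

/-! ### Independence and averaging over disjoint pieces -/

section Independence

open LowerMeas RandomVariable

/-- By independence the probability is at most an average of the `P (E j)` with weights `P (s j)`,
whose sum is at most one. So the bound does not depend on the number of pieces. -/
theorem measure_biUnion_inter_le_of_indep {Ω ι : Type*} [MeasurableSpace Ω] {P : Measure Ω}
    [IsProbabilityMeasure P] (F : Finset ι) {s E : ι → Set Ω} {η : ℝ≥0∞}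
    (hs : ∀ j ∈ F, MeasurableSet (s j)) (hd : (F : Set ι).PairwiseDisjoint s)
    (hE : ∀ j ∈ F, P (E j ∩ s j) = P (E j) * P (s j)) (hη : ∀ j ∈ F, P (E j) ≤ η) :
    P (⋃ j ∈ F, E j ∩ s j) ≤ η :=
  calc P (⋃ j ∈ F, E j ∩ s j) ≤ ∑ j ∈ F, P (E j ∩ s j) := measure_biUnion_finset_le _ _
    _ ≤ ∑ j ∈ F, η * P (s j) := Finset.sum_le_sum fun j hj => by
        rw [hE j hj]; gcongr; exact hη j hj
    _ = η * P (⋃ j ∈ F, s j) := by rw [← Finset.mul_sum, measure_biUnion_finset hd hs]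
    _ ≤ η * 1 := by gcongr; exact prob_le_one
    _ = η := mul_one η

variable {Ω : Type*} [TopologicalSpace Ω] [MeasurableSpace Ω] [OpensMeasurableSpace Ω]
  {P : Measure Ω} [IsProbabilityMeasure P]
  {X Y X' Y' : Type*} [MetricSpace X] [MetricSpace Y] [MetricSpace X'] [MetricSpace Y']
  [MeasurableSpace X'] [BorelSpace X'] [MeasurableSpace Y'] [BorelSpace Y']
  {iX : X → X'} {iY : Y → Y'} [SeparableSpace X'] [SeparableSpace Y']
  {T : MeasureTopology P} {Yc : ConditionalRV P X Y} {y : X → Ω → Y'}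

/-- Independence is assumed for preimages of open sets. Open rectangles form a π-system which
generates the Borel sets of `Y' × Y'`, so it extends to events such as "the two values are far
apart". -/
theorem ConditionalRV.IndependentOf.measure_inter (hiY : Isometry iY) (h : Yc.IndependentOf T)
    (hy : ∀ x, Realizes iY (y x) (Yc.toFun x)) {A : LowerMeas P} (hA : A ∈ T.carrier) {s : Set Ω}
    (hAs : A.Is s) (x₁ x₂ : X) {B : Set (Y' × Y')}
    (hB : MeasurableSet B) :
    P ({ω | (y x₁ ω, y x₂ ω) ∈ B} ∩ s) = P {ω | (y x₁ ω, y x₂ ω) ∈ B} * P s := by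
  have : SecondCountableTopology Y' := UniformSpace.secondCountable_of_separable Y'
  have hm : Measurable fun ω => (y x₁ ω, y x₂ ω) := (hy x₁).measurable.prodMk (hy x₂).measurable
  have key : (P.restrict s).map (fun ω => (y x₁ ω, y x₂ ω)) =
      P s • P.map (fun ω => (y x₁ ω, y x₂ ω)) := by
    have hb := (isTopologicalBasis_opens (α := Y')).prod (isTopologicalBasis_opens (α := Y'))
    refine ext_of_generate_finite _
      ((BorelSpace.measurable_eq (α := Y' × Y')).trans hb.borel_eq_generateFrom) ?_ ?_ ?_
    · rintro _ ⟨U, hU, V, hV, rfl⟩ _ ⟨U', hU', V', hV', rfl⟩ -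
      exact ⟨U ∩ U', IsOpen.inter hU hU', V ∩ V', IsOpen.inter hV hV', Set.prod_inter_prod.symm⟩
    · rintro _ ⟨U, hU, V, hV, rfl⟩
      have hU : IsOpen U := hU
      have hV : IsOpen V := hV
      have hUV := (hU.prod hV).measurableSet
      rw [Measure.map_apply hm hUV, Measure.restrict_apply (hm hUV), Measure.smul_apply,
        Measure.map_apply hm hUV, smul_eq_mul, mul_comm]
      have h1 := h 2 ![x₁, x₂] ![⟨_, hU.preimage hiY.continuous⟩, ⟨_, hV.preimage hiY.continuous⟩]
        A hA
      have h0 : (Finset.univ : Finset (Fin 2)) = {0, 1} := rfl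
      rw [h0, Finset.inf_insert, Finset.inf_singleton] at h1
      simp only [Matrix.cons_val_zero, Matrix.cons_val_one] at h1
      have h2 := ((hy x₁).is_pre ⟨_, hU.preimage hiY.continuous⟩ U hU rfl).inf
        ((hy x₂).is_pre ⟨_, hV.preimage hiY.continuous⟩ V hV rfl)
      rw [(h2.inf hAs).prob_eq, h2.prob_eq, hAs.prob_eq] at h1
      exact h1
    · simp [Measure.map_apply hm]
  have h1 := congrArg (fun μ : Measure (Y' × Y') => μ B) key
  simp only [Measure.map_apply hm hB, Measure.restrict_apply (hm hB), Measure.smul_apply,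
    smul_eq_mul] at h1
  rw [mul_comm] at h1
  exact h1

end Independence

/-- If `S` were empty, its only open set would have a preimage of measure both zero and one. -/
theorem RandomVariable.nonempty {Ω S : Type*} [TopologicalSpace Ω] [MeasurableSpace Ω]
    [OpensMeasurableSpace Ω] {P : Measure Ω} [IsProbabilityMeasure P] [TopologicalSpace S]
    (Z : RandomVariable P S) : Nonempty S := by
  by_contra hne
  have := not_nonempty_iff.1 hne
  have h1 : (⊤ : Opens S) = ⊥ := Opens.ext (Set.eq_empty_of_isEmpty _)
  have h2 := Z.pre_top
  rw [h1, Z.pre_bot] at h2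
  have h3 := LowerMeas.is_top.ae_eq (h2 ▸ LowerMeas.is_bot : (⊤ : LowerMeas P).Is ∅)
  simpa using measure_congr h3

namespace MeasureTopology

variable {Ω : Type*} [TopologicalSpace Ω] [MeasurableSpace Ω] [OpensMeasurableSpace Ω]
  {P : Measure Ω} [IsFiniteMeasure P]

theorem sup_mem (T : MeasureTopology P) {A B : LowerMeas P} (hA : A ∈ T.carrier)
    (hB : B ∈ T.carrier) : A ⊔ B ∈ T.carrier := by
  have h1 := T.iUnion_mem (fun n => if n = 0 then A else B) (fun n => by split_ifs <;> assumption)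
  have h2 : LowerMeas.iUnion (fun n => if n = 0 then A else B) = A ⊔ B := by
    have h3 := LowerMeas.Is.iUnion (A := fun n => if n = 0 then A else B)
      (s := fun n => if n = 0 then A.toSet else B.toSet) (fun n => by
        split_ifs <;> exact LowerMeas.is_toSet _)
    refine h3.eq ?_
    have h4 : (⋃ n : ℕ, if n = 0 then A.toSet else B.toSet) = A.toSet ∪ B.toSet := by
      ext ω
      simp only [Set.mem_iUnion, Set.mem_union]
      constructor
      · rintro ⟨n, hn⟩
        split_ifs at hn
        · exact Or.inl hn
        · exact Or.inr hn
      · rintro (h | h)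
        · exact ⟨0, by simpa using h⟩
        · exact ⟨1, by simpa using h⟩
    rw [h4]
    exact (LowerMeas.is_toSet A).sup (LowerMeas.is_toSet B)
  rwa [h2] at h1

theorem finset_sup_mem (T : MeasureTopology P) {ι : Type*} (F : Finset ι) {A : ι → LowerMeas P}
    (h : ∀ j ∈ F, A j ∈ T.carrier) : F.sup A ∈ T.carrier := by
  classical
  induction F using Finset.induction_on with
  | empty => exact T.bot_mem
  | insert a F ha ih =>
    rw [Finset.sup_insert]
    exact T.sup_mem (h a (Finset.mem_insert_self a F))
      (ih fun j hj => h j (Finset.mem_insert_of_mem hj))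

end MeasureTopology

/-! ### Approximation by simple random variables -/

section Approximation

open LowerMeas RandomVariable

variable {Ω : Type*} [TopologicalSpace Ω] [MeasurableSpace Ω] [OpensMeasurableSpace Ω]
  {P : Measure Ω} [IsProbabilityMeasure P] [P.OuterRegular]
  {X X' : Type*} [MetricSpace X] [MetricSpace X'] [MeasurableSpace X'] [BorelSpace X']
  {iX : X → X'} [SeparableSpace X']

/-- A function with finitely many values, each taken on a lower-measurable set of the
measure-topology `T`, is a simple random variable. -/
theorem exists_simple_realizes (hi : Isometry iX) {T : MeasureTopology P} {f : Ω → X}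
    (F : Finset X) (hF : ∀ ω, f ω ∈ F) (hm : ∀ x ∈ F, MeasurableSet (f ⁻¹' {x}))
    (hT : ∀ x ∈ F, ∃ A ∈ T.carrier, A.Is (f ⁻¹' {x})) :
    ∃ S : RandomVariable P X, S.IsSimple ∧ S.MeasurableWrt T ∧ Realizes iX (fun ω => iX (f ω)) S := by
  classical
  have hpre : ∀ (s : Set X), f ⁻¹' s = ⋃ x ∈ F.filter (· ∈ s), f ⁻¹' {x} := by
    intro s
    ext ω
    simp only [Set.mem_preimage, Finset.mem_filter, Set.mem_iUnion, exists_prop,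
      Set.mem_singleton_iff]
    exact ⟨fun h => ⟨f ω, ⟨hF ω, h⟩, rfl⟩, fun ⟨x, h1, h2⟩ => h2 ▸ h1.2⟩
  have hfm : ∀ s : Set X, MeasurableSet (f ⁻¹' s) := by
    intro s
    rw [hpre]
    exact Finset.measurableSet_biUnion _ fun x hx => hm x (Finset.mem_filter.1 hx).1
  obtain ⟨S, hS⟩ := exists_realizes (P := P) hi.isUniformInducing.isInducing
    (g := fun ω => iX (f ω)) (fun s _ => hfm (iX ⁻¹' s)) (fun O₁ O₂ _ _ _ h12 => by
      have : (fun ω => iX (f ω)) ⁻¹' (O₂ \ O₁) = f ⁻¹' (iX ⁻¹' O₂ \ iX ⁻¹' O₁) := rfl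
      rw [this, h12, Set.sdiff_self]
      simp)
  choose! A hAT hA using hT
  have hSU : ∀ U : Opens X, S.pre U = (F.filter (· ∈ U)).sup A := by
    intro U
    obtain ⟨O, hO, hU⟩ := hi.isUniformInducing.isInducing.isOpen_iff.1 U.isOpen
    have h1 : (fun ω => iX (f ω)) ⁻¹' O = f ⁻¹' (U : Set X) := by rw [← hU]; rfl
    refine (hS.is_pre U O hO hU.symm).eq ?_
    rw [h1, hpre]
    exact Is.finset_sup fun x hx => hA x (Finset.mem_filter.1 hx).1
  refine ⟨S, ⟨F.card, fun j => (F.equivFin.symm j).1, fun j => A (F.equivFin.symm j).1, ?_, ?_⟩,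
    fun U => ?_, hS⟩
  · exact Subtype.val_injective.comp F.equivFin.symm.injective
  · intro U
    rw [hSU]
    apply le_antisymm
    · refine Finset.sup_le fun x hx => ?_
      obtain ⟨h1, h2⟩ := Finset.mem_filter.1 hx
      have := Finset.le_sup (f := fun j => A (F.equivFin.symm j).1)
        (s := Finset.univ.filter fun j => ((F.equivFin.symm j).1 : X) ∈ U)
        (b := F.equivFin ⟨x, h1⟩) (by simpa using h2)
      simpa using this
    · refine Finset.sup_le fun j hj => ?_
      exact Finset.le_sup (f := A) (Finset.mem_filter.2
        ⟨(F.equivFin.symm j).2, (Finset.mem_filter.1 hj).2⟩)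
  · rw [hSU]
    exact T.finset_sup_mem _ fun x hx => hAT x (Finset.mem_filter.1 hx).1

/-- Every `T`-measurable random variable is a limit of `T`-measurable simple ones. -/
theorem exists_isApproximation [CompleteSpace X'] [Nonempty X'] [SeparableSpace X]
    (hi : Isometry iX) {T : MeasureTopology P} {X₀ : RandomVariable P X}
    (hX : X₀.MeasurableWrt T) :
    ∃ Xs : ℕ → RandomVariable P X, IsApproximation T Xs X₀ := by
  classical
  obtain ⟨g, hg⟩ := RandomVariable.exists_fun (S' := X') hi.continuous X₀
  have hXne : Nonempty X := X₀.nonempty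
  let u := denseSeq X
  -- For each centre, only countably many spheres have positive measure. With null spheres, a ball
  -- minus earlier balls agrees almost surely with a ball minus earlier closed balls, which is open.
  -- This keeps the level sets in `T`.
  have hrad : ∀ n : ℕ, ∃ r : ℝ, 0 < r ∧ r < (1 / 2) ^ n ∧
      ∀ a, P {ω | dist (g ω) (iX (u a)) = r} = 0 := by
    intro n
    have h1 : (⋃ a, {t : ℝ | 0 < P {ω | dist (g ω) (iX (u a)) = t}}).Countable :=
      Set.countable_iUnion fun a => Measure.countable_meas_level_set_pos
        (hg.measurable.dist measurable_const)
    have h2 : ¬ (Set.Ioo (0 : ℝ) ((1 / 2) ^ n)).Countable := fun h =>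
      (Cardinal.Real.Ioo_countable_iff.1 h).not_gt (by positivity)
    obtain ⟨r, hr, hr'⟩ := Set.not_subset.1 fun h => h2 (h1.mono h)
    refine ⟨r, hr.1, hr.2, fun a => ?_⟩
    by_contra h3
    exact hr' (Set.mem_iUnion.2 ⟨a, pos_iff_ne_zero.2 h3⟩)
  choose r hr0 hr hrnull using hrad
  have hstep : ∀ n : ℕ, ∃ (f : Ω → X) (S : RandomVariable P X), S.IsSimple ∧ S.MeasurableWrt T ∧
      Realizes iX (fun ω => iX (f ω)) S ∧
        P {ω | (1 / 2 : ℝ) ^ n ≤ dist (iX (f ω)) (g ω)} ≤ (2⁻¹ : ℝ≥0∞) ^ n := by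
    intro n
    obtain ⟨N, hN⟩ : ∃ N : ℕ, P (⋂ a ∈ Finset.range N, {ω | r n ≤ dist (g ω) (iX (u a))}) ≤
        (2⁻¹ : ℝ≥0∞) ^ n := by
      have h1 := tendsto_measure_iInter_atTop (μ := P)
        (s := fun N : ℕ => ⋂ a ∈ Finset.range N, {ω | r n ≤ dist (g ω) (iX (u a))})
        (fun N => (Finset.measurableSet_biInter _ fun a _ =>
          measurableSet_le measurable_const (hg.measurable.dist measurable_const)).nullMeasurableSet)
        (fun N M hNM => Set.biInter_subset_biInter_left fun a ha => by
          simp only [Finset.coe_range, Set.mem_Iio] at ha ⊢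
          exact lt_of_lt_of_le ha hNM) ⟨0, measure_ne_top _ _⟩
      have hO : IsOpen (⋃ a, Metric.ball (iX (u a)) (r n)) :=
        isOpen_iUnion fun a => Metric.isOpen_ball
      have h2 := hg.is_pre ⊤ (⋃ a, Metric.ball (iX (u a)) (r n)) hO (by
        ext x
        simp only [Opens.coe_top, Set.mem_univ, true_iff]
        obtain ⟨a, ha⟩ := (denseRange_denseSeq X).exists_dist_lt x (hr0 n)
        exact Set.mem_iUnion.2 ⟨a, by rw [Metric.mem_ball, hi.dist_eq]; exact ha⟩)
      rw [X₀.pre_top] at h2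
      have h0 : P (⋂ N : ℕ, ⋂ a ∈ Finset.range N, {ω | r n ≤ dist (g ω) (iX (u a))}) = 0 := by
        have h3 := h2.ae_eq is_top
        refine measure_mono_null (fun ω hω => ?_) (ae_iff.1 h3)
        intro h4
        obtain ⟨a, ha⟩ := Set.mem_iUnion.1 ((iff_of_eq h4).2 trivial)
        have h5 : r n ≤ dist (g ω) (iX (u a)) :=
          Set.mem_iInter₂.1 (Set.mem_iInter.1 hω (a + 1)) a (by simp)
        exact h5.not_gt ha
      rw [h0] at h1
      exact (ENNReal.tendsto_nhds_zero.1 h1 _ (ENNReal.pow_pos (by simp) n)).exists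
    -- `J` is the index of the first closed ball that contains `g ω`, or `N` if none of the first
    -- `N` does.
    have hp : ∀ ω, ∃ a, N ≤ a ∨ dist (g ω) (iX (u a)) ≤ r n := fun ω => ⟨N, Or.inl le_rfl⟩
    let J : Ω → ℕ := fun ω => Nat.find (hp ω)
    have hJm : Measurable J := measurable_find hp fun a =>
      (MeasurableSet.const _).union
        (measurableSet_le (hg.measurable.dist measurable_const) measurable_const)
    have hJN : ∀ ω, J ω ≤ N := fun ω => Nat.find_min' (hp ω) (Or.inl le_rfl)
    -- On the remaining set, whose measure is at most `2⁻ⁿ`, the value is arbitrary.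
    let w : ℕ → X := fun a => if a < N then u a else u 0
    have hJT : ∀ a ≤ N, ∃ A ∈ T.carrier, A.Is (J ⁻¹' {a}) := by
      intro a haN
      let O : Set X' := (if a < N then Metric.ball (iX (u a)) (r n) else Set.univ) ∩
        ⋂ b ∈ Finset.range a, (Metric.closedBall (iX (u b)) (r n))ᶜ
      have hO : IsOpen O := by
        refine IsOpen.inter ?_ (isOpen_biInter_finset fun b _ => Metric.isClosed_closedBall.isOpen_compl)
        split_ifs
        · exact Metric.isOpen_ball
        · exact isOpen_univ
      refine ⟨_, hX ⟨_, hO.preimage hi.continuous⟩, (hg.is_pre _ O hO rfl).congr ?_⟩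
      have h1 : ∀ᵐ ω ∂P, dist (g ω) (iX (u a)) ≠ r n := by
        rw [ae_iff]
        simpa using hrnull n a
      filter_upwards [h1] with ω hω
      refine propext (Iff.trans (b := J ω = a) ?_ Iff.rfl)
      rw [Nat.find_eq_iff]
      refine Iff.trans (b := g ω ∈ O) Iff.rfl ?_
      have h2 : g ω ∈ (if a < N then Metric.ball (iX (u a)) (r n) else Set.univ) ↔
          (N ≤ a ∨ dist (g ω) (iX (u a)) ≤ r n) := by
        split_ifs with h
        · rw [Metric.mem_ball]
          exact ⟨fun h3 => Or.inr h3.le, fun h3 =>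
            lt_of_le_of_ne (h3.resolve_left (not_le.2 h)) hω⟩
        · exact ⟨fun _ => Or.inl (not_lt.1 h), fun _ => trivial⟩
      simp only [O, Set.mem_inter_iff, h2, Set.mem_iInter, Finset.mem_range, Set.mem_compl_iff,
        Metric.mem_closedBall, not_or, not_le]
      exact and_congr_right fun _ => forall₂_congr fun b hb =>
        ⟨fun h3 => ⟨hb.trans_le haN, h3⟩, fun h3 => h3.2⟩
    have hf : ∀ x, (fun ω => w (J ω)) ⁻¹' {x} =
        ⋃ a ∈ (Finset.range (N + 1)).filter (w · = x), J ⁻¹' {a} := by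
      intro x
      ext ω
      simp only [Set.mem_preimage, Finset.mem_filter, Finset.mem_range, Set.mem_iUnion, exists_prop,
        Set.mem_singleton_iff]
      exact ⟨fun h => ⟨J ω, ⟨Nat.lt_succ_of_le (hJN ω), h⟩, rfl⟩, fun ⟨a, h1, h2⟩ => h2 ▸ h1.2⟩
    obtain ⟨S, hS1, hS2, hS3⟩ := exists_simple_realizes (P := P) hi (T := T)
      (f := fun ω => w (J ω)) ((Finset.range (N + 1)).image w)
      (fun ω => Finset.mem_image_of_mem w (Finset.mem_range.2 (Nat.lt_succ_of_le (hJN ω))))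
      (fun x _ => by
        rw [hf]
        exact Finset.measurableSet_biUnion _ fun a _ => hJm (measurableSet_singleton a))
      (fun x _ => by
        choose! A hAT hA using hJT
        refine ⟨_, T.finset_sup_mem ((Finset.range (N + 1)).filter (w · = x)) (A := A)
          fun a ha => hAT a ?_, ?_⟩
        · exact Nat.le_of_lt_succ (Finset.mem_range.1 (Finset.mem_filter.1 ha).1)
        · rw [hf]
          exact Is.finset_sup fun a ha =>
            hA a (Nat.le_of_lt_succ (Finset.mem_range.1 (Finset.mem_filter.1 ha).1)))
    refine ⟨_, S, hS1, hS2, hS3, (measure_mono fun ω hω => ?_).trans hN⟩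
    have hω : (1 / 2 : ℝ) ^ n ≤ dist (iX (w (J ω))) (g ω) := hω
    refine Set.mem_iInter₂.2 fun a ha => ?_
    by_contra h1
    have h1 : dist (g ω) (iX (u a)) < r n := not_le.1 h1
    have ha := Finset.mem_range.1 ha
    have h2 : J ω < N := (Nat.find_min' (hp ω) (Or.inr h1.le)).trans_lt ha
    have h3 := (Nat.find_spec (hp ω)).resolve_left (not_le.2 h2)
    have h4 : w (J ω) = u (J ω) := if_pos h2
    rw [h4, dist_comm] at hω
    exact (hω.trans h3).not_gt (hr n)
  choose f Ss h1 h2 h3 h4 using hstep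
  refine ⟨Ss, h1, h2, ?_⟩
  rw [converges_iff_tendstoInMeasure hi.isUniformInducing.isInducing h3 hg,
    tendstoInMeasure_iff_dist]
  intro δ hδ
  refine tendsto_of_tendsto_of_tendsto_of_le_of_le' tendsto_const_nhds FastSeq.pow_tendsto
    (Eventually.of_forall fun _ => bot_le) ?_
  filter_upwards [(tendsto_pow_atTop_nhds_zero_of_lt_one (r := (1 / 2 : ℝ)) (by norm_num)
    (by norm_num)).eventually (gt_mem_nhds hδ)] with n hn
  exact (measure_mono fun ω hω => hn.le.trans hω).trans (h4 n)

end Approximation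

end CondRV

namespace CondRV

/-! ### The joint random variables form a Cauchy sequence, and their limit stays in `X × Y` -/

section JointLimit

open LowerMeas RandomVariable

variable {Ω : Type*} [TopologicalSpace Ω] [MeasurableSpace Ω] [OpensMeasurableSpace Ω]
  {P : Measure Ω} [IsProbabilityMeasure P]
  {X Y X' Y' : Type*} [MetricSpace X] [MetricSpace Y] [MetricSpace X'] [MetricSpace Y']
  [MeasurableSpace X'] [BorelSpace X'] [MeasurableSpace Y'] [BorelSpace Y']
  {iX : X → X'} {iY : Y → Y'} [SeparableSpace X'] [SeparableSpace Y']
  {T : MeasureTopology P} {X₀ : RandomVariable P X} {Yc : ConditionalRV P X Y}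
  {g : Ω → X'} {y : X → Ω → Y'}

/-- Functions `gs` representing `T`-measurable simple random variables which converge to the
function `g`, and functions `Gs` representing their joint random variables with the conditional
random variable represented by `y`. -/
structure JointApprox (T : MeasureTopology P) (iX : X → X') (g : Ω → X') (y : X → Ω → Y')
    (gs : ℕ → Ω → X') (Gs : ℕ → Ω → X' × Y') : Prop where
  measurable : ∀ n, Measurable (gs n)
  measurable_joint : ∀ n, Measurable (Gs n)
  fst : ∀ n, ∀ᵐ ω ∂P, (Gs n ω).1 = gs n ω
  snd : ∀ n x, ∀ᵐ ω ∂P, gs n ω = iX x → (Gs n ω).2 = y x ω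
  finite : ∀ n, ∃ F : Finset X, ∀ᵐ ω ∂P, ∃ x ∈ F, gs n ω = iX x
  mem : ∀ n x, ∃ A ∈ T.carrier, A.Is {ω | gs n ω = iX x}
  tendsto : TendstoInMeasure P gs atTop g

theorem IsApproximation.jointApprox (hiX : Isometry iX) (hiY : Isometry iY)
    (hg : Realizes iX g X₀) (hy : ∀ x, Realizes iY (y x) (Yc.toFun x))
    {Xs : ℕ → RandomVariable P X} {Zs : ℕ → RandomVariable P (X × Y)}
    (hXs : IsApproximation T Xs X₀) (hZs : ∀ n, IsSimpleJoint (Xs n) Yc (Zs n))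
    {gs : ℕ → Ω → X'} {Gs : ℕ → Ω → X' × Y'} (hgs : ∀ n, Realizes iX (gs n) (Xs n))
    (hGs : ∀ n, Realizes (Prod.map iX iY) (Gs n) (Zs n)) : JointApprox T iX g y gs Gs where
  measurable n := (hgs n).measurable
  measurable_joint n := (hGs n).measurable
  fst n := ((hZs n).ae_eq hiX hiY (hgs n) hy (hGs n)).1
  snd n := ((hZs n).ae_eq hiX hiY (hgs n) hy (hGs n)).2
  finite n := (hXs.simple n).exists_finset hiX (hgs n)
  mem n := (hXs.simple n).exists_mem hiX (hgs n) (hXs.measurable n)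
  tendsto := (converges_iff_tendstoInMeasure hiX.isUniformInducing.isInducing hgs hg).1
    hXs.converges

/-- By separability countably many of the balls cover `X`. Their union in `X'` has full trace, so it
contains `g` almost surely, and finitely many balls suffice up to `η`. -/
theorem RandomVariable.Realizes.exists_finset_cover [SeparableSpace X] (hi : Isometry iX)
    (hg : Realizes iX g X₀) {r : X → ℝ} (hr : ∀ x, 0 < r x) {η : ℝ≥0∞} (hη : 0 < η) :
    ∃ F : Finset X, P {ω | ∀ x ∈ F, r x ≤ dist (g ω) (iX x)} ≤ η := by
  classical
  have : SecondCountableTopology X := UniformSpace.secondCountable_of_separable X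
  have : Nonempty X := X₀.nonempty
  obtain ⟨s, hs, hsU⟩ := countable_cover_nhds (f := fun x => Metric.ball x (r x))
    fun x => Metric.ball_mem_nhds x (hr x)
  have hne : s.Nonempty := by
    by_contra h
    rw [Set.not_nonempty_iff_eq_empty.1 h] at hsU
    have := Set.mem_univ (Classical.arbitrary X)
    rw [← hsU] at this
    simp at this
  obtain ⟨e, rfl⟩ := hs.exists_eq_range hne
  have h1 := tendsto_measure_iInter_atTop (μ := P)
    (s := fun N : ℕ => ⋂ a ∈ Finset.range N, {ω | r (e a) ≤ dist (g ω) (iX (e a))})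
    (fun N => (Finset.measurableSet_biInter _ fun a _ =>
      measurableSet_le measurable_const (hg.measurable.dist measurable_const)).nullMeasurableSet)
    (fun N M hNM => Set.biInter_subset_biInter_left fun a ha => by
      simp only [Finset.coe_range, Set.mem_Iio] at ha ⊢
      exact lt_of_lt_of_le ha hNM) ⟨0, measure_ne_top _ _⟩
  have h2 := hg.is_pre ⊤ (⋃ a, Metric.ball (iX (e a)) (r (e a)))
    (isOpen_iUnion fun a => Metric.isOpen_ball) (by
      ext x
      simp only [Opens.coe_top, Set.mem_univ, true_iff]
      have : x ∈ ⋃ x ∈ Set.range e, Metric.ball x (r x) := by rw [hsU]; trivial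
      rw [Set.biUnion_range] at this
      obtain ⟨a, ha⟩ := Set.mem_iUnion.1 this
      exact Set.mem_iUnion.2 ⟨a, by rw [Metric.mem_ball, hi.dist_eq]; exact ha⟩)
  rw [X₀.pre_top] at h2
  have h0 : P (⋂ N : ℕ, ⋂ a ∈ Finset.range N, {ω | r (e a) ≤ dist (g ω) (iX (e a))}) = 0 := by
    have h3 := h2.ae_eq is_top
    refine measure_mono_null (fun ω hω => ?_) (ae_iff.1 h3)
    intro h4
    obtain ⟨a, ha⟩ := Set.mem_iUnion.1 ((iff_of_eq h4).2 trivial)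
    have h5 : r (e a) ≤ dist (g ω) (iX (e a)) :=
      Set.mem_iInter₂.1 (Set.mem_iInter.1 hω (a + 1)) a (by simp)
    exact h5.not_gt ha
  rw [h0] at h1
  obtain ⟨N, hN⟩ := (ENNReal.tendsto_nhds_zero.1 h1 _ hη).exists
  refine ⟨(Finset.range N).image e, (measure_mono fun ω hω => ?_).trans hN⟩
  exact Set.mem_iInter₂.2 fun a ha => hω (e a) (Finset.mem_image_of_mem e ha)

/-- Otherwise violations at distances below `2⁻ⁿ` would contradict sequential continuity. -/
theorem ConditionalRV.exists_osc_le (hiY : Isometry iY)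
    (hy : ∀ x, Realizes iY (y x) (Yc.toFun x)) (x : X) {δ : ℝ} (hδ : 0 < δ) {η : ℝ≥0∞}
    (hη : 0 < η) :
    ∃ r, 0 < r ∧ ∀ x', dist x' x < r → P {ω | δ ≤ dist (y x' ω) (y x ω)} ≤ η := by
  by_contra! h
  choose xs h1 h2 using fun n : ℕ => h ((1 / 2) ^ n) (by positivity)
  have h3 : Tendsto xs atTop (𝓝 x) := tendsto_iff_dist_tendsto_zero.2
    (squeeze_zero (fun _ => dist_nonneg) (fun n => (h1 n).le)
      (tendsto_pow_atTop_nhds_zero_of_lt_one (by norm_num) (by norm_num)))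
  have h4 := (converges_iff_tendstoInMeasure hiY.isUniformInducing.isInducing
    (fun n => hy (xs n)) (hy x)).1 (Yc.continuous xs x h3)
  obtain ⟨n, hn⟩ := (ENNReal.tendsto_nhds_zero.1
    (tendstoInMeasure_iff_dist.1 h4 δ hδ) η hη).exists
  exact (h2 n).not_ge hn

theorem JointApprox.eventually_exists_near {gs : ℕ → Ω → X'} {Gs : ℕ → Ω → X' × Y'}
    (h : JointApprox T iX g y gs Gs) (hg : Measurable g) (F : Finset X) (r : X → ℝ)
    {η : ℝ≥0∞} (hη : 0 < η) :
    ∀ᶠ n in atTop, P {ω | ∃ x ∈ F, dist (g ω) (iX x) < r x ∧ r x ≤ dist (gs n ω) (iX x)} ≤ η := by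
  have h2 : Tendsto (fun n => ∑ x ∈ F, P (g ⁻¹' Metric.ball (iX x) (r x) \
      gs n ⁻¹' Metric.ball (iX x) (r x))) atTop (𝓝 0) := by
    simpa using tendsto_finsetSum F fun x _ =>
      TendstoInMeasure.tendsto_measure_sdiff hg h.tendsto Metric.isOpen_ball
  filter_upwards [ENNReal.tendsto_nhds_zero.1 h2 _ hη] with n hn
  refine (measure_mono ?_).trans ((measure_biUnion_finset_le _ _).trans hn)
  rintro ω ⟨x, hx, h3, h4⟩
  exact Set.mem_biUnion hx ⟨h3, not_lt.2 h4⟩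

/-- The common level sets of `gs n` and `gs' m` are finitely many disjoint pieces in the
measure-topology, and `y` is independent of them. The maps `a` and `b` say which members of the
family are compared on the piece `(x, x')`. -/
theorem JointApprox.measure_le_of_indep {gs gs' : ℕ → Ω → X'} {Gs Gs' : ℕ → Ω → X' × Y'}
    (hiX : Isometry iX) (hiY : Isometry iY)
    (hY : Yc.IndependentOf T) (hy : ∀ x, Realizes iY (y x) (Yc.toFun x))
    (h : JointApprox T iX g y gs Gs) (h' : JointApprox T iX g y gs' Gs') (n m : ℕ)
    {R : X → X → Prop} {a b : X → X → X} {B : X → X → Set (Y' × Y')}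
    (hB : ∀ x x', MeasurableSet (B x x')) {η : ℝ≥0∞}
    (hη : ∀ x x', R x x' → P {ω | (y (a x x') ω, y (b x x') ω) ∈ B x x'} ≤ η) :
    P {ω | ∃ x x', R x x' ∧ gs n ω = iX x ∧ gs' m ω = iX x' ∧
      (y (a x x') ω, y (b x x') ω) ∈ B x x'} ≤ η := by
  classical
  obtain ⟨F, hF⟩ := h.finite n
  obtain ⟨F', hF'⟩ := h'.finite m
  let I := (F ×ˢ F').filter fun p => R p.1 p.2
  have key := measure_biUnion_inter_le_of_indep (P := P) I
    (s := fun p => {ω | gs n ω = iX p.1} ∩ {ω | gs' m ω = iX p.2})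
    (E := fun p => {ω | (y (a p.1 p.2) ω, y (b p.1 p.2) ω) ∈ B p.1 p.2}) (η := η)
    (fun p _ => ((h.measurable n) (measurableSet_singleton _)).inter
      ((h'.measurable m) (measurableSet_singleton _))) ?_ ?_
    (fun p hp => hη _ _ (Finset.mem_filter.1 hp).2)
  · refine (measure_mono_ae ?_).trans key
    filter_upwards [hF, hF'] with ω ⟨x₁, hx₁, e₁⟩ ⟨x₂, hx₂, e₂⟩ ⟨x, x', h1, h2, h3, h4⟩
    obtain rfl := hiX.injective (e₁.symm.trans h2)
    obtain rfl := hiX.injective (e₂.symm.trans h3)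
    exact Set.mem_iUnion₂.2 ⟨(x₁, x₂), Finset.mem_filter.2
      ⟨Finset.mem_product.2 ⟨hx₁, hx₂⟩, h1⟩, h4, h2, h3⟩
  · intro p _ q _ hpq
    refine Set.disjoint_left.2 fun ω h1 h2 => hpq ?_
    have e1 : gs n ω = iX p.1 := h1.1
    have e2 : gs' m ω = iX p.2 := h1.2
    exact Prod.ext (hiX.injective (e1.symm.trans h2.1)) (hiX.injective (e2.symm.trans h2.2))
  · intro p _
    obtain ⟨A, hA, hA'⟩ := h.mem n p.1
    obtain ⟨A₂, hA₂, hA₂'⟩ := h'.mem m p.2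
    exact hY.measure_inter hiY hy (T.inf_mem A hA A₂ hA₂) (hA'.inf hA₂') _ _ (hB _ _)

/-- Finitely many balls in which `y` oscillates little contain `g` with high probability. For large
`n` and `m`, both simple values lie in the same ball, and independence bounds the chance that `y`
differs much at these values. -/
theorem JointApprox.cauchy [SeparableSpace X] (hiX : Isometry iX) (hiY : Isometry iY)
    (hY : Yc.IndependentOf T) (hg : Realizes iX g X₀)
    (hy : ∀ x, Realizes iY (y x) (Yc.toFun x)) {gs gs' : ℕ → Ω → X'} {Gs Gs' : ℕ → Ω → X' × Y'}
    (h : JointApprox T iX g y gs Gs) (h' : JointApprox T iX g y gs' Gs') {δ : ℝ} (hδ : 0 < δ)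
    {ε : ℝ≥0∞} (hε : 0 < ε) :
    ∃ N, ∀ n m, N ≤ n → N ≤ m → P {ω | δ ≤ dist (Gs n ω) (Gs' m ω)} ≤ ε := by
  have : SecondCountableTopology Y' := UniformSpace.secondCountable_of_separable Y'
  -- Five errors: `g` is outside the cover, either approximation leaves the ball, and `y` at either
  -- value is far from its value at the centre.
  obtain ⟨η, hη, hηε⟩ : ∃ η : ℝ≥0∞, 0 < η ∧ η + η + η + (η + η) = ε :=
    ⟨ε / 5, ENNReal.div_pos hε.ne' (by simp), by
      have : ε / 5 + ε / 5 + ε / 5 + (ε / 5 + ε / 5) = 5 * (ε / 5) := by ring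
      rw [this, ENNReal.mul_div_cancel (by simp) (by simp)]⟩
  choose r₀ hr₀ hosc using fun x => Yc.exists_osc_le (P := P) hiY hy x (half_pos hδ) hη
  let r : X → ℝ := fun x => min (r₀ x) (δ / 2)
  have hr : ∀ x, 0 < r x := fun x => lt_min (hr₀ x) (half_pos hδ)
  obtain ⟨F, hF⟩ := hg.exists_finset_cover hiX hr hη
  obtain ⟨N, hN⟩ := eventually_atTop.1 ((h.eventually_exists_near hg.measurable F r hη).and
    (h'.eventually_exists_near hg.measurable F r hη))
  refine ⟨N, fun n m hn hm => ?_⟩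
  have hind := h.measure_le_of_indep hiX hiY hY hy h' n m
    (R := fun x x' => ∃ z ∈ F, dist x z < r z ∧ dist x' z < r z)
    (a := fun x _ => x) (b := fun _ x' => x')
    (B := fun _ _ => {p : Y' × Y' | δ ≤ dist p.1 p.2})
    (fun _ _ => measurableSet_le measurable_const (measurable_fst.dist measurable_snd))
    (η := η + η) (by
      rintro x x' ⟨z, hz, h1, h2⟩
      refine (measure_mono fun ω hω => ?_).trans ((measure_union_le _ _).trans (add_le_add
        (hosc z x (h1.trans_le (min_le_left _ _))) (hosc z x' (h2.trans_le (min_le_left _ _)))))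
      by_contra h3
      simp only [Set.mem_union, Set.mem_ofPred_eq, not_or, not_le] at h3
      have h4 : δ ≤ dist (y x ω) (y x' ω) := hω
      have h5 := dist_triangle_right (y x ω) (y x' ω) (y z ω)
      linarith [h3.1, h3.2])
  rw [← hηε]
  refine (measure_mono_ae ?_).trans ((measure_union_le _ _).trans (add_le_add
    ((measure_union_le _ _).trans (add_le_add ((measure_union_le _ _).trans
      (add_le_add hF (hN n hn).1)) (hN m hm).2)) hind))
  obtain ⟨F₁, hF₁⟩ := h.finite n
  obtain ⟨F₂, hF₂⟩ := h'.finite m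
  -- The null set in `snd` depends on `x`; finitely many values leave only finitely many of them.
  have hs : ∀ᵐ ω ∂P, (∀ x ∈ F₁, gs n ω = iX x → (Gs n ω).2 = y x ω) ∧
      ∀ x ∈ F₂, gs' m ω = iX x → (Gs' m ω).2 = y x ω :=
    ((ae_ball_iff F₁.countable_toSet).2 fun x _ => h.snd n x).and
      ((ae_ball_iff F₂.countable_toSet).2 fun x _ => h'.snd m x)
  filter_upwards [hF₁, hF₂, hs, h.fst n, h'.fst m] with ω ⟨x, hx, e1⟩ ⟨x', hx', e2⟩ ⟨hs1, hs2⟩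
    f1 f2 (hω : δ ≤ dist (Gs n ω) (Gs' m ω))
  by_contra hcon
  change ¬ (((_ ∨ _) ∨ _) ∨ _) at hcon
  simp only [not_or, Set.mem_ofPred_eq, not_forall, not_le, not_exists, not_and] at hcon
  obtain ⟨⟨⟨⟨z, hz, c1⟩, c2⟩, c3⟩, c4⟩ := hcon
  have c2 := c2 z hz c1
  have c3 := c3 z hz c1
  rw [e1, hiX.dist_eq] at c2
  rw [e2, hiX.dist_eq] at c3
  have c5 := c4 x x' ⟨z, hz, c2, c3⟩ e1 e2
  have c6 : dist (y x ω) (y x' ω) < δ := c5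
  rw [Prod.dist_eq, f1, f2, hs1 x hx e1, hs2 x' hx' e2, e1, e2, hiX.dist_eq] at hω
  have c7 : dist x x' < δ := by
    have := dist_triangle_right x x' z
    have : r z ≤ δ / 2 := min_le_right _ _
    linarith
  exact (max_lt c7 c6).not_ge hω

/-- The section of `C` over `x` misses `Y`, so `y x` almost surely avoids it by `measure_trace`; the
points outside `C` but near it form a margin of small measure. -/
theorem measure_infEDist_lt_le (hiY : Isometry iY)
    (hy : ∀ x, Realizes iY (y x) (Yc.toFun x)) {C : Set (X' × Y')} (hC : IsClosed C)
    (hCd : ∀ x v, (iX x, iY v) ∉ C) (x : X) {η : ℝ≥0∞} (hη : 0 < η) :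
    ∃ δ : ℝ, 0 < δ ∧
      P {ω | Metric.infEDist (iX x, y x ω) C < ENNReal.ofReal δ} ≤ η := by
  have : SecondCountableTopology X' := UniformSpace.secondCountable_of_separable X'
  have : SecondCountableTopology Y' := UniformSpace.secondCountable_of_separable Y'
  have h1 := tendsto_measure_margin (P := P) (g := fun ω => (iX x, y x ω))
    (measurable_const.prodMk (hy x).measurable) hC.isOpen_compl
  obtain ⟨k, hk⟩ := (ENNReal.tendsto_nhds_zero.1 h1 η hη).exists
  have h2 : P {ω | (iX x, y x ω) ∈ C} = 0 := by
    have h3 := (hy x).measure_trace hiY.continuous (O₁ := {v | (iX x, v) ∈ Cᶜ}) (O₂ := Set.univ)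
      (hC.isOpen_compl.preimage (Continuous.prodMk_right _)) isOpen_univ (by
        ext v
        simp [hCd])
    refine measure_mono_null (fun ω hω => ?_) h3
    exact ⟨trivial, fun h => h hω⟩
  refine ⟨(2⁻¹ : ℝ) ^ k, by positivity, ?_⟩
  rw [ENNReal.ofReal_pow (by norm_num), ENNReal.ofReal_inv_of_pos (by norm_num)]
  simp only [ENNReal.ofReal_ofNat]
  have h4 : P {ω | Metric.infEDist (iX x, y x ω) C < (2⁻¹ : ℝ≥0∞) ^ k} ≤ η + 0 := by
    refine (measure_mono ?_).trans ((measure_union_le _ _).trans (add_le_add hk h2.le))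
    intro ω hω
    by_cases h5 : (iX x, y x ω) ∈ C
    · exact Or.inr h5
    · exact Or.inl ⟨h5, by rwa [compl_compl]⟩
  rwa [add_zero] at h4

/-- The limit of the joint random variables is almost surely not in a closed set which is
disjoint from `X × Y`. -/
theorem JointApprox.measure_eq_zero [SeparableSpace X] (hiX : Isometry iX) (hiY : Isometry iY)
    (hY : Yc.IndependentOf T) (hg : Realizes iX g X₀)
    (hy : ∀ x, Realizes iY (y x) (Yc.toFun x)) {gs : ℕ → Ω → X'} {Gs : ℕ → Ω → X' × Y'}
    (h : JointApprox T iX g y gs Gs) {G : Ω → X' × Y'} (hG : TendstoInMeasure P Gs atTop G)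
    {C : Set (X' × Y')} (hC : IsClosed C) (hCd : ∀ x v, (iX x, iY v) ∉ C) :
    P (G ⁻¹' C) = 0 := by
  have : SecondCountableTopology X' := UniformSpace.secondCountable_of_separable X'
  have : SecondCountableTopology Y' := UniformSpace.secondCountable_of_separable Y'
  refine le_antisymm (le_of_forall_pos_le_add fun ε hε => ?_) bot_le
  rw [zero_add]
  obtain ⟨η, hη, hηε⟩ : ∃ η : ℝ≥0∞, 0 < η ∧ η + η + η + (η + η) = ε :=
    ⟨ε / 5, ENNReal.div_pos hε.ne' (by simp), by
      have : ε / 5 + ε / 5 + ε / 5 + (ε / 5 + ε / 5) = 5 * (ε / 5) := by ring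
      rw [this, ENNReal.mul_div_cancel (by simp) (by simp)]⟩
  choose δ hδ hδη using fun x => measure_infEDist_lt_le (P := P) hiY hy hC hCd x hη
  choose r₀ hr₀ hosc using fun x => Yc.exists_osc_le (P := P) hiY hy x (half_pos (hδ x)) hη
  let r : X → ℝ := fun x => min (r₀ x) (δ x / 2)
  have hr : ∀ x, 0 < r x := fun x => lt_min (hr₀ x) (half_pos (hδ x))
  obtain ⟨F, hF⟩ := hg.exists_finset_cover hiX hr hη
  -- Only now that the cover is finite can the distances to `C` be bounded below uniformly.
  obtain ⟨δ₀, hδ₀, hδF⟩ : ∃ δ₀ : ℝ, 0 < δ₀ ∧ ∀ x ∈ F, δ₀ ≤ δ x / 2 := by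
    rcases F.eq_empty_or_nonempty with rfl | hne
    · exact ⟨1, one_pos, by simp⟩
    · obtain ⟨x, hx, hmin⟩ := F.exists_min_image δ hne
      exact ⟨δ x / 2, half_pos (hδ x), fun x' hx' => by linarith [hmin x' hx']⟩
  obtain ⟨n, hn1, hn2⟩ := ((h.eventually_exists_near hg.measurable F r hη).and
    (ENNReal.tendsto_nhds_zero.1 (hG (ENNReal.ofReal δ₀) (ENNReal.ofReal_pos.2 hδ₀)) η hη)).exists
  have hind := h.measure_le_of_indep hiX hiY hY hy h n n
    (R := fun x _ => ∃ z ∈ F, dist x z < r z) (a := fun x _ => x) (b := fun x _ => x)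
    (B := fun x _ => {p : Y' × Y' | Metric.infEDist (iX x, p.1) C < ENNReal.ofReal δ₀})
    (fun x _ => measurableSet_lt (measurable_infEDist.comp
      (measurable_const.prodMk measurable_fst)) measurable_const) (η := η + η) (by
      rintro x _ ⟨z, hz, h1⟩
      refine (measure_mono fun ω hω => ?_).trans ((measure_union_le _ _).trans (add_le_add
        (hosc z x (h1.trans_le (min_le_left _ _))) (hδη z)))
      by_contra h3
      change ¬ (_ ∨ _) at h3
      simp only [Set.mem_ofPred_eq, not_or, not_le] at h3
      have h4 : Metric.infEDist (iX x, y x ω) C < ENNReal.ofReal δ₀ := hω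
      refine h3.2 ?_
      -- Passing from the centre `z` to `x` uses up half of the distance `δ z` from `C`; the other
      -- half is at least `δ₀`.
      have h5 : edist (iX z, y z ω) (iX x, y x ω) ≤ ENNReal.ofReal (δ z / 2) := by
        rw [edist_dist]
        refine ENNReal.ofReal_le_ofReal ?_
        rw [Prod.dist_eq]
        refine max_le ?_ ?_
        · change dist (iX z) (iX x) ≤ _
          rw [hiX.dist_eq, dist_comm]
          exact h1.le.trans (min_le_right _ _)
        · change dist (y z ω) (y x ω) ≤ _
          rw [dist_comm]
          exact h3.1.le
      calc Metric.infEDist (iX z, y z ω) C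
          ≤ Metric.infEDist (iX x, y x ω) C + edist (iX z, y z ω) (iX x, y x ω) :=
            Metric.infEDist_le_infEDist_add_edist
        _ < ENNReal.ofReal δ₀ + ENNReal.ofReal (δ z / 2) :=
            ENNReal.add_lt_add_of_lt_of_le (ne_top_of_le_ne_top ENNReal.ofReal_ne_top h5) h4 h5
        _ ≤ ENNReal.ofReal (δ z) := by
            rw [← ENNReal.ofReal_add hδ₀.le (half_pos (hδ z)).le]
            exact ENNReal.ofReal_le_ofReal (by linarith [hδF z hz]))
  rw [← hηε]
  refine (measure_mono_ae ?_).trans ((measure_union_le _ _).trans (add_le_add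
    ((measure_union_le _ _).trans (add_le_add ((measure_union_le _ _).trans
      (add_le_add hF hn1)) hn2)) hind))
  obtain ⟨F₁, hF₁⟩ := h.finite n
  have hs : ∀ᵐ ω ∂P, (∀ x ∈ F₁, gs n ω = iX x → (Gs n ω).2 = y x ω) :=
    (ae_ball_iff F₁.countable_toSet).2 fun x _ => h.snd n x
  filter_upwards [hF₁, hs, h.fst n] with ω ⟨x, hx, e1⟩ hs1 f1 (hω : G ω ∈ C)
  by_contra hcon
  change ¬ (((_ ∨ _) ∨ _) ∨ _) at hcon
  simp only [not_or, Set.mem_ofPred_eq, not_forall, not_le, not_exists, not_and] at hcon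
  obtain ⟨⟨⟨⟨z, hz, c1⟩, c2⟩, c3⟩, c4⟩ := hcon
  have c2 := c2 z hz c1
  rw [e1, hiX.dist_eq] at c2
  refine c4 x x ⟨z, hz, c2⟩ e1 e1 ?_
  have e3 : Gs n ω = (iX x, y x ω) := Prod.ext (f1.trans e1) (hs1 x hx e1)
  rw [e3] at c3
  exact (Metric.infEDist_le_edist_of_mem hω).trans_lt c3

end JointLimit

end CondRV

namespace CondRV

/-! ### Existence and uniqueness of the joint random variable -/

section WellDefined

open LowerMeas RandomVariable

variable {Ω : Type*} [TopologicalSpace Ω] [MeasurableSpace Ω] [OpensMeasurableSpace Ω]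
  {P : Measure Ω} [IsProbabilityMeasure P]
  {X Y X' Y' : Type*} [MetricSpace X] [MetricSpace Y] [MetricSpace X'] [MetricSpace Y']
  [MeasurableSpace X'] [BorelSpace X'] [MeasurableSpace Y'] [BorelSpace Y']
  {iX : X → X'} {iY : Y → Y'} [SeparableSpace X'] [SeparableSpace Y']
  [CompleteSpace X'] [CompleteSpace Y'] [SeparableSpace X]
  {T : MeasureTopology P} {X₀ : RandomVariable P X} {Yc : ConditionalRV P X Y}

theorem ConditionalRV.nonempty (Yc : ConditionalRV P X Y) (X₀ : RandomVariable P X) :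
    Nonempty Y :=
  X₀.nonempty.elim fun x => (Yc.toFun x).nonempty

/-- Any two sequences of joint random variables of simple approximations have the same limits. -/
theorem exists_joint_limit [P.OuterRegular] (hiX : Isometry iX) (hiY : Isometry iY)
    (hX : X₀.MeasurableWrt T) (hY : Yc.IndependentOf T) :
    ∃ Z : RandomVariable P (X × Y),
      ∀ (Xs : ℕ → RandomVariable P X) (Zs : ℕ → RandomVariable P (X × Y)),
        IsApproximation T Xs X₀ → (∀ n, IsSimpleJoint (Xs n) Yc (Zs n)) →
          ∀ Z', Converges Zs Z' ↔ Z' = Z := by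
  have : SecondCountableTopology X' := UniformSpace.secondCountable_of_separable X'
  have : SecondCountableTopology Y' := UniformSpace.secondCountable_of_separable Y'
  have : Nonempty X' := X₀.nonempty.map iX
  have : Nonempty Y' := (Yc.nonempty X₀).map iY
  have hi : Topology.IsInducing (Prod.map iX iY) :=
    (hiX.isUniformInducing.isInducing).prodMap hiY.isUniformInducing.isInducing
  obtain ⟨g, hg⟩ := RandomVariable.exists_fun (S' := X') hiX.continuous X₀
  choose y hy using fun x => RandomVariable.exists_fun (S' := Y') hiY.continuous (Yc.toFun x)
  obtain ⟨Xs, hXs⟩ := exists_isApproximation hiX hX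
  choose Zs hZs using fun n =>
    exists_isSimpleJoint (Yc := Yc) hiX hiY (hXs.simple n)
  choose gs hgs using fun n => RandomVariable.exists_fun (S' := X') hiX.continuous (Xs n)
  choose Gs hGs using fun n => RandomVariable.exists_fun (S' := X' × Y') hi.continuous (Zs n)
  have hJ := hXs.jointApprox hiX hiY hg hy hZs hgs hGs
  obtain ⟨G, hG, hlim⟩ := exists_tendstoInMeasure_of_cauchy (P := P) hJ.measurable_joint
    fun δ hδ ε hε => hJ.cauchy hiX hiY hY hg hy hJ hδ hε
  obtain ⟨Z, hZ⟩ := exists_realizes (P := P) hi hG (fun O₁ O₂ h1 h2 _ h12 => by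
    -- An open set in a metric space is a countable union of closed sets, so `O₂ \ O₁` is one too,
    -- and these closed sets are disjoint from `X × Y`.
    obtain ⟨C, hC, hCO, hCU, -⟩ := h2.exists_iUnion_isClosed
    have h3 : G ⁻¹' (O₂ \ O₁) = ⋃ n, G ⁻¹' (C n \ O₁) := by
      rw [← Set.preimage_iUnion, ← Set.iUnion_sdiff, hCU]
    rw [h3]
    refine measure_iUnion_null fun n => ?_
    refine hJ.measure_eq_zero hiX hiY hY hg hy hlim ((hC n).sdiff h1) fun x v hxv => hxv.2 ?_
    have h4 : (x, v) ∈ Prod.map iX iY ⁻¹' O₂ := hCO n hxv.1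
    rw [← h12] at h4
    exact h4)
  refine ⟨Z, fun Xs' Zs' hXs' hZs' Z' => ?_⟩
  choose gs' hgs' using fun n => RandomVariable.exists_fun (S' := X') hiX.continuous (Xs' n)
  choose Gs' hGs' using fun n => RandomVariable.exists_fun (S' := X' × Y') hi.continuous (Zs' n)
  have hJ' := hXs'.jointApprox hiX hiY hg hy hZs' hgs' hGs'
  -- `JointApprox.cauchy` compares two different approximations, so all of them share the limit `G`.
  have hlim' : TendstoInMeasure P Gs' atTop G := by
    refine tendstoInMeasure_iff_dist.2 fun δ hδ => ENNReal.tendsto_nhds_zero.2 fun ε hε => ?_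
    have hε2 : 0 < ε / 2 := ENNReal.half_pos hε.ne'
    obtain ⟨N, hN⟩ := hJ'.cauchy hiX hiY hY hg hy hJ (half_pos hδ) hε2
    obtain ⟨m, hm, hm'⟩ := ((ENNReal.tendsto_nhds_zero.1 (tendstoInMeasure_iff_dist.1 hlim (δ / 2)
      (half_pos hδ)) _ hε2).and (eventually_ge_atTop N)).exists
    filter_upwards [eventually_ge_atTop N] with n hn
    rw [← ENNReal.add_halves ε]
    refine (measure_mono fun ω hω => ?_).trans ((measure_union_le _ _).trans
      (add_le_add (hN n m hn hm') hm))
    by_contra h3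
    simp only [Set.mem_union, Set.mem_ofPred_eq, not_or, not_le] at h3
    have h6 := dist_triangle (Gs' n ω) (Gs m ω) (G ω)
    have h7 : δ ≤ dist (Gs' n ω) (G ω) := hω
    linarith [h3.1, h3.2]
  constructor
  · intro h
    obtain ⟨G', hG'⟩ := RandomVariable.exists_fun (S' := X' × Y') hi.continuous Z'
    have h1 := tendstoInMeasure_ae_unique
      ((converges_iff_tendstoInMeasure hi hGs' hG').1 h) hlim'
    exact (hG'.congr hG h1).unique hi hZ
  · rintro rfl
    exact (converges_iff_tendstoInMeasure hi hGs' hZ).2 hlim'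

end WellDefined

end CondRV

namespace CondRV

/-! ## Relations which are semidecidable relative to an infinite sequence -/

section PrimrecRules

variable {α β γ : Type*} [Primcodable α] [Primcodable β] [Primcodable γ]

/-- Pointwise forms of the closure rules, so that `fun_prop` can prove concrete terms primitive
recursive. -/
theorem primrec_fst {f : α → β × γ} (hf : Primrec f) : Primrec fun a => (f a).1 :=
  Primrec.fst.comp hf

theorem primrec_snd {f : α → β × γ} (hf : Primrec f) : Primrec fun a => (f a).2 :=
  Primrec.snd.comp hf

theorem primrec_add {f g : α → ℕ} (hf : Primrec f) (hg : Primrec g) :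
    Primrec fun a => f a + g a := Primrec.nat_add.comp hf hg

theorem primrec_mul {f g : α → ℕ} (hf : Primrec f) (hg : Primrec g) :
    Primrec fun a => f a * g a := Primrec.nat_mul.comp hf hg

theorem primrec_natPair {f g : α → ℕ} (hf : Primrec f) (hg : Primrec g) :
    Primrec fun a => Nat.pair (f a) (g a) := Primrec₂.natPair.comp hf hg

theorem primrec_unpair {f : α → ℕ} (hf : Primrec f) : Primrec fun a => (f a).unpair :=
  Primrec.unpair.comp hf

theorem primrec_two_pow {f : α → ℕ} (hf : Primrec f) : Primrec fun a => 2 ^ f a :=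
  (Primrec₂.unpaired'.1 Nat.Primrec.pow).comp (Primrec.const 2) hf

theorem primrec_encode {f : α → β} (hf : Primrec f) : Primrec fun a => Encodable.encode (f a) :=
  Primrec.encode.comp hf

theorem primrec_getD {f : α → List ℕ} {g : α → ℕ} (hf : Primrec f) (hg : Primrec g) :
    Primrec fun a => (f a).getD (g a) 0 := (Primrec.list_getD 0).comp hf hg

theorem primrec_getElem? {f : α → List β} {g : α → ℕ} (hf : Primrec f) (hg : Primrec g) :
    Primrec fun a => (f a)[g a]? := Primrec.list_getElem?.comp hf hg

theorem primrec_take {f : α → ℕ} {g : α → List β} (hf : Primrec f) (hg : Primrec g) :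
    Primrec fun a => (g a).take (f a) := Primrec.list_take.comp hf hg

theorem primrec_length {f : α → List β} (hf : Primrec f) : Primrec fun a => (f a).length :=
  Primrec.list_length.comp hf

attribute [fun_prop] Primrec
attribute [fun_prop] Primrec.id Primrec.const Primrec.comp Primrec.fst Primrec.snd Primrec.pair
  primrec_fst primrec_snd primrec_add primrec_mul primrec_natPair primrec_unpair primrec_two_pow
  primrec_encode primrec_getD primrec_getElem? primrec_take primrec_length

theorem primrecPred_exists_lt {p : α → ℕ → Prop} (hp : PrimrecRel p) {f : α → ℕ}
    (hf : Primrec f) : PrimrecPred fun a => ∃ x < f a, p a x :=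
  PrimrecPred.of_eq (PrimrecRel.comp (PrimrecRel.exists_mem_list hp.swap)
    (Primrec.list_range.comp hf) Primrec.id) fun a => by simp [Function.swap]

theorem primrecPred_forall_lt {p : α → ℕ → Prop} (hp : PrimrecRel p) {f : α → ℕ}
    (hf : Primrec f) : PrimrecPred fun a => ∀ x < f a, p a x :=
  PrimrecPred.of_eq (PrimrecRel.comp (PrimrecRel.forall_mem_list hp.swap)
    (Primrec.list_range.comp hf) Primrec.id) fun a => by simp [Function.swap]

theorem primrecPred_exists_mem_option {p : α → β → Prop} (hp : PrimrecRel p) {f : α → Option β}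
    (hf : Primrec f) : PrimrecPred fun a => ∃ b, f a = some b ∧ p a b := by
  classical
  have h1 : Primrec fun a => Option.casesOn (motive := fun _ => Bool) (f a) false
      fun b => decide (p a b) :=
    Primrec.option_casesOn hf (Primrec.const false) (primrecRel_iff_primrec_decide.1 hp)
  refine PrimrecPred.of_eq (p := fun a => (Option.casesOn (motive := fun _ => Bool) (f a) false
      fun b => decide (p a b)) = true) ?_ fun a => ?_
  · refine primrecPred_iff_primrec_decide.2 ?_
    simpa using h1
  · cases h : f a <;> simp

theorem primrecPred_eq {f g : α → β} (hf : Primrec f) (hg : Primrec g) :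
    PrimrecPred fun a => f a = g a := by
  classical
  exact PrimrecRel.comp Primrec.eq hf hg

theorem primrecPred_lt {f g : α → ℕ} (hf : Primrec f) (hg : Primrec g) :
    PrimrecPred fun a => f a < g a := PrimrecRel.comp Primrec.nat_lt hf hg

end PrimrecRules

theorem length_pref (p : ℕ → ℕ) (n : ℕ) : (pref p n).length = n := by simp [pref]

theorem getElem?_pref {p : ℕ → ℕ} {n i : ℕ} (h : i < n) : (pref p n)[i]? = some (p i) := by
  simp [pref, h]

theorem take_pref {p : ℕ → ℕ} {n i : ℕ} (h : i ≤ n) : (pref p n).take i = pref p i := by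
  simp [pref, ← List.map_take, List.take_range, h]

theorem pref_prefix {p : ℕ → ℕ} {n i : ℕ} (h : i ≤ n) : pref p i <+: pref p n := by
  rw [← take_pref h]
  exact List.take_prefix _ _

theorem take_eq_of_prefix {α : Type*} {l l' : List α} (h : l <+: l') {n : ℕ} (hn : n ≤ l.length) :
    l'.take n = l.take n := by
  obtain ⟨t, rfl⟩ := h
  exact List.take_append_of_le_length hn

/-- The relation `S` is semidecidable uniformly in an infinite sequence: it is witnessed by finite
prefixes of the sequence which satisfy a primitive recursive relation. -/
def RE {α : Type*} [Primcodable α] (S : (ℕ → ℕ) → α → Prop) : Prop :=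
  ∃ R : List ℕ → α → Prop, PrimrecRel R ∧ (∀ l l' a, l <+: l' → R l a → R l' a) ∧
    ∀ ρ a, S ρ a ↔ ∃ N, R (pref ρ N) a

namespace RE

variable {α β : Type*} [Primcodable α] [Primcodable β]

theorem comp {S : (ℕ → ℕ) → β → Prop} (h : RE S) {f : α → β} (hf : Primrec f) :
    RE fun ρ a => S ρ (f a) := by
  obtain ⟨R, hR, hm, hS⟩ := h
  exact ⟨fun l a => R l (f a), PrimrecRel.comp hR Primrec.fst (hf.comp Primrec.snd),
    fun l l' a => hm l l' (f a), fun ρ a => hS ρ (f a)⟩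

theorem of_iff {S S' : (ℕ → ℕ) → α → Prop} (h : RE S) (h' : ∀ ρ a, S' ρ a ↔ S ρ a) : RE S' := by
  have : S' = S := by ext; exact h' _ _
  rwa [this]

theorem of_pred {p : α → Prop} (hp : PrimrecPred p) : RE fun _ a => p a :=
  ⟨fun _ a => p a, PrimrecPred.comp hp Primrec.snd, fun _ _ _ _ h => h, fun _ _ => by simp⟩

theorem and {S S' : (ℕ → ℕ) → α → Prop} (h : RE S) (h' : RE S') :
    RE fun ρ a => S ρ a ∧ S' ρ a := by
  obtain ⟨R, hR, hm, hS⟩ := h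
  obtain ⟨R', hR', hm', hS'⟩ := h'
  refine ⟨fun l a => R l a ∧ R' l a, PrimrecPred.and hR hR',
    fun l l' a hl ha => ⟨hm l l' a hl ha.1, hm' l l' a hl ha.2⟩, fun ρ a => ?_⟩
  refine (and_congr (hS ρ a) (hS' ρ a)).trans ?_
  constructor
  · rintro ⟨⟨N, hN⟩, M, hM⟩
    exact ⟨max N M, hm _ _ _ (pref_prefix (le_max_left _ _)) hN,
      hm' _ _ _ (pref_prefix (le_max_right _ _)) hM⟩
  · rintro ⟨N, h1, h2⟩
    exact ⟨⟨N, h1⟩, N, h2⟩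

/-- The length of the known prefix also bounds the code of the witness. Monotonicity in the prefix
lets one length serve both purposes. -/
theorem exists' {S : (ℕ → ℕ) → α → β → Prop} (h : RE fun ρ (x : α × β) => S ρ x.1 x.2) :
    RE fun ρ a => ∃ b, S ρ a b := by
  obtain ⟨R, hR, hm, hS⟩ := h
  refine ⟨fun l a => ∃ c < l.length, ∃ b, (Encodable.decode c : Option β) = some b ∧ R l (a, b),
    ?_, ?_, fun ρ a => ?_⟩
  · refine primrecPred_exists_lt (p := fun (x : List ℕ × α) c =>
      ∃ b, (Encodable.decode c : Option β) = some b ∧ R x.1 (x.2, b)) ?_ (by fun_prop)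
    refine primrecPred_exists_mem_option (p := fun (x : (List ℕ × α) × ℕ) b =>
      R x.1.1 (x.1.2, b)) ?_ (Primrec.decode.comp Primrec.snd)
    exact PrimrecRel.comp hR (f := fun x : ((List ℕ × α) × ℕ) × β => x.1.1.1)
      (g := fun x => (x.1.1.2, x.2)) (by fun_prop) (by fun_prop)
  · rintro l l' a hl ⟨c, hc, b, hb, h⟩
    exact ⟨c, hc.trans_le hl.length_le, b, hb, hm _ _ _ hl h⟩
  · constructor
    · rintro ⟨b, hb⟩
      obtain ⟨N, hN⟩ := (hS ρ (a, b)).1 hb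
      refine ⟨max N (Encodable.encode b + 1), Encodable.encode b, ?_, b, Encodable.encodek b,
        hm _ _ _ (pref_prefix (le_max_left _ _)) hN⟩
      rw [length_pref]
      exact lt_of_lt_of_le (Nat.lt_succ_self _) (le_max_right _ _)
    · rintro ⟨N, c, -, b, -, h⟩
      exact ⟨b, (hS ρ (a, b)).2 ⟨N, h⟩⟩

theorem forall_lt {S : (ℕ → ℕ) → α → ℕ → Prop} (h : RE fun ρ (x : α × ℕ) => S ρ x.1 x.2)
    {f : α → ℕ} (hf : Primrec f) : RE fun ρ a => ∀ i < f a, S ρ a i := by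
  obtain ⟨R, hR, hm, hS⟩ := h
  refine ⟨fun l a => ∀ i < f a, R l (a, i), ?_, fun l l' a hl h i hi => hm _ _ _ hl (h i hi),
    fun ρ a => ?_⟩
  · refine primrecPred_forall_lt (p := fun (x : List ℕ × α) i => R x.1 (x.2, i)) ?_ (by fun_prop)
    exact PrimrecRel.comp hR (f := fun x : (List ℕ × α) × ℕ => x.1.1)
      (g := fun x => (x.1.2, x.2)) (by fun_prop) (by fun_prop)
  · constructor
    · intro h
      have h1 : ∀ i : Fin (f a), ∃ N, R (pref ρ N) (a, i) := fun i => (hS ρ (a, i)).1 (h i i.2)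
      choose N hN using h1
      exact ⟨Finset.univ.sup N, fun i hi =>
        hm _ _ _ (pref_prefix (Finset.le_sup (f := N) (Finset.mem_univ ⟨i, hi⟩))) (hN ⟨i, hi⟩)⟩
    · rintro ⟨N, hN⟩ i hi
      exact (hS ρ (a, i)).2 ⟨N, hN i hi⟩

theorem oracle {g : ℕ → ℕ} (hg : Primrec g) {f f' : α → ℕ} (hf : Primrec f) (hf' : Primrec f') :
    RE fun ρ a => g (ρ (f a)) = f' a := by
  refine ⟨fun l a => ∃ b, l[f a]? = some b ∧ g b = f' a, ?_, ?_, fun ρ a => ?_⟩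
  · exact primrecPred_exists_mem_option (p := fun (x : List ℕ × α) b => g b = f' x.2)
      (primrecPred_eq (f := fun x : (List ℕ × α) × ℕ => g x.2) (g := fun x => f' x.1.2)
        (by fun_prop) (by fun_prop)) (by fun_prop)
  · rintro l l' a ⟨t, rfl⟩ ⟨b, hb, hb'⟩
    exact ⟨b, by rw [List.getElem?_append_left (List.getElem?_eq_some_iff.1 hb).1, hb], hb'⟩
  · constructor
    · intro h
      exact ⟨f a + 1, _, getElem?_pref (Nat.lt_succ_self _), h⟩
    · rintro ⟨N, b, hb, hb'⟩
      have h1 : f a < N := by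
        have := (List.getElem?_eq_some_iff.1 hb).1
        rwa [length_pref] at this
      rw [getElem?_pref h1] at hb
      rw [Option.some.inj hb, hb']

/-- Evaluation with a bounded number of steps is primitive recursive, and the prefix length serves
as the bound. -/
theorem of_computable {f : α → β} (hf : Computable f) : RE fun _ (x : α × β) => f x.1 = x.2 := by
  obtain ⟨c, hc⟩ := Nat.Partrec.Code.exists_code.1 hf
  have hc' : ∀ a, c.eval (Encodable.encode a) = Part.some (Encodable.encode (f a)) := by
    intro a
    rw [hc]
    simp
  refine ⟨fun l x => ∃ k < l.length, c.evaln k (Encodable.encode x.1) =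
    some (Encodable.encode x.2), ?_, ?_, fun ρ x => ?_⟩
  · refine primrecPred_exists_lt (p := fun (y : List ℕ × α × β) k =>
      c.evaln k (Encodable.encode y.2.1) = some (Encodable.encode y.2.2)) ?_ (by fun_prop)
    refine primrecPred_eq (f := fun z : (List ℕ × α × β) × ℕ =>
      c.evaln z.2 (Encodable.encode z.1.2.1))
      (Nat.Partrec.Code.primrec_evaln.comp (g := fun z : (List ℕ × α × β) × ℕ =>
        ((z.2, c), Encodable.encode z.1.2.1)) (by fun_prop)) ?_
    · exact Primrec.option_some.comp (by fun_prop)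
  · rintro l l' a hl ⟨k, hk, h⟩
    exact ⟨k, hk.trans_le hl.length_le, h⟩
  · constructor
    · rintro h
      have h1 : Encodable.encode x.2 ∈ c.eval (Encodable.encode x.1) := by
        rw [hc', h]
        exact Part.mem_some _
      obtain ⟨k, hk⟩ := Nat.Partrec.Code.evaln_complete.1 h1
      exact ⟨k + 1, k, by rw [length_pref]; exact Nat.lt_succ_self k, hk⟩
    · rintro ⟨N, k, -, hk⟩
      have h1 := Nat.Partrec.Code.evaln_sound (x := Encodable.encode x.2) hk
      rw [hc'] at h1
      exact (Encodable.encode_injective (Part.mem_some_iff.1 h1)).symm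

/-- A semidecidable relation contains a semidecidable partial function with the same domain. -/
theorem uniformize {S : (ℕ → ℕ) → α → β → Prop} (h : RE fun ρ (x : α × β) => S ρ x.1 x.2) :
    ∃ Sel : (ℕ → ℕ) → α → β → Prop, RE (fun ρ (x : α × β) => Sel ρ x.1 x.2) ∧
      (∀ ρ a b, Sel ρ a b → S ρ a b) ∧ (∀ ρ a b b', Sel ρ a b → Sel ρ a b' → b = b') ∧
      ∀ ρ a, (∃ b, S ρ a b) → ∃ b, Sel ρ a b := by
  classical
  obtain ⟨R, hR, hm, hS⟩ := h
  -- A candidate `z` codes a prefix length and a value; the first accepted candidate is selected.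
  let ok : List ℕ → α → ℕ → Prop := fun l a z =>
    ∃ b, (Encodable.decode z.unpair.2 : Option β) = some b ∧ R (l.take z.unpair.1) (a, b)
  have hok : PrimrecPred fun x : (List ℕ × α) × ℕ => ok x.1.1 x.1.2 x.2 := by
    refine primrecPred_exists_mem_option (p := fun (x : (List ℕ × α) × ℕ) b =>
      R (x.1.1.take x.2.unpair.1) (x.1.2, b)) ?_ (Primrec.decode.comp (by fun_prop))
    exact PrimrecRel.comp hR (f := fun x : ((List ℕ × α) × ℕ) × β => x.1.1.1.take x.1.2.unpair.1)
      (g := fun x => (x.1.1.2, x.2)) (by fun_prop) (by fun_prop)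
  let ok' : (ℕ → ℕ) → α → ℕ → Prop := fun ρ a z =>
    ∃ b, (Encodable.decode z.unpair.2 : Option β) = some b ∧ R (pref ρ z.unpair.1) (a, b)
  -- The prefix length in `z` is at most `z`. So a prefix longer than `z` decides the candidate for
  -- good, and even the rejection of earlier candidates is monotone in the prefix.
  have hokok : ∀ ρ a z N, z < N → (ok (pref ρ N) a z ↔ ok' ρ a z) := by
    intro ρ a z N hz
    have h1 : (pref ρ N).take z.unpair.1 = pref ρ z.unpair.1 :=
      take_pref ((Nat.unpair_left_le z).trans hz.le)
    simp only [ok, ok', h1]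
  let Sel : (ℕ → ℕ) → α → β → Prop := fun ρ a b =>
    ∃ z, (Encodable.decode z.unpair.2 : Option β) = some b ∧ R (pref ρ z.unpair.1) (a, b) ∧
      ∀ z' < z, ¬ ok' ρ a z'
  refine ⟨Sel, ⟨fun l x => ∃ z < l.length, (Encodable.decode z.unpair.2 : Option β) = some x.2 ∧
    R (l.take z.unpair.1) x ∧ ∀ z' < z, ¬ ok l x.1 z', ?_, ?_, ?_⟩, ?_, ?_, ?_⟩
  · refine primrecPred_exists_lt (p := fun (y : List ℕ × α × β) z =>
      (Encodable.decode z.unpair.2 : Option β) = some y.2.2 ∧ R (y.1.take z.unpair.1) y.2 ∧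
        ∀ z' < z, ¬ ok y.1 y.2.1 z') ?_ (by fun_prop)
    refine PrimrecPred.and (primrecPred_eq (f := fun w : (List ℕ × α × β) × ℕ =>
      (Encodable.decode w.2.unpair.2 : Option β)) (Primrec.decode.comp (by fun_prop))
      (Primrec.option_some.comp (by fun_prop))) (PrimrecPred.and ?_ ?_)
    · exact PrimrecRel.comp hR (f := fun w : (List ℕ × α × β) × ℕ => w.1.1.take w.2.unpair.1)
        (g := fun w => w.1.2) (by fun_prop) (by fun_prop)
    · refine primrecPred_forall_lt (p := fun (w : (List ℕ × α × β) × ℕ) z' =>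
        ¬ ok w.1.1 w.1.2.1 z') (PrimrecPred.not ?_) (by fun_prop)
      exact PrimrecPred.comp hok (f := fun v : ((List ℕ × α × β) × ℕ) × ℕ =>
        ((v.1.1.1, v.1.1.2.1), v.2)) (by fun_prop)
  · rintro l l' x hl ⟨z, hz, h1, h2, h3⟩
    have h4 : ∀ z' ≤ z, l'.take z'.unpair.1 = l.take z'.unpair.1 := fun z' hz' =>
      take_eq_of_prefix hl ((Nat.unpair_left_le z').trans (hz'.trans hz.le))
    refine ⟨z, hz.trans_le hl.length_le, h1, by rwa [h4 z le_rfl], fun z' hz' h5 => h3 z' hz' ?_⟩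
    simp only [ok, h4 z' hz'.le] at h5
    exact h5
  · rintro ρ ⟨a, b⟩
    constructor
    · rintro ⟨z, h1, h2, h3⟩
      refine ⟨z + 1, z, by rw [length_pref]; exact Nat.lt_succ_self z, h1, ?_, ?_⟩
      · rwa [take_pref ((Nat.unpair_left_le z).trans (Nat.le_succ z))]
      · exact fun z' hz' h4 => h3 z' hz' ((hokok ρ a z' _ (hz'.trans (Nat.lt_succ_self z))).1 h4)
    · rintro ⟨N, z, hz, h1, h2, h3⟩
      rw [length_pref] at hz
      refine ⟨z, h1, ?_, fun z' hz' h4 => h3 z' hz' ((hokok ρ a z' N (hz'.trans hz)).2 h4)⟩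
      rwa [take_pref ((Nat.unpair_left_le z).trans hz.le)] at h2
  · rintro ρ a b ⟨z, -, h2, -⟩
    exact (hS ρ (a, b)).2 ⟨_, h2⟩
  · rintro ρ a b b' ⟨z, h1, h2, h3⟩ ⟨z', h1', h2', h3'⟩
    have hz : z = z' := by
      rcases lt_trichotomy z z' with h | h | h
      · exact (h3' z h ⟨b, h1, h2⟩).elim
      · exact h
      · exact (h3 z' h ⟨b', h1', h2'⟩).elim
    subst hz
    exact Option.some.inj (h1.symm.trans h1')
  · rintro ρ a ⟨b, hb⟩
    obtain ⟨N, hN⟩ := (hS ρ (a, b)).1 hb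
    have hex : ∃ z, ok' ρ a z := ⟨Nat.pair N (Encodable.encode b), b, by simp, by simpa using hN⟩
    obtain ⟨b', h1, h2⟩ := Nat.find_spec hex
    exact ⟨b', Nat.find hex, h1, h2, fun z' hz' => Nat.find_min hex hz'⟩

end RE

end CondRV

namespace CondRV

/-! ## Application of programs given by relations -/

/-- The graph of an infinite sequence. -/
def graph (f : ℕ → ℕ) : ℕ → ℕ → Prop := fun k v => f k = v

/-- The graph of a finite sequence. -/
def finGraph (l : List ℕ) : ℕ → ℕ → Prop := fun k v => l[k]? = some v

/-- The `n`-th slice of a sequence of sequences. -/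
def sliceRel (F : ℕ → ℕ → Prop) (n : ℕ) : ℕ → ℕ → Prop := fun k v => F (Nat.pair n k) v

/-- The output of the machine with program `F` on the input `G`, where the program and the input
are partially known. -/
def App (F G : ℕ → ℕ → Prop) (k v : ℕ) : Prop :=
  ∃ l : List ℕ, (∀ i < l.length, G i (l.getD i 0)) ∧ F (Encodable.encode (k, l)) (v + 1) ∧
    ∀ m < l.length, F (Encodable.encode (k, l.take m)) 0

/-- The machine with program `F` outputs a nonzero symbol on the input `G`. -/
def Acc (F G : ℕ → ℕ → Prop) : Prop := ∃ x : ℕ × ℕ, App F G x.1 (x.2 + 1)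

theorem getD_pref {p : ℕ → ℕ} {n i : ℕ} (h : i < n) : (pref p n).getD i 0 = p i := by
  simp [List.getD_eq_getElem?_getD, getElem?_pref h]

theorem eq_pref_of_forall {p : ℕ → ℕ} {l : List ℕ} (h : ∀ i < l.length, p i = l.getD i 0) :
    l = pref p l.length := by
  refine List.ext_getElem (by rw [length_pref]) fun i h1 h2 => ?_
  have := h i h1
  rw [List.getD_eq_getElem?_getD, List.getElem?_eq_getElem h1] at this
  simp [pref, this]

/-- With full knowledge, the witness for `App` can only be the prefix at which the machine first
answers. -/
theorem app_graph {a p q : ℕ → ℕ} (h : Apply a p q) : App (graph a) (graph p) = graph q := by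
  ext k v
  constructor
  · rintro ⟨l, h1, h2, h3⟩
    have h4 := eq_pref_of_forall h1
    obtain ⟨n, hn, hn'⟩ := h k
    have h3' : ∀ m < l.length, a (Encodable.encode (k, pref p m)) = 0 := fun m hm => by
      have h5 := h3 m hm
      rw [h4, take_pref hm.le] at h5
      exact h5
    have h2' : a (Encodable.encode (k, pref p l.length)) = v + 1 := by
      rw [← h4]; exact h2
    rcases lt_trichotomy n l.length with h6 | h6 | h6
    · rw [h3' n h6] at hn
      exact absurd hn (by simp)
    · rw [← h6, hn] at h2'
      exact Nat.succ_injective h2'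
    · rw [hn' _ h6] at h2'
      exact absurd h2' (by simp)
  · rintro rfl
    obtain ⟨n, hn, hn'⟩ := h k
    refine ⟨pref p n, fun i hi => ?_, hn, fun m hm => ?_⟩
    · rw [length_pref] at hi
      exact (getD_pref hi).symm
    · rw [length_pref] at hm
      rw [take_pref hm.le]
      exact hn' m hm

/-- The increasing sequence of partial functions `Fs` has the union `F`. -/
def Tends (Fs : ℕ → ℕ → ℕ → Prop) (F : ℕ → ℕ → Prop) : Prop :=
  (∀ t t', t ≤ t' → ∀ k v, Fs t k v → Fs t' k v) ∧ ∀ k v, F k v ↔ ∃ t, Fs t k v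

namespace Tends

variable {Fs Gs : ℕ → ℕ → ℕ → Prop} {F G : ℕ → ℕ → Prop}

theorem const (F : ℕ → ℕ → Prop) : Tends (fun _ => F) F :=
  ⟨fun _ _ _ _ _ h => h, fun _ _ => by simp⟩

theorem pref (p : ℕ → ℕ) : Tends (fun t => finGraph (pref p t)) (graph p) := by
  have h1 : ∀ t k v, finGraph (CondRV.pref p t) k v ↔ k < t ∧ p k = v := by
    intro t k v
    by_cases h : k < t
    · simp [finGraph, getElem?_pref h, h]
    · simp only [finGraph, h, false_and, iff_false]
      rw [List.getElem?_eq_none (by rw [length_pref]; exact not_lt.1 h)]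
      simp
  refine ⟨fun t t' htt k v h => ?_, fun k v => ?_⟩
  · exact (h1 _ _ _).2 ⟨((h1 _ _ _).1 h).1.trans_le htt, ((h1 _ _ _).1 h).2⟩
  · simp only [h1]
    exact ⟨fun h => ⟨k + 1, Nat.lt_succ_self k, h⟩, fun ⟨_, _, h⟩ => h⟩

theorem slice (h : Tends Fs F) (n : ℕ) : Tends (fun t => sliceRel (Fs t) n) (sliceRel F n) :=
  ⟨fun t t' htt _ v => h.1 t t' htt _ v, fun _ v => h.2 _ v⟩

theorem forall_lt (h : Tends Fs F) (n : ℕ) (k v : ℕ → ℕ) :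
    (∀ i < n, F (k i) (v i)) ↔ ∃ t, ∀ i < n, Fs t (k i) (v i) := by
  constructor
  · intro h1
    choose t ht using fun i : Fin n => (h.2 _ _).1 (h1 i i.2)
    exact ⟨Finset.univ.sup t, fun i hi =>
      h.1 _ _ (Finset.le_sup (f := t) (Finset.mem_univ ⟨i, hi⟩)) _ _ (ht ⟨i, hi⟩)⟩
  · rintro ⟨t, ht⟩ i hi
    exact (h.2 _ _).2 ⟨t, ht i hi⟩

/-- A computation consults finitely many symbols of program and input, so it already succeeds at
some stage. -/
theorem app (hF : Tends Fs F) (hG : Tends Gs G) : Tends (fun t => App (Fs t) (Gs t)) (App F G) := by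
  have hmono : ∀ t t', t ≤ t' → ∀ k v, App (Fs t) (Gs t) k v → App (Fs t') (Gs t') k v := by
    rintro t t' htt k v ⟨l, h1, h2, h3⟩
    exact ⟨l, fun i hi => hG.1 t t' htt _ _ (h1 i hi), hF.1 t t' htt _ _ h2,
      fun m hm => hF.1 t t' htt _ _ (h3 m hm)⟩
  refine ⟨hmono, fun k v => ⟨?_, ?_⟩⟩
  · rintro ⟨l, h1, h2, h3⟩
    obtain ⟨t₁, h1⟩ := (hG.forall_lt _ (fun i => i) (fun i => l.getD i 0)).1 h1
    obtain ⟨t₂, h2⟩ := (hF.2 _ _).1 h2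
    obtain ⟨t₃, h3⟩ := (hF.forall_lt _ (fun m => Encodable.encode (k, l.take m)) (fun _ => 0)).1 h3
    refine ⟨max t₁ (max t₂ t₃), l, fun i hi => hG.1 _ _ (le_max_left _ _) _ _ (h1 i hi),
      hF.1 _ _ ((le_max_left _ _).trans (le_max_right _ _)) _ _ h2, fun m hm =>
      hF.1 _ _ ((le_max_right _ _).trans (le_max_right _ _)) _ _ (h3 m hm)⟩
  · rintro ⟨t, l, h1, h2, h3⟩
    exact ⟨l, fun i hi => (hG.2 _ _).2 ⟨t, h1 i hi⟩, (hF.2 _ _).2 ⟨t, h2⟩,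
      fun m hm => (hF.2 _ _).2 ⟨t, h3 m hm⟩⟩

theorem acc (hF : Tends Fs F) (hG : Tends Gs G) : Acc F G ↔ ∃ t, Acc (Fs t) (Gs t) := by
  unfold Acc
  rw [exists_comm]
  exact exists_congr fun x => (hF.app hG).2 _ _

theorem acc_mono (hF : Tends Fs F) (hG : Tends Gs G) {t t' : ℕ} (h : t ≤ t')
    (hA : Acc (Fs t) (Gs t)) : Acc (Fs t') (Gs t') :=
  hA.imp fun _ hx => (hF.app hG).1 _ _ h _ _ hx

end Tends

section REF

variable {α β : Type*} [Primcodable α] [Primcodable β]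

/-- A family of partial functions which is semidecidable uniformly in an infinite sequence. -/
def REF (F : (ℕ → ℕ) → α → ℕ → ℕ → Prop) : Prop :=
  RE fun ρ (x : α × ℕ × ℕ) => F ρ x.1 x.2.1 x.2.2

namespace REF

variable {F G : (ℕ → ℕ) → α → ℕ → ℕ → Prop}

theorem comp {F : (ℕ → ℕ) → β → ℕ → ℕ → Prop} (hF : REF F) {f : α → β} (hf : Primrec f) :
    REF fun ρ a => F ρ (f a) :=
  RE.comp (β := β × ℕ × ℕ) hF (f := fun x : α × ℕ × ℕ => (f x.1, x.2)) (by fun_prop)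

theorem rel (hF : REF F) {f : β → α} {k v : β → ℕ} (hf : Primrec f) (hk : Primrec k)
    (hv : Primrec v) : RE fun ρ b => F ρ (f b) (k b) (v b) :=
  RE.comp hF (f := fun b => (f b, k b, v b)) (by fun_prop)

theorem oracle {g : ℕ → ℕ} (hg : Primrec g) : REF fun ρ (_ : α) => graph fun n => g (ρ n) :=
  RE.oracle hg (by fun_prop) (by fun_prop)

theorem finGraph {f : α → List ℕ} (hf : Primrec f) : REF fun _ a => finGraph (f a) :=
  RE.of_pred (primrecPred_eq (f := fun x : α × ℕ × ℕ => (f x.1)[x.2.1]?) (by fun_prop)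
    (Primrec.option_some.comp (by fun_prop)))

theorem const {f : α → ℕ} (hf : Primrec f) : REF fun _ a => graph fun _ => f a :=
  RE.of_pred (primrecPred_eq (f := fun x : α × ℕ × ℕ => f x.1) (by fun_prop) (by fun_prop))

theorem of_computable {f : ℕ → ℕ} (hf : Computable f) : REF fun _ (_ : α) => graph f :=
  RE.comp (RE.of_computable hf) (f := fun x : α × ℕ × ℕ => x.2) (by fun_prop)

theorem slice (hF : REF F) {n : α → ℕ} (hn : Primrec n) :
    REF fun ρ a => sliceRel (F ρ a) (n a) :=
  hF.rel (β := α × ℕ × ℕ) (f := fun x => x.1) (k := fun x => Nat.pair (n x.1) x.2.1)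
    (v := fun x => x.2.2) (by fun_prop) (by fun_prop) (by fun_prop)

theorem app (hF : REF F) (hG : REF G) : REF fun ρ a => App (F ρ a) (G ρ a) := by
  refine RE.exists' (RE.and (RE.forall_lt ?_ ?_) (RE.and ?_ (RE.forall_lt ?_ ?_)))
  · exact hG.rel (f := fun y : ((α × ℕ × ℕ) × List ℕ) × ℕ => y.1.1.1) (k := fun y => y.2)
      (v := fun y => y.1.2.getD y.2 0) (by fun_prop) (by fun_prop) (by fun_prop)
  · fun_prop
  · exact hF.rel (f := fun y : (α × ℕ × ℕ) × List ℕ => y.1.1)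
      (k := fun y => Encodable.encode (y.1.2.1, y.2)) (v := fun y => y.1.2.2 + 1)
      (by fun_prop) (by fun_prop) (by fun_prop)
  · exact hF.rel (f := fun y : ((α × ℕ × ℕ) × List ℕ) × ℕ => y.1.1.1)
      (k := fun y => Encodable.encode (y.1.1.2.1, y.1.2.take y.2)) (v := fun _ => 0)
      (by fun_prop) (by fun_prop) (by fun_prop)
  · fun_prop

theorem acc (hF : REF F) (hG : REF G) : RE fun ρ a => Acc (F ρ a) (G ρ a) :=
  RE.exists' ((hF.app hG).rel (f := fun y : α × ℕ × ℕ => y.1) (k := fun y => y.2.1)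
    (v := fun y => y.2.2 + 1) (by fun_prop) (by fun_prop) (by fun_prop))

end REF

end REF

/-! ## Names of open sets -/

/-- The set `S` of finite sequences describes the predicate `p`: it holds at a point if and only if
a prefix of one of its names, equivalently of each of its names, is in `S`. -/
def Describes {A : Type*} (δ : Rep A) (S : List ℕ → Prop) (p : A → Prop) : Prop :=
  ∀ ν a, δ ν a → (p a ↔ ∃ n, S (pref ν n))

theorem mem_iff_acc {A : Type*} [TopologicalSpace A] {δ : Rep A} {u : ℕ → ℕ} {U : Opens A}
    (h : Rep.opens δ u U) {ν : ℕ → ℕ} {a : A} (ha : δ ν a) :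
    a ∈ U ↔ Acc (graph u) (graph ν) := by
  obtain ⟨q, hq, hq'⟩ := h ν a ha
  have hq' : (∃ k, q k ≠ 0) ↔ a ∈ U := hq'
  rw [← hq', Acc, app_graph hq]
  constructor
  · rintro ⟨k, hk⟩
    exact ⟨(k, q k - 1), by simp only [graph]; lia⟩
  · rintro ⟨x, hx⟩
    exact ⟨x.1, by rw [show q x.1 = x.2 + 1 from hx]; simp⟩

theorem describes_acc {A : Type*} [TopologicalSpace A] {δ : Rep A} {u : ℕ → ℕ} {U : Opens A}
    (h : Rep.opens δ u U) : Describes δ (fun l => Acc (graph u) (finGraph l)) (· ∈ U) :=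
  fun ν _ ha => (mem_iff_acc h ha).trans ((Tends.const _).acc (Tends.pref ν))

/-- The program waits for `k` symbols of the argument. It then answers at position `k` whether `k`
symbols of `ρ` suffice to find a prefix in `S`. -/
theorem RE.exists_name {α : Type*} [Primcodable α] {S : (ℕ → ℕ) → α → List ℕ → Prop}
    (h : RE fun ρ (x : α × List ℕ) => S ρ x.1 x.2) :
    ∃ f : List ℕ × α × ℕ → ℕ, Primrec f ∧ ∀ ρ a (A : Type*) [TopologicalSpace A] (δ : Rep A)
      (U : Opens A), Describes δ (S ρ a) (· ∈ U) → Rep.opens δ (fun e => f (pref ρ e, a, e)) U := by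
  classical
  obtain ⟨R, hR, hm, hS⟩ := h
  let D : ℕ → ℕ × List ℕ := Denumerable.ofNat (ℕ × List ℕ)
  have hD : Primrec D := Primrec.ofNat _
  have hDe : ∀ x, D (Encodable.encode x) = x := fun x => Denumerable.ofNat_encode x
  -- In the convention of `Apply`, `0` requests input, and `1` and `2` stand for the symbols `0` and
  -- `1`.
  let f : List ℕ × α × ℕ → ℕ := fun x =>
    if (D x.2.2).2.length < (D x.2.2).1 then 0 else
      if ∃ i < (D x.2.2).1 + 1, R (x.1.take (D x.2.2).1) (x.2.1, (D x.2.2).2.take i) then 2 else 1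
  refine ⟨f, ?_, ?_⟩
  · have hD' : Primrec fun x : List ℕ × α × ℕ => D x.2.2 := hD.comp (by fun_prop)
    refine Primrec.ite (primrecPred_lt (by fun_prop) (by fun_prop)) (Primrec.const 0)
      (Primrec.ite (primrecPred_exists_lt (p := fun (x : List ℕ × α × ℕ) i =>
        R (x.1.take (D x.2.2).1) (x.2.1, (D x.2.2).2.take i)) ?_ (by fun_prop))
        (Primrec.const 2) (Primrec.const 1))
    have hD'' : Primrec fun x : (List ℕ × α × ℕ) × ℕ => D x.1.2.2 := hD.comp (by fun_prop)
    exact PrimrecRel.comp hR (f := fun x : (List ℕ × α × ℕ) × ℕ => x.1.1.take (D x.1.2.2).1)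
      (g := fun x => (x.1.2.1, (D x.1.2.2).2.take x.2)) (by fun_prop) (by fun_prop)
  · intro ρ a A _ δ U hU ν z hz
    have hval : ∀ k n, f (pref ρ (Encodable.encode (k, pref ν n)), a, Encodable.encode (k, pref ν n))
        = if n < k then 0 else
          if ∃ i < k + 1, R (pref ρ k) (a, (pref ν n).take i) then 2 else 1 := by
      intro k n
      -- The code of a pair is at least its first component, so enough of `ρ` is known at this
      -- position of the name.
      have h1 : (pref ρ (Encodable.encode (k, pref ν n))).take k = pref ρ k :=
        take_pref (by
          rw [Encodable.encode_prod_val]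
          exact Nat.left_le_pair _ _)
      simp only [f, hDe, length_pref, h1]
    refine ⟨fun k => if ∃ i < k + 1, R (pref ρ k) (a, (pref ν k).take i) then 1 else 0,
      fun k => ⟨k, ?_, fun m hm' => ?_⟩, ?_⟩
    · refine (hval k k).trans ?_
      rw [if_neg (lt_irrefl k)]
      beta_reduce
      split_ifs <;> rfl
    · exact (hval k m).trans (if_pos hm')
    · refine Iff.trans ?_ (hU ν z hz).symm
      simp only [ne_eq, ite_eq_right_iff, one_ne_zero, imp_false, not_not]
      constructor
      · rintro ⟨k, i, hi, h1⟩
        rw [take_pref (Nat.le_of_lt_succ hi)] at h1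
        exact ⟨i, (hS ρ (a, pref ν i)).2 ⟨k, h1⟩⟩
      · rintro ⟨i, hi⟩
        obtain ⟨N, hN⟩ := (hS ρ (a, pref ν i)).1 hi
        refine ⟨max N i, i, Nat.lt_succ_of_le (le_max_right _ _), ?_⟩
        rw [take_pref (le_max_right _ _)]
        exact hm _ _ _ (pref_prefix (le_max_left _ _)) hN

/-- Position `e` of the name needs `e` symbols of `ρ`, so the graph of the name is itself
semidecidable. It can then be fed to other programs through `App`. -/
theorem RE.exists_nameGraph {α : Type*} [Primcodable α] {S : (ℕ → ℕ) → α → List ℕ → Prop}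
    (h : RE fun ρ (x : α × List ℕ) => S ρ x.1 x.2) :
    ∃ u : (ℕ → ℕ) → α → ℕ → ℕ, REF (fun ρ a => graph (u ρ a)) ∧
      ∀ ρ a (A : Type*) [TopologicalSpace A] (δ : Rep A) (U : Opens A),
        Describes δ (S ρ a) (· ∈ U) → Rep.opens δ (u ρ a) U := by
  obtain ⟨f, hf, hf'⟩ := h.exists_name
  refine ⟨fun ρ a e => f (pref ρ e, a, e), ?_, hf'⟩
  refine ⟨fun l x => x.2.1 < l.length + 1 ∧ f (l.take x.2.1, x.1, x.2.1) = x.2.2, ?_, ?_, ?_⟩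
  · exact PrimrecPred.and (primrecPred_lt (f := fun y : List ℕ × α × ℕ × ℕ => y.2.2.1)
      (by fun_prop) (by fun_prop)) (primrecPred_eq (f := fun y : List ℕ × α × ℕ × ℕ =>
        f (y.1.take y.2.2.1, y.2.1, y.2.2.1)) (hf.comp (by fun_prop)) (by fun_prop))
  · rintro l l' x hl ⟨h1, h2⟩
    exact ⟨h1.trans_le (Nat.succ_le_succ hl.length_le), by
      rw [take_eq_of_prefix hl (Nat.le_of_lt_succ h1)]; exact h2⟩
  · rintro ρ ⟨a, e, v⟩
    constructor
    · intro h1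
      refine ⟨e, by rw [length_pref]; exact Nat.lt_succ_self e, ?_⟩
      rw [take_pref le_rfl]
      exact h1
    · rintro ⟨N, h1, h2⟩
      rw [length_pref] at h1
      rw [take_pref (Nat.le_of_lt_succ h1)] at h2
      exact h2

/-- A machine which reads as many symbols as the position of the output symbol says. -/
theorem exists_apply_of_prefix {h : List ℕ → ℕ → ℕ} (hh : Primrec₂ h) :
    ∃ a : ℕ → ℕ, Primrec a ∧ ∀ ρ, Apply a ρ fun k => h (pref ρ k) k := by
  let D : ℕ → ℕ × List ℕ := Denumerable.ofNat (ℕ × List ℕ)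
  have hD : Primrec D := Primrec.ofNat _
  have hDe : ∀ x, D (Encodable.encode x) = x := fun x => Denumerable.ofNat_encode x
  refine ⟨fun z => if (D z).2.length < (D z).1 then 0 else h ((D z).2.take (D z).1) (D z).1 + 1,
    ?_, fun ρ k => ⟨k, ?_, fun m hm => ?_⟩⟩
  · refine Primrec.ite (primrecPred_lt (by fun_prop) (by fun_prop)) (Primrec.const 0) ?_
    exact Primrec.succ.comp (hh.comp (by fun_prop) (by fun_prop))
  · simp only [hDe, length_pref, lt_irrefl, if_false, take_pref le_rfl]
  · simp only [hDe, length_pref, hm, if_true]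

/-- Currying: an operation on pairs of sequences is computed by a machine which maps the first
argument to a program. -/
theorem exists_curry {h : List ℕ → ℕ → ℕ} (hh : Primrec₂ h) :
    ∃ a : ℕ → ℕ, Computable a ∧ ∀ ρ, ∃ r, Apply a ρ r ∧
      ∀ w, Apply r w fun k => h (pref (pairSeq ρ w) k) k := by
  let D : ℕ → ℕ × List ℕ := Denumerable.ofNat (ℕ × List ℕ)
  have hD : Primrec D := Primrec.ofNat _
  have hDe : ∀ x, D (Encodable.encode x) = x := fun x => Denumerable.ofNat_encode x
  -- Rebuilds a prefix of the paired input from prefixes of its two components.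
  let zip : List ℕ → List ℕ → ℕ → List ℕ := fun l l' k =>
    (List.range k).map fun i => Nat.pair (l.getD i 0) (l'.getD i 0)
  let h' : List ℕ → ℕ → ℕ := fun l z =>
    if (D z).2.length < (D z).1 then 0 else h (zip l (D z).2 (D z).1) (D z).1 + 1
  have hh' : Primrec₂ h' := by
    have hD' : Primrec fun x : List ℕ × ℕ => D x.2 := hD.comp (by fun_prop)
    refine Primrec.ite (primrecPred_lt (by fun_prop) (by fun_prop)) (Primrec.const 0) ?_
    refine Primrec.succ.comp (hh.comp (Primrec.list_map (Primrec.list_range.comp (by fun_prop))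
      ?_) (by fun_prop))
    have hD'' : Primrec fun x : (List ℕ × ℕ) × ℕ => D x.1.2 := hD.comp (by fun_prop)
    change Primrec fun x : (List ℕ × ℕ) × ℕ =>
      Nat.pair (x.1.1.getD x.2 0) ((D x.1.2).2.getD x.2 0)
    fun_prop
  obtain ⟨a, ha, ha'⟩ := exists_apply_of_prefix hh'
  refine ⟨a, ha.to_comp, fun ρ => ⟨_, ha' ρ, fun w k => ⟨k, ?_, fun m hm => ?_⟩⟩⟩
  · have hle : k ≤ Encodable.encode (k, pref w k) := by
      rw [Encodable.encode_prod_val]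
      exact Nat.left_le_pair _ _
    have hz : zip (pref ρ (Encodable.encode (k, pref w k))) (pref w k) k =
        pref (pairSeq ρ w) k := by
      refine List.map_congr_left fun i hi => ?_
      have hi := List.mem_range.1 hi
      rw [getD_pref (hi.trans_le hle), getD_pref hi]
      rfl
    simp only [h', hDe, length_pref, lt_irrefl, if_false, hz]
  · simp only [h', hDe, length_pref, hm, if_true]

/-- A semidecidable relation which describes sequences of open sets for each pair of sequences
yields a machine which computes names of them. -/
theorem RE.exists_machine {Φ : (ℕ → ℕ) → ℕ → List ℕ → Prop}
    (h : RE fun ρ (x : ℕ × List ℕ) => Φ ρ x.1 x.2) :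
    ∃ a : ℕ → ℕ, Computable a ∧ ∀ ρ, ∃ r, Apply a ρ r ∧ ∀ w, ∃ o, Apply r w o ∧
      ∀ (A : Type*) [TopologicalSpace A] (δ : Rep A) (U : ℕ → Opens A),
        (∀ n, Describes δ (Φ (pairSeq ρ w) n) (· ∈ U n)) → Rep.seq (Rep.opens δ) o U := by
  obtain ⟨f, hf, hf'⟩ := h.exists_name
  obtain ⟨a, ha, ha'⟩ := exists_curry
    (h := fun l k => f (l.take k.unpair.2, k.unpair.1, k.unpair.2)) (hf.comp (by fun_prop))
  refine ⟨a, ha, fun ρ => ?_⟩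
  obtain ⟨r, hr, hr'⟩ := ha' ρ
  refine ⟨r, hr, fun w => ⟨_, hr' w, fun A _ δ U hU n => ?_⟩⟩
  have h1 := hf' (pairSeq ρ w) n A δ (U n) (hU n)
  convert h1 using 1
  funext e
  -- Position `e` of slice `n` sits at `Nat.pair n e ≥ e`, so enough input has been read.
  have h2 : (pref (pairSeq ρ w) (Nat.pair n e)).take e = pref (pairSeq ρ w) e :=
    take_pref (Nat.right_le_pair _ _)
  simp only [slice, Nat.unpair_pair, h2]

end CondRV

/-! ### Oscillation bounds for the limit of the joint random variables -/

namespace CondRV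

/-- Fatou's lemma for sets: the limit inferior is an increasing union of sets, each contained in one
of the `E N`. -/
theorem measure_eventually_mem_le {Ω : Type*} [MeasurableSpace Ω] {P : Measure Ω}
    {E : ℕ → Set Ω} {η : ℝ≥0∞} (h : ∀ n, P (E n) ≤ η) : P {ω | ∀ᶠ n in atTop, ω ∈ E n} ≤ η := by
  have h1 : {ω | ∀ᶠ n in atTop, ω ∈ E n} = ⋃ N, ⋂ n ≥ N, E n := by
    ext ω
    simp [eventually_atTop]
  have h2 : Monotone fun N => ⋂ n ≥ N, E n := fun N M hNM =>
    Set.biInter_subset_biInter_left fun n (hn : M ≤ n) => hNM.trans hn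
  rw [h1, h2.measure_iUnion]
  exact iSup_le fun N => (measure_mono (Set.biInter_subset_of_mem (le_refl N))).trans (h N)

section Levels

open LowerMeas RandomVariable

variable {Ω : Type*} [TopologicalSpace Ω] [MeasurableSpace Ω] [OpensMeasurableSpace Ω]
  {P : Measure Ω} [IsProbabilityMeasure P]
  {X Y X' Y' : Type*} [MetricSpace X] [MetricSpace Y] [MetricSpace X'] [MetricSpace Y']
  [MeasurableSpace X'] [BorelSpace X'] [MeasurableSpace Y'] [BorelSpace Y']
  {iX : X → X'} {iY : Y → Y'} [SeparableSpace X'] [SeparableSpace Y']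
  {T : MeasureTopology P} {X₀ : RandomVariable P X} {Yc : ConditionalRV P X Y}
  {g : Ω → X'} {y : X → Ω → Y'}

theorem JointApprox.fst_ae_eq {gs : ℕ → Ω → X'} {Gs : ℕ → Ω → X' × Y'}
    (h : JointApprox T iX g y gs Gs) {G : Ω → X' × Y'} (hG : TendstoInMeasure P Gs atTop G) :
    ∀ᵐ ω ∂P, (G ω).1 = g ω := by
  refine tendstoInMeasure_ae_unique (f := gs) ?_ h.tendsto
  refine tendstoInMeasure_iff_dist.2 fun δ hδ => ?_
  refine tendsto_of_tendsto_of_tendsto_of_le_of_le tendsto_const_nhds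
    (tendstoInMeasure_iff_dist.1 hG δ hδ) (fun _ => zero_le) fun n => measure_mono_ae ?_
  filter_upwards [h.fst n] with ω h1 (h2 : δ ≤ dist (gs n ω) (G ω).1)
  rw [← h1] at h2
  exact h2.trans (le_max_left _ _)

/-- If on each of the disjoint open sets `D i` the conditional random variable is close to its
value at `c i`, then so is the second component of the joint random variable. -/
theorem JointApprox.measure_far_le (hiX : Isometry iX) (hiY : Isometry iY)
    (hY : Yc.IndependentOf T) (hy : ∀ x, Realizes iY (y x) (Yc.toFun x)) {gs : ℕ → Ω → X'}
    {Gs : ℕ → Ω → X' × Y'} (h : JointApprox T iX g y gs Gs) {G : Ω → X' × Y'}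
    (hG : TendstoInMeasure P Gs atTop G) {n : ℕ} {m : ℕ → ℕ} {c : ℕ → X} {D : ℕ → Set X'}
    {v : ℕ → ℕ → Y'} {ε : ℝ} {η : ℝ≥0∞} (hDo : ∀ i < n, IsOpen (D i))
    (hD : ∀ i < n, ∀ j < n, ∀ x, x ∈ D i → x ∈ D j → i = j)
    (hosc : ∀ i < n, ∀ x, iX x ∈ D i →
      P {ω | ∀ j < m i, ¬ (dist (y (c i) ω) (v i j) < ε ∧ dist (y x ω) (v i j) < ε)} ≤ η) :
    P {ω | ∃ i < n, (G ω).1 ∈ D i ∧ ¬ (dist (y (c i) ω) (G ω).2 ≤ 2 * ε ∧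
      ∃ j < m i, dist (y (c i) ω) (v i j) < ε)} ≤ η := by
  classical
  have : SecondCountableTopology Y' := UniformSpace.secondCountable_of_separable Y'
  obtain ⟨ns, -, hlim⟩ := hG.exists_seq_tendsto_ae
  -- Disjointness makes the index of the piece containing `x` unique; the default `0` only serves
  -- points outside all pieces.
  let idx : X → ℕ := fun x => if h : ∃ i < n, iX x ∈ D i then h.choose else 0
  have hidx : ∀ x, ∀ i < n, iX x ∈ D i → idx x = i := by
    intro x i hi hx
    have h1 : ∃ i < n, iX x ∈ D i := ⟨i, hi, hx⟩
    have h2 : idx x = h1.choose := dif_pos h1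
    rw [h2]
    exact hD _ h1.choose_spec.1 i hi _ h1.choose_spec.2 hx
  have hE := fun l => h.measure_le_of_indep hiX hiY hY hy h (ns l) (ns l)
    (R := fun x x' => x' = x ∧ ∃ i < n, iX x ∈ D i) (a := fun x _ => c (idx x)) (b := fun x _ => x)
    (B := fun x _ => {p : Y' × Y' | ∀ j < m (idx x),
      ¬ (dist p.1 (v (idx x) j) < ε ∧ dist p.2 (v (idx x) j) < ε)}) (fun x _ => by
        have h1 : {p : Y' × Y' | ∀ j < m (idx x),
            ¬ (dist p.1 (v (idx x) j) < ε ∧ dist p.2 (v (idx x) j) < ε)} =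
            ⋂ j ∈ Set.Iio (m (idx x)), {p : Y' × Y' |
              dist p.1 (v (idx x) j) < ε ∧ dist p.2 (v (idx x) j) < ε}ᶜ := by
          ext p
          simp
        rw [h1]
        refine MeasurableSet.biInter (Set.to_countable _) fun j _ => MeasurableSet.compl ?_
        exact (measurableSet_lt (measurable_fst.dist measurable_const) measurable_const).inter
          (measurableSet_lt (measurable_snd.dist measurable_const) measurable_const))
    (η := η) (by
      rintro x x' ⟨-, i, hi, hx⟩
      rw [hidx x i hi hx]
      exact hosc i hi x hx)
  -- Along an almost surely convergent subsequence, a bad `ω` for the limit is bad eventually: if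
  -- the approximations were infinitely often in a common ball with `y (c i)`, the limit would
  -- inherit this.
  refine (measure_mono_ae ?_).trans (measure_eventually_mem_le hE)
  choose F hF using fun l => h.finite (ns l)
  have hs : ∀ᵐ ω ∂P, ∀ l, ∀ x ∈ F l, gs (ns l) ω = iX x → (Gs (ns l) ω).2 = y x ω :=
    ae_all_iff.2 fun l => (ae_ball_iff (F l).countable_toSet).2 fun x _ => h.snd (ns l) x
  filter_upwards [hlim, ae_all_iff.2 hF, hs, ae_all_iff.2 fun l => h.fst (ns l)] with ω h1 h2 h3 h4
    ⟨i, hi, h5, h6⟩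
  by_contra h7
  change ¬ (∀ᶠ l in atTop, _) at h7
  rw [not_eventually] at h7
  refine h6 ?_
  have h8 : ∀ᶠ l in atTop, gs (ns l) ω ∈ D i := by
    have := (continuous_fst.tendsto (G ω)).comp h1
    filter_upwards [this.eventually ((hDo i hi).mem_nhds h5)] with l hl
    rw [← h4 l]
    exact hl
  have h9 : ∃ᶠ l in atTop, ∃ j < m i, dist (y (c i) ω) (v i j) < ε ∧
      dist (Gs (ns l) ω).2 (v i j) < ε := by
    refine (h7.and_eventually h8).mono ?_
    rintro l ⟨h9, h10⟩
    obtain ⟨x, hx, hgx⟩ := h2 l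
    rw [hgx] at h10
    by_contra h11
    push Not at h11
    refine h9 ⟨x, x, ⟨rfl, i, hi, h10⟩, hgx, hgx, ?_⟩
    intro j hj h12
    rw [hidx x i hi h10] at hj h12
    refine (h11 j hj h12.1).not_gt ?_
    rw [h3 l x hx hgx]
    exact h12.2
  constructor
  -- The strict bound is weakened to a closed condition, which survives the limit.
  · have h10 : IsClosed {z : Y' | dist (y (c i) ω) z ≤ 2 * ε} :=
      isClosed_le (continuous_const.dist continuous_id) continuous_const
    refine h10.mem_of_frequently_of_tendsto (h9.mono ?_)
      ((continuous_snd.tendsto (G ω)).comp h1)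
    rintro l ⟨j, -, h11, h12⟩
    have := dist_triangle_right (y (c i) ω) (Gs (ns l) ω).2 (v i j)
    change dist (y (c i) ω) (Gs (ns l) ω).2 ≤ 2 * ε
    linarith
  · obtain ⟨l, j, hj, h11, -⟩ := h9.exists
    exact ⟨j, hj, h11⟩

end Levels

end CondRV

namespace CondRV

/-! ### Fast sequences from approximations with summable errors -/

section FastLimit

variable {Ω : Type*} [TopologicalSpace Ω] [MeasurableSpace Ω] [OpensMeasurableSpace Ω]
  {P : Measure Ω} [IsFiniteMeasure P]

/-- The set of points which are in `U k` for all `k` in an interval of length `n + 4`. -/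
def window (U : ℕ → Opens Ω) (n : ℕ) : Opens Ω :=
  ⨆ N : ℕ, (Finset.range (n + 4)).inf fun i => U (N + i)

theorem mem_window {U : ℕ → Opens Ω} {n : ℕ} {ω : Ω} :
    ω ∈ window U n ↔ ∃ N, ∀ i < n + 4, ω ∈ U (N + i) := by
  rw [window, Opens.mem_iSup]
  refine exists_congr fun N => ?_
  rw [← SetLike.mem_coe, Opens.coe_finset_inf]
  simp

theorem tsum_inv_two_pow_add (k : ℕ) : ∑' i, (2⁻¹ : ℝ≥0∞) ^ (k + i + 1) = 2⁻¹ ^ k := by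
  simp only [add_assoc, pow_add _ k]
  rw [ENNReal.tsum_mul_left, ENNReal.tsum_geometric_add_one]
  simp [ENNReal.one_sub_inv_two, ENNReal.inv_mul_cancel]

/-- The limit inferior of open sets with quickly decreasing differences is represented by the
windows. -/
theorem exists_fastSeq_window {U : ℕ → Opens Ω}
    (h : ∀ k, P ((U k : Set Ω) \ U (k + 1)) ≤ 4 * 2⁻¹ ^ k) :
    ∃ S : FastSeq P, S.seq = window U ∧ S.inter =ᵐ[P] {ω | ∀ᶠ k in atTop, ω ∈ U k} := by
  have hLm : MeasurableSet {ω | ∀ᶠ k in atTop, ω ∈ U k} := by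
    have h1 : {ω | ∀ᶠ k in atTop, ω ∈ U k} = ⋃ N, ⋂ n, (U (N + n) : Set Ω) := by
      ext ω
      simp only [Set.mem_ofPred_eq, eventually_atTop, Set.mem_iUnion, Set.mem_iInter,
        SetLike.mem_coe]
      refine exists_congr fun N => ⟨fun h n => h _ (Nat.le_add_right _ _), fun h n hn => ?_⟩
      obtain ⟨d, rfl⟩ := Nat.exists_eq_add_of_le hn
      exact h d
    rw [h1]
    exact MeasurableSet.iUnion fun N => MeasurableSet.iInter fun n =>
      (U (N + n)).isOpen.measurableSet
  have hL : ∀ n, {ω | ∀ᶠ k in atTop, ω ∈ U k} ⊆ (window U n : Set Ω) := by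
    intro n ω hω
    obtain ⟨N, hN⟩ := eventually_atTop.1 hω
    exact mem_window.2 ⟨N, fun i _ => hN _ (Nat.le_add_right _ _)⟩
  refine ⟨FastSeq.ofBound {ω | ∀ᶠ k in atTop, ω ∈ U k} (window U) ?_ hL ?_, rfl,
    FastSeq.ofBound_inter _ _ _ _ _ hLm⟩
  · intro n m hnm ω hω
    obtain ⟨N, hN⟩ := mem_window.1 hω
    exact mem_window.2 ⟨N, fun i hi => hN i (by lia)⟩
  · intro n
    -- A point of the window which is not eventually in the `U k` must leave at some index of at
    -- least `n + 3`, because the window has length `n + 4`. The exits from there on cost at most `4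
    -- * 2⁻¹ ^ (n + 2) = 2⁻¹ ^ n`.
    have h2 : (window U n : Set Ω) ⊆ {ω | ∀ᶠ k in atTop, ω ∈ U k} ∪
        ⋃ i : ℕ, ((U (n + 3 + i) : Set Ω) \ U (n + 3 + i + 1)) := by
      intro ω hω
      obtain ⟨N, hN⟩ := mem_window.1 hω
      by_contra hcon
      simp only [Set.mem_union, Set.mem_iUnion, Set.mem_sdiff, not_or, not_exists, not_and,
        not_not] at hcon
      refine hcon.1 (eventually_atTop.2 ⟨N + (n + 3), fun k hk => ?_⟩)
      induction k, hk using Nat.le_induction with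
      | base => exact hN _ (by lia)
      | succ k hk ih =>
        have := hcon.2 (k - (n + 3))
        rw [show n + 3 + (k - (n + 3)) = k by lia] at this
        exact this ih
    refine (measure_mono h2).trans ((measure_union_le _ _).trans ?_)
    gcongr
    refine (measure_iUnion_le _).trans ((ENNReal.tsum_le_tsum fun i => h (n + 3 + i)).trans ?_)
    rw [← tsum_inv_two_pow_add]
    refine ENNReal.tsum_le_tsum fun i => ?_
    rw [show n + 3 + i = (n + i + 1) + 2 by ring, pow_add _ _ 2, ← mul_assoc, mul_comm (4 : ℝ≥0∞),
      mul_assoc]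
    have : (4 : ℝ≥0∞) * 2⁻¹ ^ 2 = 1 := by
      rw [← ENNReal.inv_pow]
      norm_num
      exact ENNReal.mul_inv_cancel (by simp) (by simp)
    rw [this, mul_one]

end FastLimit

/-! ### Approximation of the joint random variable at a given accuracy -/

section Levels

open LowerMeas RandomVariable

variable {Ω : Type*} [TopologicalSpace Ω] [MeasurableSpace Ω] [OpensMeasurableSpace Ω]
  {P : Measure Ω} [IsProbabilityMeasure P]
  {X Y X' Y' : Type*} [MetricSpace X] [MetricSpace Y] [MetricSpace X'] [MetricSpace Y']
  [MeasurableSpace X'] [BorelSpace X'] [MeasurableSpace Y'] [BorelSpace Y']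
  {iX : X → X'} {iY : Y → Y'} [SeparableSpace X'] [SeparableSpace Y']
  {T : MeasureTopology P} {X₀ : RandomVariable P X} {Yc : ConditionalRV P X Y}
  {g : Ω → X'} {y : X → Ω → Y'}

/-- Data which determine the joint random variable up to `2⁻ᵏ`: disjoint open sets `D i` for
`i < n` on which the conditional random variable is close to its value at `c i`, balls around
`v i j` for `j < m i` which contain this value, and open sets `A i j` and `B i j` which approximate
the events that `g ∈ D i` and that `y (c i)` is in the ball around `v i j`. -/
structure Level (P : Measure Ω) (iX : X → X') (iY : Y → Y') (g : Ω → X') (y : X → Ω → Y')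
    (k : ℕ) where
  n : ℕ
  m : ℕ → ℕ
  c : ℕ → X
  v : ℕ → ℕ → Y
  D : ℕ → Set X'
  A : ℕ → ℕ → Opens Ω
  B : ℕ → ℕ → Opens Ω
  isOpen : ∀ i < n, IsOpen (D i)
  disjoint : ∀ i < n, ∀ j < n, ∀ x, x ∈ D i → x ∈ D j → i = j
  dist_le : ∀ i < n, ∀ z ∈ D i, dist (iX (c i)) z ≤ 2 * (1 / 2) ^ k
  osc : ∀ i < n, ∀ x, iX x ∈ D i → P {ω | ∀ j < m i,
    ¬ (dist (y (c i) ω) (iY (v i j)) < (1 / 2) ^ k ∧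
      dist (y x ω) (iY (v i j)) < (1 / 2) ^ k)} ≤ 2⁻¹ ^ k
  cover : P {ω | ∀ i < n, g ω ∉ D i} ≤ 2⁻¹ ^ k
  A_mem : ∀ i < n, ∀ j < m i, ∀ᵐ ω ∂P, g ω ∈ D i → ω ∈ A i j
  A_le : ∀ i < n, ∀ j < m i, P {ω | ω ∈ A i j ∧ g ω ∉ D i} ≤ 2⁻¹ ^ (k + Nat.pair i j + 2)
  B_mem : ∀ i < n, ∀ j < m i, ∀ᵐ ω ∂P, dist (y (c i) ω) (iY (v i j)) < (1 / 2) ^ k → ω ∈ B i j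
  B_le : ∀ i < n, ∀ j < m i, P {ω | ω ∈ B i j ∧
    ¬ dist (y (c i) ω) (iY (v i j)) < (1 / 2) ^ k} ≤ 2⁻¹ ^ (k + Nat.pair i j + 2)

/-- The pairs which pass the test `t k` are close to points of `W` only, and all pairs which are
close to a given point of `W` pass the test eventually. -/
structure IsTest (iX : X → X') (iY : Y → Y') (W : Set (X' × Y')) (t : ℕ → X → Y → Prop) :
    Prop where
  mem : ∀ k c v z, t k c v → dist (iX c, iY v) z ≤ 3 * (1 / 2) ^ k → z ∈ W
  succ : ∀ k c v c' v', t k c v → dist c c' ≤ 5 * (1 / 2) ^ k → dist v v' ≤ 5 * (1 / 2) ^ k →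
    t (k + 1) c' v'
  eventually : ∀ z ∈ W, ∀ᶠ k in atTop, ∀ c v, dist (iX c, iY v) z ≤ 3 * (1 / 2) ^ k → t k c v

namespace Level

variable {k : ℕ} (l : Level P iX iY g y k)

/-- The open set of the selected pairs of events. -/
def select (t : X → Y → Prop) : Opens Ω :=
  ⟨{ω | ∃ i < l.n, ∃ j < l.m i, t (l.c i) (l.v i j) ∧ ω ∈ l.A i j ∧ ω ∈ l.B i j}, by
    have h : {ω | ∃ i < l.n, ∃ j < l.m i, t (l.c i) (l.v i j) ∧ ω ∈ l.A i j ∧ ω ∈ l.B i j} =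
        ⋃ i ∈ {i | i < l.n}, ⋃ j ∈ {j | j < l.m i ∧ t (l.c i) (l.v i j)},
          ((l.A i j : Set Ω) ∩ l.B i j) := by
      ext ω
      simp only [Set.mem_ofPred_eq, Set.mem_iUnion, Set.mem_inter_iff, SetLike.mem_coe,
        exists_prop, and_assoc]
    rw [h]
    exact isOpen_biUnion fun i _ => isOpen_biUnion fun j _ => (l.A i j).isOpen.inter
      (l.B i j).isOpen⟩

/-- The event which is approximated by `select t`. -/
def exact (t : X → Y → Prop) : Set Ω :=
  {ω | ∃ i < l.n, ∃ j < l.m i, t (l.c i) (l.v i j) ∧ g ω ∈ l.D i ∧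
    dist (y (l.c i) ω) (iY (l.v i j)) < (1 / 2) ^ k}

theorem ae_mem_select (t : X → Y → Prop) : ∀ᵐ ω ∂P, ω ∈ l.exact t → ω ∈ l.select t := by
  have h : ∀ᵐ ω ∂P, ∀ i j, i < l.n → j < l.m i → (g ω ∈ l.D i → ω ∈ l.A i j) ∧
      (dist (y (l.c i) ω) (iY (l.v i j)) < (1 / 2) ^ k → ω ∈ l.B i j) :=
    ae_all_iff.2 fun i => ae_all_iff.2 fun j => by
      by_cases hi : i < l.n
      · by_cases hj : j < l.m i
        · filter_upwards [l.A_mem i hi j hj, l.B_mem i hi j hj] with ω h1 h2 _ _ using ⟨h1, h2⟩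
        · simp [hj]
      · simp [hi]
  filter_upwards [h] with ω hω ⟨i, hi, j, hj, h1, h2, h3⟩
  exact ⟨i, hi, j, hj, h1, (hω i j hi hj).1 h2, (hω i j hi hj).2 h3⟩

/-- The pair with code `s` contributes two errors of `2⁻¹ ^ (k + s + 2)`. So the total stays below
`2⁻¹ ^ k` whatever the number of pairs. -/
theorem measure_select_sdiff_le (t : X → Y → Prop) :
    P ((l.select t : Set Ω) \ l.exact t) ≤ 2⁻¹ ^ k := by
  have h1 : (l.select t : Set Ω) \ l.exact t ⊆ ⋃ s : ℕ,
      {ω | s.unpair.1 < l.n ∧ s.unpair.2 < l.m s.unpair.1 ∧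
        ((ω ∈ l.A s.unpair.1 s.unpair.2 ∧ g ω ∉ l.D s.unpair.1) ∨
        (ω ∈ l.B s.unpair.1 s.unpair.2 ∧
          ¬ dist (y (l.c s.unpair.1) ω) (iY (l.v s.unpair.1 s.unpair.2)) < (1 / 2) ^ k))} := by
    rintro ω ⟨⟨i, hi, j, hj, h1, h2, h3⟩, h4⟩
    refine Set.mem_iUnion.2 ⟨Nat.pair i j, ?_⟩
    simp only [Nat.unpair_pair, Set.mem_ofPred_eq]
    refine ⟨hi, hj, ?_⟩
    by_contra h5
    push Not at h5
    exact h4 ⟨i, hi, j, hj, h1, h5.1 h2, h5.2 h3⟩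
  refine (measure_mono h1).trans ((measure_iUnion_le _).trans ?_)
  rw [← tsum_inv_two_pow_add k]
  refine ENNReal.tsum_le_tsum fun s => ?_
  by_cases hs : s.unpair.1 < l.n ∧ s.unpair.2 < l.m s.unpair.1
  · have h2 := l.A_le _ hs.1 _ hs.2
    have h3 := l.B_le _ hs.1 _ hs.2
    rw [Nat.pair_unpair] at h2 h3
    rw [← FastSeq.two_mul_pow (k + s + 1)]
    refine (measure_mono fun ω hω => ?_).trans ((measure_union_le _ _).trans (add_le_add h2 h3))
    exact hω.2.2
  · refine (measure_mono_null (t := ∅) (fun ω hω => hs ⟨hω.1, hω.2.1⟩) measure_empty).le.trans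
      bot_le

/-- The event that the level gives a good approximation of `G`. -/
def good (G : Ω → X' × Y') : Set Ω :=
  {ω | (∃ i < l.n, g ω ∈ l.D i) ∧ ∀ i < l.n, g ω ∈ l.D i →
    dist (y (l.c i) ω) (G ω).2 ≤ 2 * (1 / 2) ^ k ∧
      ∃ j < l.m i, dist (y (l.c i) ω) (iY (l.v i j)) < (1 / 2) ^ k}

/-- One error is that `g` is in no piece; the other is the oscillation error of
`JointApprox.measure_far_le`. -/
theorem measure_good_compl_le (hiX : Isometry iX) (hiY : Isometry iY)
    (hY : Yc.IndependentOf T) (hy : ∀ x, Realizes iY (y x) (Yc.toFun x)) {gs : ℕ → Ω → X'}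
    {Gs : ℕ → Ω → X' × Y'} (h : JointApprox T iX g y gs Gs) {G : Ω → X' × Y'}
    (hG : TendstoInMeasure P Gs atTop G) : P (l.good G)ᶜ ≤ 2⁻¹ ^ k + 2⁻¹ ^ k := by
  refine (measure_mono_ae ?_).trans ((measure_union_le _ _).trans (add_le_add l.cover
    (h.measure_far_le hiX hiY hY hy hG l.isOpen l.disjoint l.osc)))
  filter_upwards [h.fst_ae_eq hG] with ω h1 (h2 : ω ∉ l.good G)
  by_contra h3
  change ¬ (_ ∨ _) at h3
  simp only [Set.mem_ofPred_eq, not_or, not_forall, not_exists, not_and, not_not] at h3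
  obtain ⟨⟨i, hi, h3⟩, h4⟩ := h3
  refine h2 ⟨⟨i, hi, h3⟩, fun j hj hj' => ?_⟩
  obtain ⟨h5, h6⟩ := h4 j hj (h1 ▸ hj')
  by_contra h7
  exact h7 ⟨h5, by simpa only [exists_prop] using h6⟩

-- The constant is `2` for the first coordinate by `dist_le`, and `2 + 1` for the second by way of
-- `y (c i)`.
variable {l} in
theorem exists_dist_le_of_good {G : Ω → X' × Y'} {ω : Ω} (h1 : (G ω).1 = g ω)
    (h : ω ∈ l.good G) : ∃ i < l.n, ∃ j < l.m i, g ω ∈ l.D i ∧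
      dist (y (l.c i) ω) (iY (l.v i j)) < (1 / 2) ^ k ∧
      dist (iX (l.c i), iY (l.v i j)) (G ω) ≤ 3 * (1 / 2) ^ k := by
  obtain ⟨⟨i, hi, hD⟩, h2⟩ := h
  obtain ⟨h3, j, hj, h4⟩ := h2 i hi hD
  refine ⟨i, hi, j, hj, hD, h4, max_le ?_ ?_⟩
  · change dist (iX (l.c i)) (G ω).1 ≤ _
    rw [h1]
    refine (l.dist_le i hi _ hD).trans ?_
    gcongr
    norm_num
  · change dist (iY (l.v i j)) (G ω).2 ≤ _
    have := dist_triangle_left (iY (l.v i j)) (G ω).2 (y (l.c i) ω)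
    linarith

-- Here any pair that brought `ω` into the exact event is close to `G ω`, with the same constants;
-- the preceding lemma instead finds a pair in the level.
variable {l} in
theorem exists_dist_le_of_mem_exact {t : X → Y → Prop} {G : Ω → X' × Y'} {ω : Ω}
    (h1 : (G ω).1 = g ω) (h : ω ∈ l.good G) (ht : ω ∈ l.exact t) :
    ∃ c v, t c v ∧ dist (iX c, iY v) (G ω) ≤ 3 * (1 / 2) ^ k := by
  obtain ⟨i, hi, j, hj, h2, hD, h4⟩ := ht
  refine ⟨l.c i, l.v i j, h2, max_le ?_ ?_⟩
  · change dist (iX (l.c i)) (G ω).1 ≤ _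
    rw [h1]
    refine (l.dist_le i hi _ hD).trans ?_
    gcongr
    norm_num
  · change dist (iY (l.v i j)) (G ω).2 ≤ _
    have h3 := (h.2 i hi hD).1
    have := dist_triangle_left (iY (l.v i j)) (G ω).2 (y (l.c i) ω)
    linarith

/-- The preimage of a tested set is represented by the windows of the selected open sets. -/
theorem exists_fastSeq (hiX : Isometry iX) (hiY : Isometry iY)
    (hY : Yc.IndependentOf T) (hy : ∀ x, Realizes iY (y x) (Yc.toFun x)) {gs : ℕ → Ω → X'}
    {Gs : ℕ → Ω → X' × Y'} (h : JointApprox T iX g y gs Gs) {G : Ω → X' × Y'}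
    (hG : TendstoInMeasure P Gs atTop G) (l : ∀ k, Level P iX iY g y k) {W : Set (X' × Y')}
    {t : ℕ → X → Y → Prop} (ht : IsTest iX iY W t) :
    ∃ S : FastSeq P, S.seq = window (fun k => (l k).select (t k)) ∧ (LowerMeas.mk S).Is (G ⁻¹' W) := by
  have hgood : ∀ k, P ((l k).good G)ᶜ ≤ 2⁻¹ ^ k + 2⁻¹ ^ k := fun k =>
    (l k).measure_good_compl_le hiX hiY hY hy h hG
  have hfst := h.fst_ae_eq hG
  have hsel : ∀ᵐ ω ∂P, ∀ k, ω ∈ (l k).exact (t k) → ω ∈ (l k).select (t k) :=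
    ae_all_iff.2 fun k => (l k).ae_mem_select (t k)
  obtain ⟨S, hS, hS'⟩ := exists_fastSeq_window (P := P) (U := fun k => (l k).select (t k)) (by
    intro k
    -- One part for the excess of the selected set, two for a bad level `k`, and one for a bad level
    -- `k + 1`.
    have h1 : (4 : ℝ≥0∞) * 2⁻¹ ^ k = 2⁻¹ ^ k + (2⁻¹ ^ k + 2⁻¹ ^ k) +
        (2⁻¹ ^ (k + 1) + 2⁻¹ ^ (k + 1)) := by
      rw [FastSeq.two_mul_pow]
      ring
    rw [h1]
    refine (measure_mono_ae ?_).trans ((measure_union_le _ _).trans (add_le_add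
      ((measure_union_le _ _).trans (add_le_add ((l k).measure_select_sdiff_le (t k)) (hgood k)))
      (hgood (k + 1))))
    filter_upwards [hfst, hsel] with ω h2 h3 h4
    obtain ⟨h4, h5⟩ : ω ∈ (l k).select (t k) ∧ ω ∉ (l (k + 1)).select (t (k + 1)) := h4
    by_contra h6
    change ¬ ((_ ∨ _) ∨ _) at h6
    simp only [not_or, Set.mem_sdiff, Set.mem_compl_iff, not_and, not_not, SetLike.mem_coe] at h6
    obtain ⟨⟨h6, h7⟩, h8⟩ := h6
    obtain ⟨c, v, h9, h10⟩ := exists_dist_le_of_mem_exact h2 h7 (h6 h4)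
    obtain ⟨i, hi, j, hj, h11, h12, h13⟩ := exists_dist_le_of_good h2 h8
    refine h5 (h3 _ ⟨i, hi, j, hj, ht.succ k c v _ _ h9 ?_ ?_, h11, h12⟩)
    -- Both centres are close to `G ω`: `3 + 3 / 2` times `2⁻ᵏ` is within the `5` times `2⁻ᵏ`
    -- allowed by `IsTest.succ`.
    · rw [← hiX.dist_eq]
      have h14 : dist (iX c) (G ω).1 ≤ _ := (le_max_left _ _).trans h10
      have h15 : dist (iX ((l (k + 1)).c i)) (G ω).1 ≤ _ := (le_max_left _ _).trans h13
      have := dist_triangle_right (iX c) (iX ((l (k + 1)).c i)) (G ω).1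
      have h16 : (0 : ℝ) < (1 / 2) ^ k := by positivity
      rw [pow_succ] at h15
      linarith
    · rw [← hiY.dist_eq]
      have h14 : dist (iY v) (G ω).2 ≤ _ := (le_max_right _ _).trans h10
      have h15 : dist (iY ((l (k + 1)).v i j)) (G ω).2 ≤ _ := (le_max_right _ _).trans h13
      have := dist_triangle_right (iY v) (iY ((l (k + 1)).v i j)) (G ω).2
      have h16 : (0 : ℝ) < (1 / 2) ^ k := by positivity
      rw [pow_succ] at h15
      linarith)
  refine ⟨S, hS, is_mk.2 (hS'.trans ?_)⟩
  have hsum : ∑' k : ℕ, (2⁻¹ : ℝ≥0∞) ^ k ≠ ⊤ := by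
    rw [ENNReal.tsum_geometric]
    simp [ENNReal.one_sub_inv_two]
  -- Borel–Cantelli: almost every `ω` is eventually free of all level errors, so selection and
  -- membership in `W` agree in the limit.
  have hev1 : ∀ᵐ ω ∂P, ∀ᶠ k in atTop, ω ∉ (((l k).select (t k) : Set Ω) \ (l k).exact (t k)) :=
    ae_eventually_notMem (ne_top_of_le_ne_top hsum
      (ENNReal.tsum_le_tsum fun k => (l k).measure_select_sdiff_le (t k)))
  have hev2 : ∀ᵐ ω ∂P, ∀ᶠ k in atTop, ω ∉ ((l k).good G)ᶜ :=
    ae_eventually_notMem (ne_top_of_le_ne_top (by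
      rw [ENNReal.tsum_add]
      exact ENNReal.add_ne_top.2 ⟨hsum, hsum⟩) (ENNReal.tsum_le_tsum hgood))
  filter_upwards [hfst, hsel, hev1, hev2] with ω h2 h3 h4 h5
  refine propext (Iff.trans (b := G ω ∈ W) ⟨fun h6 => ?_, fun h6 => ?_⟩ Iff.rfl)
  · have h6 : ∀ᶠ k in atTop, ω ∈ (l k).select (t k) := h6
    obtain ⟨k, h7, h8, h9⟩ := (h4.and (h5.and h6)).exists
    have h8 : ω ∈ (l k).good G := not_not.1 h8
    have h7 : ω ∈ (l k).exact (t k) := not_not.1 fun h => h7 ⟨h9, h⟩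
    obtain ⟨c, v, h10, h11⟩ := exists_dist_le_of_mem_exact h2 h8 h7
    exact ht.mem k c v _ h10 h11
  · change ∀ᶠ k in atTop, ω ∈ (l k).select (t k)
    filter_upwards [h5, ht.eventually _ h6] with k h7 h8
    obtain ⟨i, hi, j, hj, h11, h12, h13⟩ := exists_dist_le_of_good h2 (not_not.1 h7)
    exact h3 k ⟨i, hi, j, hj, h8 _ _ h13, h11, h12⟩

end Level

end Levels

end CondRV

namespace CondRV

/-! ## Names of points and of open sets of computable metric spaces -/

namespace Describes

variable {A : Type*} {δ : Rep A} {S S' : List ℕ → Prop} {p p' : A → Prop}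

theorem congr (h : Describes δ S p) (h' : ∀ a, p' a ↔ p a) : Describes δ S p' :=
  fun ν a ha => (h' a).trans (h ν a ha)

theorem exists' {ι : Sort*} {S : ι → List ℕ → Prop} {p : ι → A → Prop}
    (h : ∀ i, Describes δ (S i) (p i)) : Describes δ (fun l => ∃ i, S i l) fun a => ∃ i, p i a :=
  fun ν a ha => (exists_congr fun i => h i ν a ha).trans exists_comm

theorem const_and {q : Prop} (h : q → Describes δ S p) :
    Describes δ (fun l => q ∧ S l) fun a => q ∧ p a :=
  fun ν a ha => (and_congr_right fun hq => h hq ν a ha).trans exists_and_left.symm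

theorem exists_take_iff {ν : ℕ → ℕ} : (∃ n m, S ((pref ν n).take m)) ↔ ∃ n, S (pref ν n) := by
  constructor
  · rintro ⟨n, m, h⟩
    rcases le_total m n with hm | hm
    · rw [take_pref hm] at h
      exact ⟨m, h⟩
    · rw [List.take_of_length_le (by rwa [length_pref])] at h
      exact ⟨n, h⟩
  · rintro ⟨n, h⟩
    exact ⟨n, n, by rwa [take_pref le_rfl]⟩

theorem exists_take_mono {ν : ℕ → ℕ} {n n' : ℕ} (hn : n ≤ n')
    (h : ∃ m, S ((pref ν n).take m)) : ∃ m, S ((pref ν n').take m) := by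
  obtain ⟨m, h⟩ := h
  rcases le_total m n with hm | hm
  · rw [take_pref hm] at h
    exact ⟨m, by rwa [take_pref (hm.trans hn)]⟩
  · rw [List.take_of_length_le (by rwa [length_pref])] at h
    exact ⟨n, by rwa [take_pref hn]⟩

/-- Descriptions need not be closed under longer prefixes. Asking for some truncation in `S i`
closes them, so that one common prefix serves finitely many conditions. -/
theorem forall_lt {n : ℕ} {S : ℕ → List ℕ → Prop} {p : ℕ → A → Prop}
    (h : ∀ i < n, Describes δ (S i) (p i)) :
    Describes δ (fun l => ∀ i < n, ∃ m, S i (l.take m)) fun a => ∀ i < n, p i a := by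
  intro ν a ha
  constructor
  · intro h1
    choose N hN using fun i : Fin n => exists_take_iff.2 ((h i i.2 ν a ha).1 (h1 i i.2))
    exact ⟨Finset.univ.sup N, fun i hi =>
      exists_take_mono (Finset.le_sup (f := N) (Finset.mem_univ ⟨i, hi⟩)) (hN ⟨i, hi⟩)⟩
  · rintro ⟨N, hN⟩ i hi
    exact (h i hi ν a ha).2 (exists_take_iff.1 ⟨N, hN i hi⟩)

theorem and (h : Describes δ S p) (h' : Describes δ S' p') :
    Describes δ (fun l => (∃ m, S (l.take m)) ∧ ∃ m, S' (l.take m)) fun a => p a ∧ p' a := by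
  intro ν a ha
  refine (and_congr (h ν a ha) (h' ν a ha)).trans ?_
  rw [← exists_take_iff, ← exists_take_iff (S := S')]
  constructor
  · rintro ⟨⟨n, hn⟩, n', hn'⟩
    exact ⟨max n n', exists_take_mono (le_max_left _ _) hn,
      exists_take_mono (le_max_right _ _) hn'⟩
  · rintro ⟨n, h1, h2⟩
    exact ⟨⟨n, h1⟩, n, h2⟩

end Describes

theorem exists_one_div_two_pow_lt {ε : ℝ} (hε : 0 < ε) : ∃ m : ℕ, 1 / 2 ^ m < ε := by
  obtain ⟨m, hm⟩ := exists_pow_lt_of_lt_one hε (show (1 / 2 : ℝ) < 1 by norm_num)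
  exact ⟨m, by rwa [one_div_pow] at hm⟩

namespace ComputableMetric

variable {X : Type*} [MetricSpace X] (c : ComputableMetric X)

/-- The set of points which have a name that begins with `l`. -/
def cyl (l : List ℕ) : Set X := {x | ∀ j < l.length, dist (c.pt (l.getD j 0)) x < 1 / 2 ^ j}

theorem isOpen_cyl (l : List ℕ) : IsOpen (c.cyl l) := by
  have h : c.cyl l = ⋂ j ∈ Set.Iio l.length, {x | dist (c.pt (l.getD j 0)) x < 1 / 2 ^ j} := by
    ext x
    simp [cyl]
  rw [h]
  exact (Set.finite_Iio _).isOpen_biInter fun j _ =>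
    isOpen_lt (continuous_const.dist continuous_id) continuous_const

variable {c}

theorem mem_cyl_pref {ν : ℕ → ℕ} {x : X} (h : c.rep ν x) (n : ℕ) : x ∈ c.cyl (pref ν n) := by
  intro j hj
  rw [length_pref] at hj
  rw [getD_pref hj]
  exact h j

/-- Density continues `l` to an infinite name. Acceptance by a finite sequence can thus be
transferred to genuine names. -/
theorem exists_name {x : X} {l : List ℕ} (h : x ∈ c.cyl l) :
    ∃ ν, c.rep ν x ∧ pref ν l.length = l := by
  have h1 : ∀ n : ℕ, ∃ i, dist (c.pt i) x < 1 / 2 ^ n := fun n => by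
    obtain ⟨i, hi⟩ := c.dense.exists_dist_lt x (show (0 : ℝ) < 1 / 2 ^ n by positivity)
    exact ⟨i, by rwa [dist_comm]⟩
  choose e he using h1
  refine ⟨fun n => if n < l.length then l.getD n 0 else e n, fun n => ?_, ?_⟩
  · dsimp only
    split_ifs with hn
    · exact h n hn
    · exact he n
  · refine (eq_pref_of_forall fun i hi => ?_).symm
    rw [if_pos hi]

theorem exists_name' (x : X) : ∃ ν, c.rep ν x :=
  (exists_name (c := c) (x := x) (l := []) (fun j hj => by simp at hj)).imp fun _ h => h.1

theorem rep_const (i : ℕ) : c.rep (fun _ => i) (c.pt i) := fun n => by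
  rw [dist_self]
  positivity

variable (c)

section Tests

variable {α : Type*} [Primcodable α]

/-- A strict inequality is witnessed by a dyadic approximation of the distance whose error is below
half the gap; the test then becomes one between integers. -/
theorem re_dist_add_lt {i j n b n' b' : α → ℕ} (hi : Primrec i) (hj : Primrec j)
    (hn : Primrec n) (hb : Primrec b) (hn' : Primrec n') (hb' : Primrec b') :
    RE fun _ a => dist (c.pt (i a)) (c.pt (j a)) + (n a : ℝ) / 2 ^ b a < (n' a : ℝ) / 2 ^ b' a := by
  obtain ⟨f, hf, hd⟩ := c.dist_computable
  have h1 : RE fun _ a => ∃ x : ℕ × ℕ, f (i a, j a, x.1) = x.2 ∧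
      ((x.2 + 1) * 2 ^ b a + 2 ^ x.1 * n a) * 2 ^ b' a < n' a * (2 ^ x.1 * 2 ^ b a) := by
    refine RE.exists' (RE.and ?_ (RE.of_pred (primrecPred_lt ?_ ?_)))
    · exact (RE.of_computable hf).comp (f := fun y : α × ℕ × ℕ => ((i y.1, j y.1, y.2.1), y.2.2))
        (by fun_prop)
    · fun_prop
    · fun_prop
  refine h1.of_iff fun _ a => ?_
  have h2 : ∀ m z : ℕ, ((z + 1) * 2 ^ b a + 2 ^ m * n a) * 2 ^ b' a < n' a * (2 ^ m * 2 ^ b a) ↔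
      ((z : ℝ) + 1) / 2 ^ m + (n a : ℝ) / 2 ^ b a < (n' a : ℝ) / 2 ^ b' a := by
    intro m z
    rw [div_add_div _ _ (by positivity) (by positivity), div_lt_div_iff₀ (by positivity)
      (by positivity)]
    norm_cast
  simp only [h2, Prod.exists, exists_eq_left']
  constructor
  · intro h
    obtain ⟨m, hm⟩ := exists_one_div_two_pow_lt (half_pos (sub_pos.2 h))
    refine ⟨m, ?_⟩
    have := (abs_le.1 (hd (i a) (j a) m)).1
    rw [add_div]
    linarith
  · rintro ⟨m, hm⟩
    have := (abs_le.1 (hd (i a) (j a) m)).2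
    rw [add_div] at hm
    linarith

theorem re_add_lt_dist {i j n b n' b' : α → ℕ} (hi : Primrec i) (hj : Primrec j)
    (hn : Primrec n) (hb : Primrec b) (hn' : Primrec n') (hb' : Primrec b') :
    RE fun _ a => (n a : ℝ) / 2 ^ b a + (n' a : ℝ) / 2 ^ b' a < dist (c.pt (i a)) (c.pt (j a)) := by
  obtain ⟨f, hf, hd⟩ := c.dist_computable
  have h1 : RE fun _ a => ∃ x : ℕ × ℕ, f (i a, j a, x.1) = x.2 ∧
      ((n a * 2 ^ b' a + 2 ^ b a * n' a) * 2 ^ x.1 + 2 ^ b a * 2 ^ b' a * 1) * 2 ^ x.1 <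
        x.2 * (2 ^ b a * 2 ^ b' a * 2 ^ x.1) := by
    refine RE.exists' (RE.and ?_ (RE.of_pred (primrecPred_lt ?_ ?_)))
    · exact (RE.of_computable hf).comp (f := fun y : α × ℕ × ℕ => ((i y.1, j y.1, y.2.1), y.2.2))
        (by fun_prop)
    · fun_prop
    · fun_prop
  refine h1.of_iff fun _ a => ?_
  have h2 : ∀ m z : ℕ, ((n a * 2 ^ b' a + 2 ^ b a * n' a) * 2 ^ m + 2 ^ b a * 2 ^ b' a * 1) * 2 ^ m <
        z * (2 ^ b a * 2 ^ b' a * 2 ^ m) ↔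
      (n a : ℝ) / 2 ^ b a + (n' a : ℝ) / 2 ^ b' a + 1 / 2 ^ m < (z : ℝ) / 2 ^ m := by
    intro m z
    rw [div_add_div _ _ (by positivity) (by positivity), div_add_div _ _ (by positivity)
      (by positivity), div_lt_div_iff₀ (by positivity) (by positivity)]
    norm_cast
  simp only [h2, Prod.exists, exists_eq_left']
  constructor
  · intro h
    obtain ⟨m, hm⟩ := exists_one_div_two_pow_lt (half_pos (sub_pos.2 h))
    refine ⟨m, ?_⟩
    have := (abs_le.1 (hd (i a) (j a) m)).2
    linarith
  · rintro ⟨m, hm⟩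
    have := (abs_le.1 (hd (i a) (j a) m)).1
    linarith

/-- The beginning `l` of a name shows that the distance from `pt i` is less than `r`. -/
def DistLt (l : List ℕ) (i : ℕ) (r : ℝ) : Prop :=
  ∃ m < l.length, dist (c.pt (l.getD m 0)) (c.pt i) + 1 / 2 ^ m < r

/-- The beginning `l` of a name shows that the distance from `pt i` is greater than `r`. -/
def DistGt (l : List ℕ) (i : ℕ) (r : ℝ) : Prop :=
  ∃ m < l.length, r + 1 / 2 ^ m < dist (c.pt (l.getD m 0)) (c.pt i)

theorem describes_distLt (i : ℕ) (r : ℝ) :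
    Describes c.rep (fun l => c.DistLt l i r) fun x => dist x (c.pt i) < r := by
  intro ν x hν
  constructor
  · intro h
    obtain ⟨m, hm⟩ := exists_one_div_two_pow_lt (half_pos (sub_pos.2 h))
    refine ⟨m + 1, m, by rw [length_pref]; exact Nat.lt_succ_self m, ?_⟩
    rw [getD_pref (Nat.lt_succ_self m)]
    have h1 := hν m
    have h2 := dist_triangle (c.pt (ν m)) x (c.pt i)
    linarith
  · rintro ⟨n, m, hmn, hm⟩
    rw [length_pref] at hmn
    rw [getD_pref hmn] at hm
    have h1 := hν m
    have h2 := dist_triangle_left x (c.pt i) (c.pt (ν m))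
    linarith

theorem describes_distGt (i : ℕ) (r : ℝ) :
    Describes c.rep (fun l => c.DistGt l i r) fun x => r < dist x (c.pt i) := by
  intro ν x hν
  constructor
  · intro h
    obtain ⟨m, hm⟩ := exists_one_div_two_pow_lt (half_pos (sub_pos.2 h))
    refine ⟨m + 1, m, by rw [length_pref]; exact Nat.lt_succ_self m, ?_⟩
    rw [getD_pref (Nat.lt_succ_self m)]
    have h1 := hν m
    have h2 := dist_triangle_left x (c.pt i) (c.pt (ν m))
    linarith
  · rintro ⟨n, m, hmn, hm⟩
    rw [length_pref] at hmn
    rw [getD_pref hmn] at hm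
    have h1 := hν m
    have h2 := dist_triangle (c.pt (ν m)) x (c.pt i)
    linarith

theorem re_distLt {l : α → List ℕ} {i n b : α → ℕ} (hl : Primrec l) (hi : Primrec i)
    (hn : Primrec n) (hb : Primrec b) :
    RE fun _ a => c.DistLt (l a) (i a) ((n a : ℝ) / 2 ^ b a) := by
  refine RE.exists' (RE.and (RE.of_pred (primrecPred_lt ?_ ?_)) ?_)
  · fun_prop
  · fun_prop
  · refine (c.re_dist_add_lt (i := fun x : α × ℕ => (l x.1).getD x.2 0) (j := fun x => i x.1)
      (n := fun _ => 1) (b := fun x => x.2) (n' := fun x => n x.1) (b' := fun x => b x.1)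
      (by fun_prop) (by fun_prop) (by fun_prop) (by fun_prop) (by fun_prop)
      (by fun_prop)).of_iff fun _ x => ?_
    rw [Nat.cast_one]

theorem re_distGt {l : α → List ℕ} {i n b : α → ℕ} (hl : Primrec l) (hi : Primrec i)
    (hn : Primrec n) (hb : Primrec b) :
    RE fun _ a => c.DistGt (l a) (i a) ((n a : ℝ) / 2 ^ b a) := by
  refine RE.exists' (RE.and (RE.of_pred (primrecPred_lt ?_ ?_)) ?_)
  · fun_prop
  · fun_prop
  · refine (c.re_add_lt_dist (i := fun x : α × ℕ => (l x.1).getD x.2 0) (j := fun x => i x.1)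
      (n := fun x => n x.1) (b := fun x => b x.1) (n' := fun _ => 1) (b' := fun x => x.2)
      (by fun_prop) (by fun_prop) (by fun_prop) (by fun_prop) (by fun_prop)
      (by fun_prop)).of_iff fun _ x => ?_
    rw [Nat.cast_one]

/-- The beginning `l` of a name shows that the point is in `cyl l'`. -/
def Cert (l l' : List ℕ) : Prop :=
  ∀ j < l'.length, ∃ m, c.DistLt (l.take m) (l'.getD j 0) (1 / 2 ^ j)

theorem describes_cert (l' : List ℕ) : Describes c.rep (fun l => c.Cert l l') (· ∈ c.cyl l') :=
  (Describes.forall_lt fun j _ => c.describes_distLt (l'.getD j 0) (1 / 2 ^ j)).congr fun x => by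
    simp only [cyl, Set.mem_ofPred_eq, dist_comm]

theorem re_cert {l l' : α → List ℕ} (hl : Primrec l) (hl' : Primrec l') :
    RE fun _ a => c.Cert (l a) (l' a) := by
  refine RE.forall_lt (RE.exists' ?_) (by fun_prop)
  refine (c.re_distLt (l := fun x : (α × ℕ) × ℕ => (l x.1.1).take x.2)
    (i := fun x => (l' x.1.1).getD x.1.2 0) (n := fun _ => 1) (b := fun x => x.1.2)
    (by fun_prop) (by fun_prop) (by fun_prop) (by fun_prop)).of_iff fun _ x => ?_
  rw [Nat.cast_one]

/-- The open set of all points which have a name with a beginning in `S`. -/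
def gen (S : List ℕ → Prop) : Opens X :=
  ⟨{x | ∃ l, S l ∧ x ∈ c.cyl l}, by
    have h : {x | ∃ l, S l ∧ x ∈ c.cyl l} = ⋃ l, ⋃ (_ : S l), c.cyl l := by
      ext x
      simp only [Set.mem_ofPred_eq, Set.mem_iUnion, exists_prop]
    rw [h]
    exact isOpen_iUnion fun l => isOpen_iUnion fun _ => c.isOpen_cyl l⟩

theorem describes_gen (S : List ℕ → Prop) :
    Describes c.rep (fun l => ∃ l', S l' ∧ c.Cert l l') (· ∈ c.gen S) :=
  Describes.exists' fun l' => Describes.const_and fun _ => c.describes_cert l'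

end Tests

variable {c} {Y : Type*} [MetricSpace Y] {cY : ComputableMetric Y}

/-- A finite sequence of paired indices begins some name of `(x, v)` exactly if it satisfies the
distance bounds, so a described set is a union of boxes. -/
theorem _root_.CondRV.Describes.prod_iff {S : List ℕ → Prop} {p : X × Y → Prop}
    (h : Describes (Rep.prod c.rep cY.rep) S p) (x : X) (v : Y) : p (x, v) ↔
      ∃ l, S l ∧ ∀ m < l.length, dist (c.pt (l.getD m 0).unpair.1) x < 1 / 2 ^ m ∧
        dist (cY.pt (l.getD m 0).unpair.2) v < 1 / 2 ^ m := by
  constructor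
  · intro hx
    obtain ⟨ν, hν⟩ := exists_name' (c := c) x
    obtain ⟨μ, hμ⟩ := exists_name' (c := cY) v
    obtain ⟨n, hn⟩ := (h (pairSeq ν μ) (x, v) ⟨ν, μ, rfl, hν, hμ⟩).1 hx
    refine ⟨_, hn, fun m hm => ?_⟩
    rw [length_pref] at hm
    rw [getD_pref hm, pairSeq, Nat.unpair_pair]
    exact ⟨hν m, hμ m⟩
  · rintro ⟨l, hl, hx⟩
    obtain ⟨ν, hν, h1⟩ := exists_name (c := c) (x := x) (l := l.map fun s => s.unpair.1) (by
      intro j hj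
      have h2 := (hx j (by simpa using hj)).1
      simpa [List.getD_eq_getElem?_getD, List.getElem?_eq_getElem (show j < l.length by simpa using hj)] using h2)
    obtain ⟨μ, hμ, h2⟩ := exists_name (c := cY) (x := v) (l := l.map fun s => s.unpair.2) (by
      intro j hj
      have h2 := (hx j (by simpa using hj)).2
      simpa [List.getD_eq_getElem?_getD, List.getElem?_eq_getElem (show j < l.length by simpa using hj)] using h2)
    refine (h (pairSeq ν μ) (x, v) ⟨ν, μ, rfl, hν, hμ⟩).2 ⟨l.length, ?_⟩
    convert hl
    refine (eq_pref_of_forall fun i hi => ?_).symm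
    have h3 := congrArg (fun l => l.getD i 0) h1
    have h4 := congrArg (fun l => l.getD i 0) h2
    simp only [List.length_map] at h3 h4
    rw [getD_pref hi] at h3 h4
    rw [pairSeq, h3, h4]
    simp [List.getD_eq_getElem?_getD, List.getElem?_eq_getElem hi]

end ComputableMetric

end CondRV

namespace CondRV

/-! ## Names of measures and of random variables -/

section Names

variable {Ω : Type*} [TopologicalSpace Ω] [MeasurableSpace Ω] {P : Measure Ω} {δ : Rep Ω}

theorem one_lt_nnrat_add_iff (v k : ℕ) :
    1 < Rep.nnrat v + (2⁻¹ : ℝ≥0∞) ^ k ↔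
      (v.unpair.2 + 1) * 2 ^ k < v.unpair.1 * 2 ^ k + (v.unpair.2 + 1) := by
  have h1 : Rep.nnrat v + (2⁻¹ : ℝ≥0∞) ^ k =
      ENNReal.ofReal ((v.unpair.1 : ℝ) / (v.unpair.2 + 1) + 1 / 2 ^ k) := by
    rw [ENNReal.ofReal_add (by positivity) (by positivity), ENNReal.ofReal_div_of_pos
      (by positivity), ENNReal.ofReal_div_of_pos (by positivity), ENNReal.ofReal_add (by positivity)
      one_pos.le, ENNReal.ofReal_pow (by norm_num)]
    simp [Rep.nnrat, ENNReal.inv_pow]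
  rw [h1, ENNReal.one_lt_ofReal, div_add_div _ _ (by positivity) (by positivity),
    one_lt_div (by positivity)]
  norm_cast
  rw [mul_one]

/-- For a computable measure, it is semidecidable whether an open set is large. -/
theorem ComputableMeasure.exists_big (h : ComputableMeasure P δ) {α : Type*} [Primcodable α]
    {S : (ℕ → ℕ) → α → List ℕ → Prop} (hS : RE fun ρ (x : α × List ℕ) => S ρ x.1 x.2) :
    ∃ B : (ℕ → ℕ) → α → ℕ → Prop, RE (fun ρ (x : α × ℕ) => B ρ x.1 x.2) ∧
      ∀ ρ a k (U : Opens Ω), Describes δ (S ρ a) (· ∈ U) →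
        (B ρ a k ↔ 1 < P U + 2⁻¹ ^ k) := by
  obtain ⟨m, hm, hm'⟩ := h
  obtain ⟨u, hu, hu'⟩ := hS.exists_nameGraph
  -- The measure is a supremum of computed rationals, so a strict lower bound holds once one of them
  -- exceeds it. Adding `2⁻¹ ^ k` avoids truncated subtraction.
  refine ⟨fun ρ a k => ∃ x : ℕ × ℕ, App (graph m) (graph (u ρ a)) x.1 x.2 ∧
    (x.2.unpair.2 + 1) * 2 ^ k < x.2.unpair.1 * 2 ^ k + (x.2.unpair.2 + 1), ?_, ?_⟩
  · refine RE.exists' (RE.and ?_ (RE.of_pred (primrecPred_lt ?_ ?_)))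
    · exact ((REF.of_computable hm).app hu).rel (f := fun y : (α × ℕ) × ℕ × ℕ => y.1.1)
        (k := fun y => y.2.1) (v := fun y => y.2.2) (by fun_prop) (by fun_prop) (by fun_prop)
    · fun_prop
    · fun_prop
  · intro ρ a k U hU
    obtain ⟨q, hq, hq', hq''⟩ := hm' _ U (hu' ρ a Ω δ U hU)
    beta_reduce
    rw [app_graph hq]
    simp only [← one_lt_nnrat_add_iff, Prod.exists, graph, exists_eq_left']
    change (∃ n, 1 < Rep.nnrat (q n) + (2⁻¹ : ℝ≥0∞) ^ k) ↔ _
    replace hq'' : ⨆ n, Rep.nnrat (q n) = P U := hq''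
    rw [← hq'', ENNReal.iSup_add, lt_iSup_iff]

variable [OpensMeasurableSpace Ω] [IsFiniteMeasure P] {X Y : Type*} [TopologicalSpace X]
  [TopologicalSpace Y] {δX : Rep X} {δY : Rep Y}

theorem Rep.randomVariable.exists_fastSeq {p : ℕ → ℕ} {Z : RandomVariable P X}
    (h : Rep.randomVariable P δ δX p Z) {u : ℕ → ℕ} {U : Opens X} (hu : Rep.opens δX u U) :
    ∃ (S : FastSeq P) (o : ℕ → ℕ), LowerMeas.mk S = Z.pre U ∧ App (graph p) (graph u) = graph o ∧
      Rep.seq (Rep.opens δ) o S.seq := by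
  obtain ⟨o, ho, S, hS, hS'⟩ := h u U hu
  exact ⟨S, o, hS, app_graph ho, hS'⟩

theorem Rep.conditionalRV.exists_fastSeq {q : ℕ → ℕ} {Yc : ConditionalRV P X Y}
    (h : Rep.conditionalRV P δ δX δY q Yc) {ν : ℕ → ℕ} {x : X} (hν : δX ν x) {u : ℕ → ℕ}
    {U : Opens Y} (hu : Rep.opens δY u U) :
    ∃ (S : FastSeq P) (o : ℕ → ℕ), LowerMeas.mk S = (Yc.toFun x).pre U ∧
      App (App (graph q) (graph ν)) (graph u) = graph o ∧ Rep.seq (Rep.opens δ) o S.seq := by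
  obtain ⟨r, hr, hr'⟩ := h ν x hν
  rw [app_graph hr]
  exact Rep.randomVariable.exists_fastSeq (Z := Yc.toFun x) hr' hu

theorem sliceRel_graph (o : ℕ → ℕ) (l : ℕ) : sliceRel (graph o) l = graph (slice o l) := rfl

end Names

end CondRV

namespace CondRV

/-! ### Cores: what a program for the conditional random variable accepts from a partial argument -/

section Approximants

variable {Ω : Type*} [TopologicalSpace Ω] [MeasurableSpace Ω] [OpensMeasurableSpace Ω]
  {P : Measure Ω} [IsFiniteMeasure P]

theorem FastSeq.ae_mem_seq {S : FastSeq P} {s : Set Ω} (h : (LowerMeas.mk S).Is s) (l : ℕ) :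
    ∀ᵐ ω ∂P, ω ∈ s → ω ∈ S.seq l := by
  filter_upwards [LowerMeas.is_mk.1 h] with ω h1 h2
  exact S.inter_subset l ((iff_of_eq h1).2 h2)

theorem FastSeq.measure_mem_seq_notMem_le {S : FastSeq P} {s : Set Ω}
    (h : (LowerMeas.mk S).Is s) (l : ℕ) : P {ω | ω ∈ S.seq l ∧ ω ∉ s} ≤ 2⁻¹ ^ l := by
  refine (measure_mono_ae ?_).trans (S.measure_diff_le l)
  filter_upwards [LowerMeas.is_mk.1 h] with ω h1 h2
  exact ⟨h2.1, fun h3 => h2.2 ((iff_of_eq h1).1 h3)⟩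

theorem exists_one_lt_measure_add {s : ℕ → Set Ω} (hs : Monotone s) {ε : ℝ≥0∞}
    (h : 1 < P (⋃ n, s n) + ε) : ∃ n, 1 < P (s n) + ε := by
  rwa [hs.measure_iUnion, ENNReal.iSup_add, lt_iSup_iff] at h

end Approximants

theorem one_lt_measure_add_iff {Ω : Type*} [MeasurableSpace Ω] {P : Measure Ω}
    [IsProbabilityMeasure P] {s : Set Ω} (hs : MeasurableSet s) {ε : ℝ≥0∞} :
    1 < P s + ε ↔ P sᶜ < ε := by
  rw [← prob_add_prob_compl (μ := P) hs]
  exact ENNReal.add_lt_add_iff_left (measure_ne_top _ _)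

section Core

open LowerMeas RandomVariable

variable {Ω : Type*} [MetricSpace Ω] [MeasurableSpace Ω] [OpensMeasurableSpace Ω]
  {P : Measure Ω} [IsProbabilityMeasure P]
  {X Y Y' : Type*} [MetricSpace X] [MetricSpace Y] [MetricSpace Y']
  [MeasurableSpace Y'] [BorelSpace Y'] {iY : Y → Y'}
  {Yc : ConditionalRV P X Y} {y : X → Ω → Y'}
  {cΩ : ComputableMetric Ω} {cX : ComputableMetric X} {cY : ComputableMetric Y}
  {q : ℕ → ℕ} {k : ℕ}

/-- The open ball around a point of the dense sequence. -/
def ComputableMetric.ballOpens (c : ComputableMetric X) (v k : ℕ) : Opens X :=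
  ⟨{x | dist x (c.pt v) < 1 / 2 ^ k}, isOpen_lt (continuous_id.dist continuous_const)
    continuous_const⟩

/-- The finite sequences which the program `q` for a conditional random variable accepts as
beginnings of names of elements of the `l`-th approximation of the preimage of the open set with
name `u`, if only the beginning `τ` of a name of the argument is known. -/
def PartialAcc (F G : ℕ → ℕ → Prop) (u : ℕ → ℕ) (l : ℕ) (t : List ℕ) : Prop :=
  Acc (sliceRel (App (App F G) (graph u)) l) (finGraph t)

/-- The points which are known to be in one of the approximations of the preimages of some balls,
for all arguments which have a name that begins with `τ`. -/
def core (cΩ : ComputableMetric Ω) (q : ℕ → ℕ) (u : ℕ → ℕ → ℕ) (k : ℕ) (τ vs : List ℕ) : Opens Ω :=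
  ⟨{ω | ∃ j, j < vs.length ∧
    ω ∈ cΩ.gen (PartialAcc (graph q) (finGraph τ) (u (vs.getD j 0)) (k + j + 3))}, by
    have h : {ω | ∃ j, j < vs.length ∧
        ω ∈ cΩ.gen (PartialAcc (graph q) (finGraph τ) (u (vs.getD j 0)) (k + j + 3))} =
        ⋃ j, ⋃ (_ : j < vs.length),
          (cΩ.gen (PartialAcc (graph q) (finGraph τ) (u (vs.getD j 0)) (k + j + 3)) : Set Ω) := by
      ext ω
      simp only [Set.mem_ofPred_eq, Set.mem_iUnion, exists_prop, SetLike.mem_coe]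
    rw [h]
    exact isOpen_iUnion fun j => isOpen_iUnion fun _ => Opens.isOpen _⟩

theorem is_ball (hiY : Isometry iY) (hy : ∀ x, Realizes iY (y x) (Yc.toFun x)) (x : X) (v : ℕ) :
    ((Yc.toFun x).pre (cY.ballOpens v k)).Is {ω | dist (y x ω) (iY (cY.pt v)) < (1 / 2) ^ k} :=
  (hy x).is_pre _ (Metric.ball (iY (cY.pt v)) ((1 / 2) ^ k)) Metric.isOpen_ball (by
    ext v'
    simp [ComputableMetric.ballOpens, hiY.dist_eq])

/-- A computation that succeeds with the beginnings `τ` and `t` also succeeds with all names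
extending them. So for every `x` in the cylinder of `τ`, the accepted points lie in the `l`-th
approximation of the preimage of the ball. -/
theorem measure_gen_le (hiY : Isometry iY) (hy : ∀ x, Realizes iY (y x) (Yc.toFun x))
    (hq : Rep.conditionalRV P cΩ.rep cX.rep cY.rep q Yc) {u : ℕ → ℕ} {v : ℕ}
    (hu : Rep.opens cY.rep u (cY.ballOpens v k)) {τ : List ℕ} {x : X} (hx : x ∈ cX.cyl τ) (l : ℕ) :
    P {ω | ω ∈ cΩ.gen (PartialAcc (graph q) (finGraph τ) u l) ∧
      ¬ dist (y x ω) (iY (cY.pt v)) < (1 / 2) ^ k} ≤ 2⁻¹ ^ l := by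
  obtain ⟨ν, hν, hντ⟩ := ComputableMetric.exists_name hx
  obtain ⟨S, o, hS, ho, hS'⟩ := hq.exists_fastSeq hν hu
  refine (measure_mono ?_).trans (S.measure_mem_seq_notMem_le
    (hS.symm ▸ is_ball (cY := cY) hiY hy x v) l)
  rintro ω ⟨⟨t, ht, hω⟩, h⟩
  refine ⟨?_, h⟩
  obtain ⟨μ, hμ, hμt⟩ := ComputableMetric.exists_name hω
  rw [mem_iff_acc (hS' l) hμ, ← sliceRel_graph, ← ho]
  rw [← hμt] at ht
  rw [← hντ] at ht
  have h1 := ((Tends.const (graph q)).app (Tends.pref ν)).app (Tends.const (graph u))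
  obtain ⟨z, hz⟩ := ht
  have h2 := (((h1.slice l).app (Tends.pref μ)).2 z.1 (z.2 + 1)).2
    ⟨max τ.length t.length, ((h1.slice l).app (Tends.const _)).1 _ _ (le_max_left _ _) _ _
      (((Tends.const _).app (Tends.pref μ)).1 _ _ (le_max_right _ _) _ _ hz)⟩
  exact ⟨z, h2⟩

/-- If the core is large then the conditional random variable is close to a common value at all
arguments which have a name that begins with `τ`. -/
theorem measure_osc_le (hiY : Isometry iY) (hy : ∀ x, Realizes iY (y x) (Yc.toFun x))
    (hq : Rep.conditionalRV P cΩ.rep cX.rep cY.rep q Yc) {u : ℕ → ℕ → ℕ}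
    (hu : ∀ v, Rep.opens cY.rep (u v) (cY.ballOpens v k)) {τ vs : List ℕ}
    (hbig : 1 < P (core cΩ q u k τ vs) + 2⁻¹ ^ (k + 1)) {x x' : X} (hx : x ∈ cX.cyl τ)
    (hx' : x' ∈ cX.cyl τ) :
    P {ω | ∀ j < vs.length, ¬ (dist (y x ω) (iY (cY.pt (vs.getD j 0))) < (1 / 2) ^ k ∧
      dist (y x' ω) (iY (cY.pt (vs.getD j 0))) < (1 / 2) ^ k)} ≤ 2⁻¹ ^ k := by
  rw [one_lt_measure_add_iff (Opens.isOpen _).measurableSet] at hbig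
  let N : ℕ → X → Set Ω := fun j x =>
    {ω | ω ∈ cΩ.gen (PartialAcc (graph q) (finGraph τ) (u (vs.getD j 0)) (k + j + 3)) ∧
      ¬ dist (y x ω) (iY (cY.pt (vs.getD j 0))) < (1 / 2) ^ k}
  have h1 : {ω | ∀ j < vs.length, ¬ (dist (y x ω) (iY (cY.pt (vs.getD j 0))) < (1 / 2) ^ k ∧
      dist (y x' ω) (iY (cY.pt (vs.getD j 0))) < (1 / 2) ^ k)} ⊆
      (core cΩ q u k τ vs : Set Ω)ᶜ ∪ ⋃ j, (N j x ∪ N j x') := by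
    intro ω hω
    by_cases h2 : ω ∈ core cΩ q u k τ vs
    · obtain ⟨j, hj, h3⟩ := h2
      refine Or.inr (Set.mem_iUnion.2 ⟨j, ?_⟩)
      by_cases h4 : dist (y x ω) (iY (cY.pt (vs.getD j 0))) < (1 / 2) ^ k
      · exact Or.inr ⟨h3, fun h5 => hω j hj ⟨h4, h5⟩⟩
      · exact Or.inl ⟨h3, h4⟩
    · exact Or.inl h2
  refine (measure_mono h1).trans ((measure_union_le _ _).trans ?_)
  -- Half of the error is the complement of the core. The `j`-th ball adds two errors of `2⁻¹ ^ (k +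
  -- j + 3)`, which sum up to the other half.
  rw [← FastSeq.two_mul_pow]
  refine add_le_add hbig.le ((measure_iUnion_le _).trans ?_)
  rw [← tsum_inv_two_pow_add]
  refine ENNReal.tsum_le_tsum fun j => (measure_union_le _ _).trans ?_
  rw [show k + 1 + j + 1 = k + j + 2 by ring, ← FastSeq.two_mul_pow]
  exact add_le_add (measure_gen_le hiY hy hq (hu _) hx _) (measure_gen_le hiY hy hq (hu _) hx' _)

/-- Finitely many balls contain `y x` with high probability. Each acceptance uses finitely many
symbols of a name of `x`, so by continuity from below a long prefix accepts enough. -/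
theorem exists_core (hiY : Isometry iY) (hy : ∀ x, Realizes iY (y x) (Yc.toFun x))
    (hq : Rep.conditionalRV P cΩ.rep cX.rep cY.rep q Yc) {u : ℕ → ℕ → ℕ}
    (hu : ∀ v, Rep.opens cY.rep (u v) (cY.ballOpens v k)) (x : X) :
    ∃ τ vs : List ℕ, k < τ.length ∧ x ∈ cX.cyl τ ∧
      1 < P (core cΩ q u k τ vs) + 2⁻¹ ^ (k + 1) := by
  obtain ⟨ν, hν⟩ := ComputableMetric.exists_name' (c := cX) x
  have hfull : P (⋃ v, {ω | dist (y x ω) (iY (cY.pt v)) < (1 / 2) ^ k}) = 1 := by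
    have h1 := is_pre_iSup (Yc.toFun x) fun v => is_ball (cY := cY) (k := k) hiY hy x v
    have h2 : (⨆ v, cY.ballOpens v k) = ⊤ := by
      refine eq_top_iff.2 fun z _ => ?_
      obtain ⟨v, hv⟩ := cY.dense.exists_dist_lt z (show (0 : ℝ) < 1 / 2 ^ k by positivity)
      exact Opens.mem_iSup.2 ⟨v, hv⟩
    rw [h2, (Yc.toFun x).pre_top] at h1
    rw [measure_congr (h1.ae_eq is_top), measure_univ]
  obtain ⟨M, hM⟩ := exists_one_lt_measure_add (P := P) (ε := 2⁻¹ ^ (k + 1))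
    (s := fun M => ⋃ v ∈ Set.Iio M, {ω | dist (y x ω) (iY (cY.pt v)) < (1 / 2) ^ k})
    (fun M M' h => Set.biUnion_subset_biUnion_left (Set.Iio_subset_Iio h)) (by
      have h1 : (⋃ M : ℕ, ⋃ v ∈ Set.Iio M, {ω | dist (y x ω) (iY (cY.pt v)) < (1 / 2) ^ k}) =
          ⋃ v, {ω | dist (y x ω) (iY (cY.pt v)) < (1 / 2) ^ k} := by
        ext ω
        simp only [Set.mem_iUnion, Set.mem_Iio]
        exact ⟨fun ⟨_, v, _, h⟩ => ⟨v, h⟩, fun ⟨v, h⟩ => ⟨v + 1, v, Nat.lt_succ_self v, h⟩⟩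
      rw [h1, hfull]
      exact ENNReal.lt_add_right (by simp) (by simp))
  choose S o hS ho hS' using fun v => hq.exists_fastSeq hν (hu v)
  have h1 : ∀ v, ∀ᵐ ω ∂P, dist (y x ω) (iY (cY.pt v)) < (1 / 2) ^ k → ω ∈ (S v).seq (k + v + 3) :=
    fun v => FastSeq.ae_mem_seq ((hS v).symm ▸ is_ball (cY := cY) hiY hy x v) _
  have hT := fun v => (((Tends.const (graph q)).app (Tends.pref ν)).app
    (Tends.const (graph (u v)))).slice (k + v + 3)
  obtain ⟨t, ht⟩ := exists_one_lt_measure_add (P := P) (ε := 2⁻¹ ^ (k + 1))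
    (s := fun t => core cΩ q u k (pref ν t) (List.range M)) (by
      rintro t t' htt ω ⟨j, hj, s, hs, hω⟩
      rw [List.length_range] at hj
      rw [show (List.range M).getD j 0 = j by simp [hj]] at hs
      refine ⟨j, by rwa [List.length_range], s, ?_, hω⟩
      rw [show (List.range M).getD j 0 = j by simp [hj]]
      exact (hT j).acc_mono (Tends.const _) htt hs) (by
    refine hM.trans_le (add_le_add (measure_mono_ae ?_) le_rfl)
    filter_upwards [ae_all_iff.2 h1] with ω h2 h3
    obtain ⟨v, hv, h3⟩ := Set.mem_iUnion₂.1 h3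
    obtain ⟨μ, hμ⟩ := ComputableMetric.exists_name' (c := cΩ) ω
    have h4 := (mem_iff_acc (hS' v _) hμ).1 (h2 v h3)
    rw [← sliceRel_graph, ← ho] at h4
    obtain ⟨t, ht⟩ := ((hT v).acc (Tends.pref μ)).1 h4
    have hv : v < M := hv
    refine Set.mem_iUnion.2 ⟨t, v, by rwa [List.length_range], pref μ t, ?_,
      ComputableMetric.mem_cyl_pref hμ t⟩
    rw [show (List.range M).getD v 0 = v by simp [hv]]
    exact ht)
  -- The prefix is made longer than `k`, so that its cylinder has radius below `2⁻ᵏ`.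
  refine ⟨pref ν (max t (k + 1)), List.range M, ?_, ComputableMetric.mem_cyl_pref hν _,
    ht.trans_le (add_le_add (measure_mono ?_) le_rfl)⟩
  · rw [length_pref]
    exact lt_of_lt_of_le (Nat.lt_succ_self k) (le_max_right _ _)
  · rintro ω ⟨j, hj, s, hs, hω⟩
    rw [List.length_range] at hj
    rw [show (List.range M).getD j 0 = j by simp [hj]] at hs
    refine ⟨j, by rwa [List.length_range], s, ?_, hω⟩
    rw [show (List.range M).getD j 0 = j by simp [hj]]
    exact (hT j).acc_mono (Tends.const _) (le_max_left _ _) hs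

end Core

end CondRV

/-! ### Finite lists of rational balls and their disjoint shells -/

namespace CondRV

/-- The level sets of infinitely many dyadic numbers are disjoint, so only finitely many can have
measure `η` or more. A dyadic radius with a null sphere might not exist. -/
theorem exists_dyadic_measure_le {Ω : Type*} [MeasurableSpace Ω] {P : Measure Ω}
    [IsFiniteMeasure P] {h : Ω → ℝ} (hh : Measurable h) {s t : ℝ} (hs : 0 ≤ s) (hst : s < t)
    {η : ℝ≥0∞} (hη : 0 < η) :
    ∃ a b : ℕ, s < (a : ℝ) / 2 ^ b ∧ (a : ℝ) / 2 ^ b < t ∧ P {ω | h ω = (a : ℝ) / 2 ^ b} ≤ η := by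
  obtain ⟨m, hm⟩ := exists_one_div_two_pow_lt (sub_pos.2 hst)
  have h1 := Nat.lt_floor_add_one (s * 2 ^ m)
  have h2 := Nat.floor_le (show 0 ≤ s * 2 ^ m by positivity)
  obtain ⟨c, hc, hc'⟩ : ∃ c : ℕ, s < (c : ℝ) / 2 ^ m ∧ (c : ℝ) / 2 ^ m < t := by
    refine ⟨⌊s * 2 ^ m⌋₊ + 1, ?_, ?_⟩
    · rw [lt_div_iff₀ (by positivity)]
      push_cast
      exact h1
    · push_cast
      have h3 : (⌊s * 2 ^ m⌋₊ : ℝ) / 2 ^ m ≤ s := by rwa [div_le_iff₀ (by positivity)]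
      rw [add_div]
      linarith
  obtain ⟨n₀, hn₀⟩ := exists_one_div_two_pow_lt (sub_pos.2 hc')
  let r : ℕ → ℝ := fun n => (c : ℝ) / 2 ^ m + 1 / 2 ^ (n₀ + n)
  have hr : ∀ n, ((c * 2 ^ (n₀ + n) + 2 ^ m : ℕ) : ℝ) / 2 ^ (m + (n₀ + n)) = r n := by
    intro n
    simp only [r]
    rw [div_add_div _ _ (by positivity) (by positivity), pow_add 2 m]
    push_cast
    ring
  have hinj : StrictAnti r := strictAnti_nat_of_succ_lt fun n => by
    simp only [r]
    gcongr
    · norm_num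
    · exact Nat.lt_succ_self n
  have hfin := Measure.finite_const_le_meas_of_disjoint_iUnion P hη (As := fun n => {ω | h ω = r n})
    (fun n => hh (measurableSet_singleton _))
    (fun n n' hn => Set.disjoint_left.2 fun ω (h1 : h ω = r n) (h2 : h ω = r n') =>
      hn (hinj.injective (h1.symm.trans h2)))
    (measure_ne_top _ _)
  obtain ⟨n, hn⟩ := hfin.infinite_compl.nonempty
  refine ⟨c * 2 ^ (n₀ + n) + 2 ^ m, m + (n₀ + n), ?_, ?_, ?_⟩
  · rw [hr]
    have : (0 : ℝ) < 1 / 2 ^ (n₀ + n) := by positivity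
    linarith
  · rw [hr]
    have : r n ≤ r 0 := hinj.antitone (Nat.zero_le n)
    have h3 : r 0 = (c : ℝ) / 2 ^ m + 1 / 2 ^ n₀ := rfl
    linarith
  · rw [hr]
    exact (not_le.1 fun h3 => hn h3).le

/-- A rational ball, given by its center and its radius, together with the beginning of a name and
a list of points. -/
abbrev Entry := (ℕ × ℕ × ℕ) × List ℕ × List ℕ

namespace Entry

/-- The radius of the ball. -/
noncomputable def radius (e : Entry) : ℝ := (e.1.2.1 : ℝ) / 2 ^ e.1.2.2

end Entry

section Shells

variable {X X' : Type*} [MetricSpace X] [MetricSpace X'] {iX : X → X'} {cX : ComputableMetric X}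

/-- The points in the `i`-th ball which are not in one of the earlier closed balls. -/
def shell (cX : ComputableMetric X) (iX : X → X') (d : List Entry) (i : ℕ) : Set X' :=
  {z | dist z (iX (cX.pt (d.getD i default).1.1)) < (d.getD i default).radius ∧
    ∀ j < i, (d.getD j default).radius < dist z (iX (cX.pt (d.getD j default).1.1))}

theorem isOpen_shell (d : List Entry) (i : ℕ) : IsOpen (shell cX iX d i) := by
  have h : shell cX iX d i = {z | dist z (iX (cX.pt (d.getD i default).1.1)) <
      (d.getD i default).radius} ∩ ⋂ j ∈ Set.Iio i,
        {z | (d.getD j default).radius < dist z (iX (cX.pt (d.getD j default).1.1))} := by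
    ext z
    simp [shell]
  rw [h]
  exact (isOpen_lt (continuous_id.dist continuous_const) continuous_const).inter
    ((Set.finite_Iio _).isOpen_biInter fun j _ =>
      isOpen_lt continuous_const (continuous_id.dist continuous_const))

theorem shell_disjoint (d : List Entry) {i j : ℕ} {z : X'} (hi : z ∈ shell cX iX d i)
    (hj : z ∈ shell cX iX d j) : i = j := by
  rcases lt_trichotomy i j with h | h | h
  · exact (lt_asymm hi.1 (hj.2 i h)).elim
  · exact h
  · exact (lt_asymm hj.1 (hi.2 j h)).elim

/-- Take the first ball that contains `z`; off the spheres, being outside an earlier ball means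
being outside its closure. -/
theorem exists_mem_shell {d : List Entry} {z : X'} {e : Entry} (he : e ∈ d)
    (hz : dist z (iX (cX.pt e.1.1)) < e.radius)
    (hne : ∀ e ∈ d, dist z (iX (cX.pt e.1.1)) ≠ e.radius) :
    ∃ i < d.length, z ∈ shell cX iX d i := by
  classical
  have hex : ∃ i, i < d.length ∧ dist z (iX (cX.pt (d.getD i default).1.1)) <
      (d.getD i default).radius := by
    obtain ⟨i, hi, rfl⟩ := List.getElem_of_mem he
    exact ⟨i, hi, by rwa [List.getD_eq_getElem?_getD, List.getElem?_eq_getElem hi]⟩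
  have h1 := Nat.find_spec hex
  refine ⟨Nat.find hex, h1.1, h1.2, fun j hj => ?_⟩
  have h2 : j < d.length := hj.trans h1.1
  have h3 := Nat.find_min hex hj
  simp only [h2, true_and, not_lt] at h3
  refine lt_of_le_of_ne h3 (Ne.symm (hne _ ?_))
  rw [List.getD_eq_getElem?_getD, List.getElem?_eq_getElem h2]
  exact List.getElem_mem h2

end Shells

section Entries

open LowerMeas RandomVariable

variable {Ω : Type*} [MetricSpace Ω] [MeasurableSpace Ω] [OpensMeasurableSpace Ω]
  {P : Measure Ω} [IsProbabilityMeasure P]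
  {X Y X' Y' : Type*} [MetricSpace X] [MetricSpace Y] [MetricSpace X'] [MetricSpace Y']
  [MeasurableSpace X'] [BorelSpace X'] [MeasurableSpace Y'] [BorelSpace Y']
  {iX : X → X'} {iY : Y → Y'} {X₀ : RandomVariable P X} {g : Ω → X'}
  {Yc : ConditionalRV P X Y} {y : X → Ω → Y'}
  {cΩ : ComputableMetric Ω} {cX : ComputableMetric X} {cY : ComputableMetric Y}
  {q : ℕ → ℕ} {k : ℕ}

/-- The entry contains a ball of points which have names that begin with the given beginning, and
for these points the conditional random variable is close to a common value. -/
def Entry.Ok (P : Measure Ω) (cΩ : ComputableMetric Ω) (cX : ComputableMetric X) (q : ℕ → ℕ)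
    (u : ℕ → ℕ → ℕ) (k : ℕ) (e : Entry) : Prop :=
  k < e.2.1.length ∧
    (∀ j < e.2.1.length, dist (cX.pt e.1.1) (cX.pt (e.2.1.getD j 0)) + e.radius < 1 / 2 ^ j) ∧
    1 < P (core cΩ q u k e.2.1 e.2.2) + 2⁻¹ ^ (k + 1)

theorem Entry.Ok.mem_cyl {u : ℕ → ℕ → ℕ} {e : Entry} (h : e.Ok P cΩ cX q u k) {x : X}
    (hx : dist x (cX.pt e.1.1) < e.radius) : x ∈ cX.cyl e.2.1 := by
  intro j hj
  have h1 := h.2.1 j hj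
  have h2 := dist_triangle_left (cX.pt (e.2.1.getD j 0)) x (cX.pt e.1.1)
  have h3 := dist_comm x (cX.pt e.1.1)
  have h4 := dist_comm x (cX.pt (e.2.1.getD j 0))
  linarith

theorem Entry.Ok.center_mem_cyl {u : ℕ → ℕ → ℕ} {e : Entry} (h : e.Ok P cΩ cX q u k) :
    cX.pt e.1.1 ∈ cX.cyl e.2.1 := by
  intro j hj
  have h1 := h.2.1 j hj
  have h2 : 0 ≤ e.radius := by unfold Entry.radius; positivity
  rw [dist_comm]
  linarith

theorem Entry.Ok.dist_le {u : ℕ → ℕ → ℕ} {e : Entry}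
    (h : e.Ok P cΩ cX q u k) {z : X'} (hz : dist z (iX (cX.pt e.1.1)) < e.radius) :
    dist (iX (cX.pt e.1.1)) z ≤ 2 * (1 / 2) ^ k := by
  have h1 := h.2.1 k h.1
  have h2 : 0 ≤ dist (cX.pt e.1.1) (cX.pt (e.2.1.getD k 0)) := dist_nonneg
  have h3 : (0 : ℝ) < 1 / 2 ^ k := by positivity
  rw [one_div_pow, dist_comm]
  linarith

/-- Each `x` has a beginning `τ x` with a large core, and a whole neighbourhood of `x` lies in its
cylinder. Finitely many such neighbourhoods, replaced by rational balls, contain `g` up to a small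
probability. -/
theorem exists_entries [SeparableSpace X] [SeparableSpace X'] (hiX : Isometry iX) (hiY : Isometry iY)
    (hg : Realizes iX g X₀) (hy : ∀ x, Realizes iY (y x) (Yc.toFun x))
    (hq : Rep.conditionalRV P cΩ.rep cX.rep cY.rep q Yc) {u : ℕ → ℕ → ℕ}
    (hu : ∀ v, Rep.opens cY.rep (u v) (cY.ballOpens v k)) :
    ∃ d : List Entry, (∀ e ∈ d, e.Ok P cΩ cX q u k) ∧
      P {ω | ∀ i < d.length, g ω ∉ shell cX iX d i} < 2⁻¹ ^ (k + 1) := by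
  classical
  choose τ vs hτ hx hbig using fun x => exists_core (cX := cX) hiY hy hq hu x
  have hε : ∀ x, ∃ ε : ℝ, 0 < ε ∧ ∀ j < (τ x).length,
      dist (cX.pt ((τ x).getD j 0)) x + ε < 1 / 2 ^ j := by
    intro x
    have h1 : ∀ᶠ ε in 𝓝[>] (0 : ℝ), ∀ j ∈ Finset.range (τ x).length,
        dist (cX.pt ((τ x).getD j 0)) x + ε < 1 / 2 ^ j := by
      refine (eventually_all_finset _).2 fun j hj => ?_
      have h2 : Tendsto (fun ε => dist (cX.pt ((τ x).getD j 0)) x + ε) (𝓝[>] 0)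
          (𝓝 (dist (cX.pt ((τ x).getD j 0)) x + 0)) :=
        (tendsto_const_nhds.add tendsto_id).mono_left nhdsWithin_le_nhds
      rw [add_zero] at h2
      exact h2.eventually (gt_mem_nhds (hx x j (Finset.mem_range.1 hj)))
    obtain ⟨ε, h2, h3⟩ := (h1.and self_mem_nhdsWithin).exists
    exact ⟨ε, h3, fun j hj => h2 j (Finset.mem_range.2 hj)⟩
  choose ε hε0 hε using hε
  have hη : (0 : ℝ≥0∞) < 2⁻¹ ^ (k + 3) := ENNReal.pow_pos (by simp) _
  -- With `g` and the new centre both within `ε x / 8` of `x`, a radius between `ε x / 4` and `ε x /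
  -- 2` contains `g` and still fits into the cylinder.
  obtain ⟨F, hF⟩ := hg.exists_finset_cover hiX (r := fun x => ε x / 8)
    (fun x => by have := hε0 x; positivity) hη
  -- The allowance for the spheres is shared among the balls; adding one avoids division by zero.
  have hη' : (0 : ℝ≥0∞) < 2⁻¹ ^ (k + 3) / (F.card + 1) :=
    ENNReal.div_pos hη.ne' (by finiteness)
  choose c hc using fun x => cX.dense.exists_dist_lt x (show 0 < ε x / 8 by
    have := hε0 x; positivity)
  choose a b hab hab' hP using fun x => exists_dyadic_measure_le (P := P)
    (h := fun ω => dist (g ω) (iX (cX.pt (c x)))) (hg.measurable.dist measurable_const)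
    (s := ε x / 4) (t := ε x / 2) (by have := hε0 x; positivity) (by linarith [hε0 x]) hη'
  let e : X → Entry := fun x => ((c x, a x, b x), τ x, vs x)
  refine ⟨F.toList.map e, fun e' he' => ?_, ?_⟩
  · obtain ⟨x, -, rfl⟩ := List.mem_map.1 he'
    refine ⟨hτ x, fun j hj => ?_, hbig x⟩
    have h1 := hε x j hj
    have h2 := dist_triangle_right (cX.pt (c x)) (cX.pt ((τ x).getD j 0)) x
    rw [dist_comm (cX.pt (c x)) x] at h2
    have h3 := hc x
    have h4 := hab' x
    change dist (cX.pt (c x)) (cX.pt ((τ x).getD j 0)) + (a x : ℝ) / 2 ^ b x < 1 / 2 ^ j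
    linarith [hε0 x]
  · have h1 : {ω | ∀ i < (F.toList.map e).length, g ω ∉ shell cX iX (F.toList.map e) i} ⊆
        {ω | ∀ x ∈ F, ε x / 8 ≤ dist (g ω) (iX x)} ∪
          ⋃ x ∈ F, {ω | dist (g ω) (iX (cX.pt (c x))) = (a x : ℝ) / 2 ^ b x} := by
      intro ω hω
      by_contra h2
      simp only [Set.mem_union, Set.mem_ofPred_eq, Set.mem_iUnion, not_or, not_forall, not_exists,
        not_le] at h2
      obtain ⟨⟨x, hxF, h2⟩, h3⟩ := h2
      obtain ⟨i, hi, h4⟩ := exists_mem_shell (cX := cX) (iX := iX) (d := F.toList.map e)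
        (z := g ω) (e := e x) (List.mem_map_of_mem (Finset.mem_toList.2 hxF)) (by
          have h5 := dist_triangle (g ω) (iX x) (iX (cX.pt (c x)))
          rw [hiX.dist_eq] at h5
          have h6 := hc x
          have h7 := hab x
          change dist (g ω) (iX (cX.pt (c x))) < (a x : ℝ) / 2 ^ b x
          linarith) (by
          intro e' he'
          obtain ⟨x', hx', rfl⟩ := List.mem_map.1 he'
          exact h3 x' (Finset.mem_toList.1 hx'))
      exact hω i hi h4
    have h2 : (2⁻¹ : ℝ≥0∞) ^ (k + 3) + 2⁻¹ ^ (k + 3) < 2⁻¹ ^ (k + 1) := by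
      rw [FastSeq.two_mul_pow (k + 2)]
      rw [← FastSeq.two_mul_pow (k + 1)]
      exact ENNReal.lt_add_right (by simp) (by simp)
    refine ((measure_mono h1).trans ((measure_union_le _ _).trans (add_le_add hF
      ((measure_biUnion_finset_le _ _).trans ((Finset.sum_le_sum fun x _ => hP x).trans ?_))))).trans_lt
      h2
    rw [Finset.sum_const, nsmul_eq_mul, ← mul_div_assoc, mul_comm, mul_div_assoc]
    refine mul_le_of_le_one_right' (ENNReal.div_le_of_le_mul ?_)
    rw [one_mul]
    exact le_self_add

end Entries

end CondRV

namespace CondRV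

/-! ## Semidecidability of the conditions in the algorithm -/

theorem primrec_getEntry {α : Type*} [Primcodable α] {f : α → List Entry} {g : α → ℕ}
    (hf : Primrec f) (hg : Primrec g) : Primrec fun a => (f a).getD (g a) default :=
  (Primrec.list_getD default).comp hf hg

attribute [fun_prop] primrec_getEntry

section Conditions

variable {X Y : Type*} [MetricSpace X] [MetricSpace Y] (cX : ComputableMetric X)
  (cY : ComputableMetric Y)

/-- The beginning `l` of a name shows that the point is in the `i`-th shell. -/
def ShellDesc (d : List Entry) (i : ℕ) (l : List ℕ) : Prop :=
  (∃ m, cX.DistLt (l.take m) (d.getD i default).1.1 (d.getD i default).radius) ∧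
    ∃ m, ∀ j < i, ∃ m', cX.DistGt ((l.take m).take m') (d.getD j default).1.1
      (d.getD j default).radius

theorem describes_shell (d : List Entry) (i : ℕ) :
    Describes cX.rep (ShellDesc cX d i) (· ∈ shell cX id d i) :=
  (cX.describes_distLt (d.getD i default).1.1 (d.getD i default).radius).and
    (Describes.forall_lt fun j _ =>
      cX.describes_distGt (d.getD j default).1.1 (d.getD j default).radius)

theorem re_shellDesc :
    RE fun _ (x : (List Entry × ℕ) × List ℕ) => ShellDesc cX x.1.1 x.1.2 x.2 := by
  refine RE.and (RE.exists' ?_) (RE.exists' (RE.forall_lt (RE.exists' ?_) ?_))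
  · exact cX.re_distLt (l := fun y : ((List Entry × ℕ) × List ℕ) × ℕ => y.1.2.take y.2)
      (i := fun y => (y.1.1.1.getD y.1.1.2 default).1.1)
      (n := fun y => (y.1.1.1.getD y.1.1.2 default).1.2.1)
      (b := fun y => (y.1.1.1.getD y.1.1.2 default).1.2.2)
      (by fun_prop) (by fun_prop) (by fun_prop) (by fun_prop)
  · exact cX.re_distGt
      (l := fun y : ((((List Entry × ℕ) × List ℕ) × ℕ) × ℕ) × ℕ => (y.1.1.1.2.take y.1.1.2).take y.2)
      (i := fun y => (y.1.1.1.1.1.getD y.1.2 default).1.1)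
      (n := fun y => (y.1.1.1.1.1.getD y.1.2 default).1.2.1)
      (b := fun y => (y.1.1.1.1.1.getD y.1.2 default).1.2.2)
      (by fun_prop) (by fun_prop) (by fun_prop) (by fun_prop)
  · fun_prop

/-- The open set of all points in a shell. -/
def shellOpens (d : List Entry) (i : ℕ) : Opens X := ⟨shell cX id d i, isOpen_shell d i⟩

/-- The open set of all points in some shell. -/
def shellsOpens (d : List Entry) : Opens X :=
  ⟨⋃ i, ⋃ (_ : i < d.length), shell cX id d i,
    isOpen_iUnion fun i => isOpen_iUnion fun _ => isOpen_shell d i⟩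

theorem describes_shells (d : List Entry) :
    Describes cX.rep (fun l => ∃ i, i < d.length ∧ ShellDesc cX d i l) (· ∈ shellsOpens cX d) :=
  (Describes.exists' fun i => Describes.const_and fun _ => describes_shell cX d i).congr
    fun x => by
      change x ∈ ⋃ i, ⋃ (_ : i < d.length), shell cX id d i ↔ _
      simp only [Set.mem_iUnion, exists_prop]

theorem re_shellsDesc : RE fun _ (x : List Entry × List ℕ) =>
    ∃ i, i < x.1.length ∧ ShellDesc cX x.1 i x.2 := by
  refine RE.exists' (RE.and (RE.of_pred (primrecPred_lt ?_ ?_)) ?_)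
  · fun_prop
  · fun_prop
  · exact (re_shellDesc cX).comp (f := fun y : (List Entry × List ℕ) × ℕ => ((y.1.1, y.2), y.1.2))
      (by fun_prop)

theorem describes_ball (v k : ℕ) :
    Describes cX.rep (fun l => cX.DistLt l v (1 / 2 ^ k)) (· ∈ cX.ballOpens v k) :=
  cX.describes_distLt v (1 / 2 ^ k)

theorem re_ballDesc :
    RE fun _ (x : (ℕ × ℕ) × List ℕ) => cX.DistLt x.2 x.1.1 (1 / 2 ^ x.1.2) := by
  refine (cX.re_distLt (l := fun x : (ℕ × ℕ) × List ℕ => x.2) (i := fun x => x.1.1)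
    (n := fun _ => 1) (b := fun x => x.1.2) (by fun_prop) (by fun_prop) (by fun_prop)
    (by fun_prop)).of_iff fun _ x => ?_
  rw [Nat.cast_one]

/-- A box which contains a neighbourhood of radius `10 / 2 ^ k` of `(x, v)` has a name that begins
with an element of `S`. -/
def Test (S : List ℕ → Prop) (k : ℕ) (x : X) (v : Y) : Prop :=
  ∃ s, S s ∧ ∀ m < s.length, dist (cX.pt (s.getD m 0).unpair.1) x + 10 / 2 ^ k < 1 / 2 ^ m ∧
    dist (cY.pt (s.getD m 0).unpair.2) v + 10 / 2 ^ k < 1 / 2 ^ m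

theorem re_test {α : Type*} [Primcodable α] {S : (ℕ → ℕ) → List ℕ → Prop} (hS : RE S)
    {k i j : α → ℕ} (hk : Primrec k) (hi : Primrec i) (hj : Primrec j) :
    RE fun ρ a => Test cX cY (S ρ) (k a) (cX.pt (i a)) (cY.pt (j a)) := by
  refine RE.exists' (RE.and ?_ (RE.forall_lt (RE.and ?_ ?_) ?_))
  · exact hS.comp Primrec.snd
  · refine (cX.re_dist_add_lt (i := fun y : (α × List ℕ) × ℕ => (y.1.2.getD y.2 0).unpair.1)
      (j := fun y => i y.1.1) (n := fun _ => 10) (b := fun y => k y.1.1) (n' := fun _ => 1)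
      (b' := fun y => y.2) (by fun_prop) (by fun_prop) (by fun_prop) (by fun_prop) (by fun_prop)
      (by fun_prop)).of_iff fun _ y => ?_
    rw [Nat.cast_one, Nat.cast_ofNat]
  · refine (cY.re_dist_add_lt (i := fun y : (α × List ℕ) × ℕ => (y.1.2.getD y.2 0).unpair.2)
      (j := fun y => j y.1.1) (n := fun _ => 10) (b := fun y => k y.1.1) (n' := fun _ => 1)
      (b' := fun y => y.2) (by fun_prop) (by fun_prop) (by fun_prop) (by fun_prop) (by fun_prop)
      (by fun_prop)).of_iff fun _ y => ?_
    rw [Nat.cast_one, Nat.cast_ofNat]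
  · fun_prop

variable {X' Y' : Type*} [MetricSpace X'] [MetricSpace Y'] {iX : X → X'} {iY : Y → Y'}

/-- The union of the boxes with names in `S` in a larger space. -/
def boxes (iX : X → X') (iY : Y → Y') (S : List ℕ → Prop) : Set (X' × Y') :=
  {z | ∃ s, S s ∧ ∀ m < s.length, dist (iX (cX.pt (s.getD m 0).unpair.1)) z.1 < 1 / 2 ^ m ∧
    dist (iY (cY.pt (s.getD m 0).unpair.2)) z.2 < 1 / 2 ^ m}

theorem isOpen_boxes (S : List ℕ → Prop) : IsOpen (boxes cX cY iX iY S) := by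
  have h : boxes cX cY iX iY S = ⋃ s, ⋃ (_ : S s), ⋂ m ∈ Set.Iio s.length,
      ({z | dist (iX (cX.pt (s.getD m 0).unpair.1)) z.1 < 1 / 2 ^ m} ∩
        {z | dist (iY (cY.pt (s.getD m 0).unpair.2)) z.2 < 1 / 2 ^ m}) := by
    ext z
    simp only [boxes, Set.mem_ofPred_eq, Set.mem_iUnion, Set.mem_iInter, Set.mem_Iio,
      Set.mem_inter_iff, exists_prop]
  rw [h]
  exact isOpen_iUnion fun s => isOpen_iUnion fun _ => (Set.finite_Iio _).isOpen_biInter fun m _ =>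
    (isOpen_lt (continuous_const.dist continuous_fst) continuous_const).inter
      (isOpen_lt (continuous_const.dist continuous_snd) continuous_const)

theorem isTest_test (hiX : Isometry iX) (hiY : Isometry iY) (S : List ℕ → Prop) :
    IsTest iX iY (boxes cX cY iX iY S) (Test cX cY S) where
  mem := by
    rintro k x v z ⟨s, hs, h⟩ hz
    refine ⟨s, hs, fun m hm => ?_⟩
    obtain ⟨h1, h2⟩ := h m hm
    have h3 : dist (iX x) z.1 ≤ _ := (le_max_left _ _).trans hz
    have h4 : dist (iY v) z.2 ≤ _ := (le_max_right _ _).trans hz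
    rw [← hiX.dist_eq] at h1
    rw [← hiY.dist_eq] at h2
    have h5 := dist_triangle (iX (cX.pt (s.getD m 0).unpair.1)) (iX x) z.1
    have h6 := dist_triangle (iY (cY.pt (s.getD m 0).unpair.2)) (iY v) z.2
    have h7 : (10 : ℝ) / 2 ^ k = 10 * (1 / 2) ^ k := by rw [one_div_pow]; ring
    have h8 : (0 : ℝ) < (1 / 2) ^ k := by positivity
    rw [h7] at h1 h2
    exact ⟨by linarith, by linarith⟩
  succ := by
    rintro k x v x' v' ⟨s, hs, h⟩ hx hv
    refine ⟨s, hs, fun m hm => ?_⟩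
    obtain ⟨h1, h2⟩ := h m hm
    have h5 := dist_triangle (cX.pt (s.getD m 0).unpair.1) x x'
    have h6 := dist_triangle (cY.pt (s.getD m 0).unpair.2) v v'
    have h7 : (10 : ℝ) / 2 ^ k = 10 * (1 / 2) ^ k := by rw [one_div_pow]; ring
    -- Halving the margin `10 / 2 ^ k` frees exactly the `5 / 2 ^ k` by which the centre may move.
    have h8 : (10 : ℝ) / 2 ^ (k + 1) = 5 * (1 / 2) ^ k := by rw [one_div_pow, pow_succ]; ring
    rw [h7] at h1 h2
    rw [h8]
    exact ⟨by linarith, by linarith⟩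
  eventually := by
    rintro z ⟨s, hs, h⟩
    -- The margin `10` and the distance `3` from the centre to `z` add up to `13`.
    have h1 : Tendsto (fun k : ℕ => (13 : ℝ) * (1 / 2) ^ k) atTop (𝓝 (13 * 0)) :=
      (tendsto_pow_atTop_nhds_zero_of_lt_one (by norm_num) (by norm_num)).const_mul _
    rw [mul_zero] at h1
    have h2 : ∀ᶠ k : ℕ in atTop, ∀ m ∈ Finset.range s.length,
        dist (iX (cX.pt (s.getD m 0).unpair.1)) z.1 + 13 * (1 / 2) ^ k < 1 / 2 ^ m ∧
        dist (iY (cY.pt (s.getD m 0).unpair.2)) z.2 + 13 * (1 / 2) ^ k < 1 / 2 ^ m := by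
      refine (eventually_all_finset _).2 fun m hm => ?_
      obtain ⟨h3, h4⟩ := h m (Finset.mem_range.1 hm)
      filter_upwards [h1.eventually (gt_mem_nhds (sub_pos.2 h3)),
        h1.eventually (gt_mem_nhds (sub_pos.2 h4))] with k h5 h6
      exact ⟨by linarith, by linarith⟩
    filter_upwards [h2] with k h3 x v hz
    refine ⟨s, hs, fun m hm => ?_⟩
    obtain ⟨h1, h2⟩ := h3 m (Finset.mem_range.2 hm)
    have h3 : dist (iX x) z.1 ≤ _ := (le_max_left _ _).trans hz
    have h4 : dist (iY v) z.2 ≤ _ := (le_max_right _ _).trans hz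
    have h5 := dist_triangle_right (iX (cX.pt (s.getD m 0).unpair.1)) (iX x) z.1
    have h6 := dist_triangle_right (iY (cY.pt (s.getD m 0).unpair.2)) (iY v) z.2
    have h7 : (10 : ℝ) / 2 ^ k = 10 * (1 / 2) ^ k := by rw [one_div_pow]; ring
    rw [h7, ← hiX.dist_eq, ← hiY.dist_eq]
    exact ⟨by linarith, by linarith⟩

variable {cX cY} in
theorem preimage_boxes (hiX : Isometry iX) (hiY : Isometry iY) {S : List ℕ → Prop}
    {W : Opens (X × Y)} (h : Describes (Rep.prod cX.rep cY.rep) S (· ∈ W)) :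
    (W : Set (X × Y)) = Prod.map iX iY ⁻¹' boxes cX cY iX iY S := by
  ext ⟨x, v⟩
  refine (h.prod_iff x v).trans ?_
  simp only [boxes, Set.mem_preimage, Set.mem_ofPred_eq, Prod.map_fst, Prod.map_snd, hiX.dist_eq,
    hiY.dist_eq]

end Conditions

end CondRV

namespace CondRV

/-! ## Computability of the joint random variable -/

/-- The name of the random variable in the input. -/
def inputX (ρ : ℕ → ℕ) : ℕ → ℕ := fun n => (ρ n).unpair.1.unpair.1

/-- The name of the conditional random variable in the input. -/
def inputY (ρ : ℕ → ℕ) : ℕ → ℕ := fun n => (ρ n).unpair.1.unpair.2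

/-- The name of the open set in the input. -/
def inputW (ρ : ℕ → ℕ) : ℕ → ℕ := fun n => (ρ n).unpair.2

section Inputs

variable {α : Type*} [Primcodable α]

theorem ref_inputX : REF fun ρ (_ : α) => graph (inputX ρ) :=
  REF.oracle (g := fun z => z.unpair.1.unpair.1) (by fun_prop)

theorem ref_inputY : REF fun ρ (_ : α) => graph (inputY ρ) :=
  REF.oracle (g := fun z => z.unpair.1.unpair.2) (by fun_prop)

theorem ref_inputW : REF fun ρ (_ : α) => graph (inputW ρ) :=
  REF.oracle (g := fun z => z.unpair.2) (by fun_prop)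

end Inputs

section Algorithm

variable {Ω : Type*} [MetricSpace Ω] [MeasurableSpace Ω]
  {P : Measure Ω} {X Y : Type*} [MetricSpace X] [MetricSpace Y]
  {cΩ : ComputableMetric Ω} {cX : ComputableMetric X} {cY : ComputableMetric Y}
  {uD : (ℕ → ℕ) → List Entry × ℕ → ℕ → ℕ} {uU : (ℕ → ℕ) → List Entry → ℕ → ℕ}
  {uB : (ℕ → ℕ) → ℕ × ℕ → ℕ → ℕ}

/-- The beginning `l` of a name shows that the point is in the core. -/
def CoreDesc (cΩ : ComputableMetric Ω) (q : ℕ → ℕ) (u : ℕ → ℕ → ℕ) (k : ℕ) (τ vs l : List ℕ) :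
    Prop :=
  ∃ j, j < vs.length ∧
    ∃ l', PartialAcc (graph q) (finGraph τ) (u (vs.getD j 0)) (k + j + 3) l' ∧ cΩ.Cert l l'

theorem describes_core (q : ℕ → ℕ) (u : ℕ → ℕ → ℕ) (k : ℕ) (τ vs : List ℕ) :
    Describes cΩ.rep (CoreDesc cΩ q u k τ vs) (· ∈ core cΩ q u k τ vs) :=
  Describes.exists' fun _ => Describes.const_and fun _ => cΩ.describes_gen _

theorem re_coreDesc (huB : REF fun ρ a => graph (uB ρ a)) :
    RE fun ρ (x : (List ℕ × List ℕ × ℕ) × List ℕ) =>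
      CoreDesc cΩ (inputY ρ) (fun v => uB ρ (v, x.1.2.2)) x.1.2.2 x.1.1 x.1.2.1 x.2 := by
  refine RE.exists' (RE.and (RE.of_pred (primrecPred_lt ?_ ?_)) (RE.exists' (RE.and ?_
    (cΩ.re_cert ?_ ?_))))
  · fun_prop
  · fun_prop
  · have h1 := (((ref_inputY (α := (((List ℕ × List ℕ × ℕ) × List ℕ) × ℕ) × List ℕ)).app
      (REF.finGraph (f := fun y => y.1.1.1.1) (by fun_prop))).app
      (huB.comp (f := fun y : (((List ℕ × List ℕ × ℕ) × List ℕ) × ℕ) × List ℕ =>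
        (y.1.1.1.2.1.getD y.1.2 0, y.1.1.1.2.2)) (by fun_prop))).slice
      (n := fun y => y.1.1.1.2.2 + y.1.2 + 3) (by fun_prop)
    exact h1.acc (REF.finGraph (f := fun y : (((List ℕ × List ℕ × ℕ) × List ℕ) × ℕ) × List ℕ => y.2)
      (by fun_prop))
  · fun_prop
  · fun_prop

/-- It is semidecidable whether a list of entries is good enough for the level `k`. -/
theorem exists_good (hP : ComputableMeasure P cΩ.rep) (huB : REF fun ρ a => graph (uB ρ a))
    (huU : REF fun ρ a => graph (uU ρ a)) :
    ∃ Good : (ℕ → ℕ) → ℕ → List Entry → Prop,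
      RE (fun ρ (x : ℕ × List Entry) => Good ρ x.1 x.2) ∧ ∀ ρ k d (U : Opens Ω),
        Describes cΩ.rep (fun l => Acc (sliceRel (App (graph (inputX ρ)) (graph (uU ρ d))) (k + 1))
          (finGraph l)) (· ∈ U) →
        (Good ρ k d ↔ (∀ i < d.length,
          (d.getD i default).Ok P cΩ cX (inputY ρ) (fun v => uB ρ (v, k)) k) ∧
          1 < P U + 2⁻¹ ^ (k + 1)) := by
  obtain ⟨B₁, hB₁, hB₁'⟩ := hP.exists_big (S := fun ρ (x : List ℕ × List ℕ × ℕ) l =>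
    CoreDesc cΩ (inputY ρ) (fun v => uB ρ (v, x.2.2)) x.2.2 x.1 x.2.1 l) (re_coreDesc huB)
  have hU : RE fun ρ (x : (ℕ × List Entry) × List ℕ) =>
      Acc (sliceRel (App (graph (inputX ρ)) (graph (uU ρ x.1.2))) (x.1.1 + 1)) (finGraph x.2) :=
    ((ref_inputX.app (huU.comp (f := fun x : (ℕ × List Entry) × List ℕ => x.1.2)
      (by fun_prop))).slice (n := fun x => x.1.1 + 1) (by fun_prop)).acc
      (REF.finGraph (f := fun x : (ℕ × List Entry) × List ℕ => x.2) (by fun_prop))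
  obtain ⟨B₂, hB₂, hB₂'⟩ := hP.exists_big (S := fun ρ (x : ℕ × List Entry) l =>
    Acc (sliceRel (App (graph (inputX ρ)) (graph (uU ρ x.2))) (x.1 + 1)) (finGraph l)) hU
  refine ⟨fun ρ k d => (∀ i < d.length, k < (d.getD i default).2.1.length ∧
    (∀ j < (d.getD i default).2.1.length, dist (cX.pt (d.getD i default).1.1)
      (cX.pt ((d.getD i default).2.1.getD j 0)) + (d.getD i default).radius < 1 / 2 ^ j) ∧
    B₁ ρ ((d.getD i default).2.1, (d.getD i default).2.2, k) (k + 1)) ∧ B₂ ρ (k, d) (k + 1),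
    ?_, ?_⟩
  · refine RE.and (RE.forall_lt (RE.and (RE.of_pred (primrecPred_lt ?_ ?_)) (RE.and
      (RE.forall_lt ?_ ?_) ?_)) ?_) ?_
    · fun_prop
    · fun_prop
    · refine (cX.re_dist_add_lt
        (i := fun y : ((ℕ × List Entry) × ℕ) × ℕ => (y.1.1.2.getD y.1.2 default).1.1)
        (j := fun y => (y.1.1.2.getD y.1.2 default).2.1.getD y.2 0)
        (n := fun y => (y.1.1.2.getD y.1.2 default).1.2.1)
        (b := fun y => (y.1.1.2.getD y.1.2 default).1.2.2)
        (n' := fun _ => 1) (b' := fun y => y.2) (by fun_prop) (by fun_prop) (by fun_prop)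
        (by fun_prop) (by fun_prop) (by fun_prop)).of_iff fun _ y => ?_
      rw [Nat.cast_one, Entry.radius]
    · fun_prop
    · exact hB₁.comp (f := fun y : (ℕ × List Entry) × ℕ => (((y.1.2.getD y.2 default).2.1,
        (y.1.2.getD y.2 default).2.2, y.1.1), y.1.1 + 1)) (by fun_prop)
    · fun_prop
    · exact hB₂.comp (f := fun y : ℕ × List Entry => (y, y.1 + 1)) (by fun_prop)
  · intro ρ k d U hU
    refine and_congr (forall₂_congr fun i _ => ?_) (hB₂' ρ (k, d) (k + 1) U hU)
    exact and_congr_right' (and_congr_right' (hB₁' ρ _ (k + 1) _ (describes_core _ _ _ _ _)))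

/-- The beginning `l` of a name shows that the point is in the set selected at level `k`. -/
def LevelDesc (cX : ComputableMetric X) (cY : ComputableMetric Y)
    (uD : (ℕ → ℕ) → List Entry × ℕ → ℕ → ℕ) (uB : (ℕ → ℕ) → ℕ × ℕ → ℕ → ℕ)
    (Sel : (ℕ → ℕ) → ℕ → List Entry → Prop) (ρ : ℕ → ℕ) (k : ℕ) (l : List ℕ) : Prop :=
  ∃ x : List Entry × ℕ × ℕ, (Sel ρ k x.1 ∧ x.2.1 < x.1.length ∧
    x.2.2 < (x.1.getD x.2.1 default).2.2.length ∧
    Test cX cY (fun s => Acc (graph (inputW ρ)) (finGraph s)) k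
      (cX.pt (x.1.getD x.2.1 default).1.1)
      (cY.pt ((x.1.getD x.2.1 default).2.2.getD x.2.2 0))) ∧
    ((∃ m, Acc (sliceRel (App (graph (inputX ρ)) (graph (uD ρ (x.1, x.2.1))))
      (k + Nat.pair x.2.1 x.2.2 + 2)) (finGraph (l.take m))) ∧
    ∃ m, Acc (sliceRel (App (App (graph (inputY ρ))
      (graph fun _ => (x.1.getD x.2.1 default).1.1))
      (graph (uB ρ ((x.1.getD x.2.1 default).2.2.getD x.2.2 0, k))))
      (k + Nat.pair x.2.1 x.2.2 + 2)) (finGraph (l.take m)))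

theorem re_levelDesc (huD : REF fun ρ a => graph (uD ρ a)) (huB : REF fun ρ a => graph (uB ρ a))
    {Sel : (ℕ → ℕ) → ℕ → List Entry → Prop}
    (hSel : RE fun ρ (x : ℕ × List Entry) => Sel ρ x.1 x.2) :
    RE fun ρ (x : ℕ × List ℕ) => LevelDesc cX cY uD uB Sel ρ x.1 x.2 := by
  refine RE.exists' (RE.and (RE.and ?_ (RE.and (RE.of_pred (primrecPred_lt ?_ ?_))
    (RE.and (RE.of_pred (primrecPred_lt ?_ ?_)) ?_))) (RE.and (RE.exists' ?_) (RE.exists' ?_)))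
  · exact hSel.comp (f := fun y : (ℕ × List ℕ) × List Entry × ℕ × ℕ => (y.1.1, y.2.1))
      (by fun_prop)
  · fun_prop
  · fun_prop
  · fun_prop
  · fun_prop
  · refine re_test (α := (ℕ × List ℕ) × List Entry × ℕ × ℕ) cX cY
      (S := fun ρ s => Acc (graph (inputW ρ)) (finGraph s)) ?_ (k := fun y => y.1.1)
      (i := fun y => (y.2.1.getD y.2.2.1 default).1.1)
      (j := fun y => (y.2.1.getD y.2.2.1 default).2.2.getD y.2.2.2 0) (by fun_prop) (by fun_prop)
      (by fun_prop)
    exact ref_inputW.acc (REF.finGraph (f := fun y : List ℕ => y) (by fun_prop))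
  · have h1 := ((ref_inputX (α := ((ℕ × List ℕ) × List Entry × ℕ × ℕ) × ℕ)).app
      (huD.comp (f := fun y : ((ℕ × List ℕ) × List Entry × ℕ × ℕ) × ℕ =>
        (y.1.2.1, y.1.2.2.1)) (by fun_prop))).slice
      (n := fun y => y.1.1.1 + Nat.pair y.1.2.2.1 y.1.2.2.2 + 2) (by fun_prop)
    exact h1.acc (REF.finGraph (f := fun y : ((ℕ × List ℕ) × List Entry × ℕ × ℕ) × ℕ =>
      y.1.1.2.take y.2) (by fun_prop))
  · have h1 := (((ref_inputY (α := ((ℕ × List ℕ) × List Entry × ℕ × ℕ) × ℕ)).app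
      (REF.const (f := fun y => (y.1.2.1.getD y.1.2.2.1 default).1.1) (by fun_prop))).app
      (huB.comp (f := fun y : ((ℕ × List ℕ) × List Entry × ℕ × ℕ) × ℕ =>
        ((y.1.2.1.getD y.1.2.2.1 default).2.2.getD y.1.2.2.2 0, y.1.1.1)) (by fun_prop))).slice
      (n := fun y => y.1.1.1 + Nat.pair y.1.2.2.1 y.1.2.2.2 + 2) (by fun_prop)
    exact h1.acc (REF.finGraph (f := fun y : ((ℕ × List ℕ) × List Entry × ℕ × ℕ) × ℕ =>
      y.1.1.2.take y.2) (by fun_prop))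

end Algorithm

section Program

open LowerMeas RandomVariable

variable {Ω : Type*} [MetricSpace Ω] [MeasurableSpace Ω] [OpensMeasurableSpace Ω]
  {P : Measure Ω} [IsProbabilityMeasure P]
  {X Y X' Y' : Type*} [MetricSpace X] [MetricSpace Y] [MetricSpace X'] [MetricSpace Y']
  [MeasurableSpace X'] [BorelSpace X'] [MeasurableSpace Y'] [BorelSpace Y']
  [SeparableSpace X'] [SeparableSpace Y'] [CompleteSpace X'] [CompleteSpace Y']
  [SeparableSpace X] {iX : X → X'} {iY : Y → Y'}

theorem preimage_shell {cX : ComputableMetric X} (hiX : Isometry iX) (d : List Entry) (i : ℕ) :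
    shell cX id d i = iX ⁻¹' shell cX iX d i := by
  ext x
  simp only [shell, Set.mem_ofPred_eq, Set.mem_preimage, hiX.dist_eq, id_eq]

theorem is_shells {X₀ : RandomVariable P X} {g : Ω → X'} {cX : ComputableMetric X}
    (hiX : Isometry iX) (hg : Realizes iX g X₀) (d : List Entry) :
    (X₀.pre (shellsOpens cX d)).Is {ω | ∃ i, i < d.length ∧ g ω ∈ shell cX iX d i} := by
  have h1 := hg.is_pre (shellsOpens cX d) (⋃ i, ⋃ (_ : i < d.length), shell cX iX d i)
    (isOpen_iUnion fun i => isOpen_iUnion fun _ => isOpen_shell d i) (by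
      rw [Set.preimage_iUnion₂]
      exact Set.iUnion_congr fun i => Set.iUnion_congr fun _ => preimage_shell hiX d i)
  convert h1 using 1
  ext ω
  simp only [Set.mem_preimage, Set.mem_iUnion, exists_prop, Set.mem_ofPred_eq]

/-- A list of entries which is good enough for the level `k` determines a level. -/
theorem exists_level {X₀ : RandomVariable P X} {Yc : ConditionalRV P X Y} {g : Ω → X'}
    {y : X → Ω → Y'} {cΩ : ComputableMetric Ω} {cX : ComputableMetric X} {cY : ComputableMetric Y}
    {q : ℕ → ℕ} {k : ℕ} (hiX : Isometry iX) (hiY : Isometry iY) (hg : Realizes iX g X₀)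
    (hy : ∀ x, Realizes iY (y x) (Yc.toFun x))
    (hq : Rep.conditionalRV P cΩ.rep cX.rep cY.rep q Yc) {u : ℕ → ℕ → ℕ}
    (hu : ∀ v, Rep.opens cY.rep (u v) (cY.ballOpens v k)) {d : List Entry}
    (hok : ∀ i < d.length, (d.getD i default).Ok P cΩ cX q u k) {SU : FastSeq P}
    (hSU : LowerMeas.mk SU = X₀.pre (shellsOpens cX d))
    (hbig : 1 < P (SU.seq (k + 1)) + 2⁻¹ ^ (k + 1)) {SD : ℕ → FastSeq P}
    (hSD : ∀ i, LowerMeas.mk (SD i) = X₀.pre (shellOpens cX d i)) {SB : ℕ → ℕ → FastSeq P}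
    (hSB : ∀ c v, LowerMeas.mk (SB c v) = (Yc.toFun (cX.pt c)).pre (cY.ballOpens v k)) :
    ∃ l : Level P iX iY g y k, ∀ t ω, ω ∈ l.select t ↔ ∃ i j, (i < d.length ∧
      j < (d.getD i default).2.2.length ∧ t (cX.pt (d.getD i default).1.1)
        (cY.pt ((d.getD i default).2.2.getD j 0))) ∧
      ω ∈ (SD i).seq (k + Nat.pair i j + 2) ∧
      ω ∈ (SB (d.getD i default).1.1 ((d.getD i default).2.2.getD j 0)).seq
        (k + Nat.pair i j + 2) := by
  have hSD' : ∀ i, (LowerMeas.mk (SD i)).Is {ω | g ω ∈ shell cX iX d i} := fun i =>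
    (hSD i).symm ▸ hg.is_pre (shellOpens cX d i) _ (isOpen_shell d i)
      (preimage_shell hiX d i)
  have hSU' := hSU.symm ▸ is_shells (cX := cX) hiX hg d
  have hSB' := fun c v => (hSB c v).symm ▸ is_ball (cY := cY) (k := k) hiY hy (cX.pt c) v
  refine ⟨
    { n := d.length
      m := fun i => (d.getD i default).2.2.length
      c := fun i => cX.pt (d.getD i default).1.1
      v := fun i j => cY.pt ((d.getD i default).2.2.getD j 0)
      D := shell cX iX d
      A := fun i j => (SD i).seq (k + Nat.pair i j + 2)
      B := fun i j => (SB (d.getD i default).1.1 ((d.getD i default).2.2.getD j 0)).seq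
        (k + Nat.pair i j + 2)
      isOpen := fun i _ => isOpen_shell d i
      disjoint := fun i _ j _ x hi hj => shell_disjoint d hi hj
      dist_le := fun i hi z hz => (hok i hi).dist_le hz.1
      osc := fun i hi x hx => measure_osc_le hiY hy hq hu (hok i hi).2.2 (hok i hi).center_mem_cyl
        ((hok i hi).mem_cyl (by
          have h1 := hx.1
          rwa [hiX.dist_eq] at h1))
      cover := ?_
      A_mem := fun i _ j _ => FastSeq.ae_mem_seq (hSD' i) _
      A_le := fun i _ j _ => FastSeq.measure_mem_seq_notMem_le (hSD' i) _
      B_mem := fun i _ j _ => FastSeq.ae_mem_seq (hSB' _ _) _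
      B_le := fun i _ j _ => FastSeq.measure_mem_seq_notMem_le (hSB' _ _) _ }, fun t ω => ?_⟩
  -- The approximation of the covered event misses at most `2⁻¹ ^ (k + 1)` and exceeds the event by
  -- at most as much.
  · rw [one_lt_measure_add_iff (Opens.isOpen _).measurableSet] at hbig
    rw [← FastSeq.two_mul_pow]
    refine (measure_mono fun ω hω => ?_).trans ((measure_union_le _ _).trans
      (add_le_add hbig.le (FastSeq.measure_mem_seq_notMem_le hSU' (k + 1))))
    by_cases h : ω ∈ SU.seq (k + 1)
    · exact Or.inr ⟨h, fun ⟨i, hi, h1⟩ => hω i hi h1⟩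
    · exact Or.inl h
  · change (∃ i < d.length, ∃ j < _, _ ∧ _ ∧ _) ↔ _
    simp only [and_assoc]
    refine exists_congr fun i => ?_
    constructor
    · rintro ⟨hi, j, hj, h⟩
      exact ⟨j, hi, hj, h⟩
    · rintro ⟨j, hi, hj, h⟩
      exact ⟨hi, j, hj, h⟩

/-- The joint random variable is computable. -/
theorem exists_joint_program [P.OuterRegular] (hiX : Isometry iX) (hiY : Isometry iY)
    {cΩ : ComputableMetric Ω} {cX : ComputableMetric X} {cY : ComputableMetric Y}
    (hP : ComputableMeasure P cΩ.rep) :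
    ∃ a : ℕ → ℕ, Computable a ∧ ∀ (T : MeasureTopology P) (X₀ : RandomVariable P X)
      (Yc : ConditionalRV P X Y), Yc.IndependentOf T →
      ∀ Z, IsJoint T X₀ Yc Z → ∀ p q, Rep.randomVariable P cΩ.rep cX.rep p X₀ →
        Rep.conditionalRV P cΩ.rep cX.rep cY.rep q Yc →
        ∃ r, Apply a (pairSeq p q) r ∧
          Rep.randomVariable P cΩ.rep (Rep.prod cX.rep cY.rep) r Z := by
  have : SecondCountableTopology X' := UniformSpace.secondCountable_of_separable X'
  have : SecondCountableTopology Y' := UniformSpace.secondCountable_of_separable Y'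
  obtain ⟨uD, huD, huD'⟩ := RE.exists_nameGraph
    (S := fun _ (x : List Entry × ℕ) l => ShellDesc cX x.1 x.2 l) (re_shellDesc cX)
  obtain ⟨uU, huU, huU'⟩ := RE.exists_nameGraph
    (S := fun _ (x : List Entry) l => ∃ i, i < x.length ∧ ShellDesc cX x i l) (re_shellsDesc cX)
  obtain ⟨uB, huB, huB'⟩ := RE.exists_nameGraph
    (S := fun _ (x : ℕ × ℕ) l => cY.DistLt l x.1 (1 / 2 ^ x.2)) (re_ballDesc cY)
  replace huD' := fun ρ d i => huD' ρ (d, i) X cX.rep (shellOpens cX d i) (describes_shell cX d i)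
  replace huU' := fun ρ d => huU' ρ d X cX.rep (shellsOpens cX d) (describes_shells cX d)
  replace huB' := fun ρ v k => huB' ρ (v, k) Y cY.rep (cY.ballOpens v k) (describes_ball cY v k)
  obtain ⟨Good, hGood, hGood'⟩ := exists_good (cX := cX) hP huB huU
  -- All events of a level must come from the same list: without a unique choice, the search would
  -- describe the union over all good lists.
  obtain ⟨Sel, hSel, hSelGood, hSelUnique, hSelEx⟩ := hGood.uniformize
  have hΦ : RE fun ρ (x : ℕ × List ℕ) => ∃ N, ∀ i < x.1 + 4, ∃ m,
      LevelDesc cX cY uD uB Sel ρ (N + i) (x.2.take m) := by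
    refine RE.exists' (RE.forall_lt (RE.exists' ?_) ?_)
    · exact (re_levelDesc huD huB hSel).comp (f := fun y : (((ℕ × List ℕ) × ℕ) × ℕ) × ℕ =>
        (y.1.1.2 + y.1.2, y.1.1.1.2.take y.2)) (by fun_prop)
    · fun_prop
  obtain ⟨a, ha, ha'⟩ := RE.exists_machine (Φ := fun ρ n s => ∃ N, ∀ i < n + 4, ∃ m,
    LevelDesc cX cY uD uB Sel ρ (N + i) (s.take m)) hΦ
  refine ⟨a, ha, fun T X₀ Yc hY Z hZ p q hp hq => ?_⟩
  have : Nonempty X' := X₀.nonempty.map iX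
  have : Nonempty Y' := (Yc.nonempty X₀).map iY
  have hi : Topology.IsInducing (Prod.map iX iY) :=
    (hiX.isUniformInducing.isInducing).prodMap hiY.isUniformInducing.isInducing
  obtain ⟨Xs, Zs, hXs, hZs, hconv⟩ := hZ
  obtain ⟨g, hg⟩ := RandomVariable.exists_fun (S' := X') hiX.continuous X₀
  choose y hy using fun x => RandomVariable.exists_fun (S' := Y') hiY.continuous (Yc.toFun x)
  choose gs hgs using fun n => RandomVariable.exists_fun (S' := X') hiX.continuous (Xs n)
  choose Gs hGs using fun n => RandomVariable.exists_fun (S' := X' × Y') hi.continuous (Zs n)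
  obtain ⟨G, hG⟩ := RandomVariable.exists_fun (S' := X' × Y') hi.continuous Z
  have hJ := hXs.jointApprox hiX hiY hg hy hZs hgs hGs
  have hlim := (converges_iff_tendstoInMeasure hi hGs hG).1 hconv
  obtain ⟨r, hr, hr'⟩ := ha' (pairSeq p q)
  refine ⟨r, hr, fun w W hw => ?_⟩
  obtain ⟨o, ho, ho'⟩ := hr' w
  refine ⟨o, ho, ?_⟩
  have hpX : inputX (pairSeq (pairSeq p q) w) = p := by funext n; simp [inputX, pairSeq]
  have hpY : inputY (pairSeq (pairSeq p q) w) = q := by funext n; simp [inputY, pairSeq]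
  have hpW : inputW (pairSeq (pairSeq p q) w) = w := by funext n; simp [inputW, pairSeq]
  generalize pairSeq (pairSeq p q) w = ρ at ho' hpX hpY hpW
  choose SD oD hSD hSD' hSD'' using fun d i => hp.exists_fastSeq (huD' ρ d i)
  choose SU oU hSU hSU' hSU'' using fun d => hp.exists_fastSeq (huU' ρ d)
  choose SB oB hSB hSB' hSB'' using fun c v k =>
    hq.exists_fastSeq (ComputableMetric.rep_const (c := cX) c) (huB' ρ v k)
  replace hGood' : ∀ k d, Good ρ k d ↔ (∀ i < d.length,
      (d.getD i default).Ok P cΩ cX q (fun v => uB ρ (v, k)) k) ∧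
      1 < P ((SU d).seq (k + 1)) + 2⁻¹ ^ (k + 1) := fun k d => by
    rw [hGood' ρ k d ((SU d).seq (k + 1)) (by
      rw [hpX, hSU' d, sliceRel_graph]
      exact describes_acc (hSU'' d (k + 1))), hpY]
  -- The search succeeds at each level because the approximation of the covered event contains that
  -- event almost surely.
  have hex : ∀ k, ∃ d, Sel ρ k d := fun k => hSelEx ρ k (by
    obtain ⟨d, hd, hcov⟩ := exists_entries (cX := cX) hiX hiY hg hy hq fun v => huB' ρ v k
    refine ⟨d, (hGood' k d).2 ⟨fun i hi => hd _ ?_, ?_⟩⟩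
    · rw [List.getD_eq_getElem?_getD, List.getElem?_eq_getElem hi]
      exact List.getElem_mem hi
    · rw [one_lt_measure_add_iff (Opens.isOpen _).measurableSet]
      refine (measure_mono_ae ?_).trans_lt hcov
      filter_upwards [FastSeq.ae_mem_seq ((hSU d).symm ▸ is_shells (cX := cX) hiX hg d) (k + 1)]
        with ω h1 h2 i hi h3
      exact h2 (h1 ⟨i, hi, h3⟩))
  choose d hd using hex
  have hdgood := fun k => (hGood' k (d k)).1 (hSelGood ρ k (d k) (hd k))
  choose l hl using fun k => exists_level hiX hiY hg hy hq (fun v => huB' ρ v k) (hdgood k).1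
    (hSU (d k)) (hdgood k).2 (fun i => hSD (d k) i) (fun c v => hSB c v k)
  let A : List ℕ → Prop := fun s => Acc (graph w) (finGraph s)
  obtain ⟨S, hS, hS'⟩ := Level.exists_fastSeq hiX hiY hY hy hJ hlim l
    (isTest_test cX cY hiX hiY A)
  refine ⟨S, ?_, ?_⟩
  · refine hS'.eq (hG.is_pre W _ (isOpen_boxes cX cY A) ?_)
    exact preimage_boxes hiX hiY (describes_acc hw)
  · rw [hS]
    refine ho' Ω cΩ.rep _ fun n => ?_
    refine (Describes.exists' fun N => Describes.forall_lt (p := fun i ω =>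
      ω ∈ (l (N + i)).select (Test cX cY A (N + i))) fun i _ => ?_).congr fun ω => mem_window
    unfold LevelDesc
    refine Describes.congr (Describes.exists' fun x : List Entry × ℕ × ℕ =>
      Describes.const_and fun _ => Describes.and
        (S := fun t => Acc (sliceRel (App (graph (inputX ρ)) (graph (uD ρ (x.1, x.2.1))))
          (N + i + Nat.pair x.2.1 x.2.2 + 2)) (finGraph t))
        (S' := fun t => Acc (sliceRel (App (App (graph (inputY ρ))
          (graph fun _ => (x.1.getD x.2.1 default).1.1))
          (graph (uB ρ ((x.1.getD x.2.1 default).2.2.getD x.2.2 0, N + i))))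
          (N + i + Nat.pair x.2.1 x.2.2 + 2)) (finGraph t))
        (p := (· ∈ (SD x.1 x.2.1).seq (N + i + Nat.pair x.2.1 x.2.2 + 2)))
        (p' := (· ∈ (SB (x.1.getD x.2.1 default).1.1
          ((x.1.getD x.2.1 default).2.2.getD x.2.2 0) (N + i)).seq
            (N + i + Nat.pair x.2.1 x.2.2 + 2))) ?_ ?_)
      fun ω => (hl (N + i) (Test cX cY A (N + i)) ω).trans ?_
    · rw [hpX, hSD', sliceRel_graph]
      exact describes_acc (hSD'' _ _ _)
    · rw [hpY, hSB', sliceRel_graph]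
      exact describes_acc (hSB'' _ _ _ _)
    · rw [hpW]
      constructor
      · rintro ⟨i', j, ⟨h1, h2, h3⟩, h4⟩
        exact ⟨(d (N + i), i', j), ⟨hd _, h1, h2, h3⟩, h4⟩
      · rintro ⟨⟨d', i', j⟩, ⟨h0, h1, h2, h3⟩, h4⟩
        -- The list found by the machine is the one used to build the level.
        obtain rfl := hSelUnique _ _ _ _ h0 (hd (N + i))
        exact ⟨i', j, ⟨h1, h2, h3⟩, h4⟩

end Program

end CondRV

/-! ### The main theorem, by passage to completions -/

theorem mainTheorem1 {Ω X Y : Type*}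
    [MetricSpace Ω] [CompleteSpace Ω] [TopologicalSpace.SeparableSpace Ω]
    [MeasurableSpace Ω] [BorelSpace Ω]
    [MetricSpace X] [TopologicalSpace.SeparableSpace X]
    [MetricSpace Y] [TopologicalSpace.SeparableSpace Y]
    (P : MeasureTheory.Measure Ω) [MeasureTheory.IsProbabilityMeasure P] :
    (∀ (T : CondRV.MeasureTopology P) (X₀ : CondRV.RandomVariable P X)
        (Yc : CondRV.ConditionalRV P X Y), X₀.MeasurableWrt T → Yc.IndependentOf T →
      (∃ Xs : ℕ → CondRV.RandomVariable P X, CondRV.IsApproximation T Xs X₀) ∧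
      (∀ S : CondRV.RandomVariable P X, S.IsSimple → S.MeasurableWrt T →
        ∃! Z, CondRV.IsSimpleJoint S Yc Z) ∧
      ∃ Z : CondRV.RandomVariable P (X × Y),
        ∀ (Xs : ℕ → CondRV.RandomVariable P X) (Zs : ℕ → CondRV.RandomVariable P (X × Y)),
          CondRV.IsApproximation T Xs X₀ →
          (∀ n, CondRV.IsSimpleJoint (Xs n) Yc (Zs n)) →
          ∀ Z', CondRV.Converges Zs Z' ↔ Z' = Z) ∧
    (∀ (cΩ : CondRV.ComputableMetric Ω) (cX : CondRV.ComputableMetric X)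
        (cY : CondRV.ComputableMetric Y), CondRV.ComputableMeasure P cΩ.rep →
      ∃ a : ℕ → ℕ, Computable a ∧
        ∀ (T : CondRV.MeasureTopology P) (X₀ : CondRV.RandomVariable P X)
          (Yc : CondRV.ConditionalRV P X Y), X₀.MeasurableWrt T → Yc.IndependentOf T →
          ∀ Z, CondRV.IsJoint T X₀ Yc Z →
            ∀ p q, CondRV.Rep.randomVariable P cΩ.rep cX.rep p X₀ →
              CondRV.Rep.conditionalRV P cΩ.rep cX.rep cY.rep q Yc →
              ∃ r, CondRV.Apply a (CondRV.pairSeq p q) r ∧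
                CondRV.Rep.randomVariable P cΩ.rep (CondRV.Rep.prod cX.rep cY.rep) r Z) := by
  -- `X` and `Y` carry no measurable structure and need not be complete; their completions with the
  -- Borel sets serve as `X'` and `Y'`.
  let : MeasurableSpace (UniformSpace.Completion X) := borel _
  have : BorelSpace (UniformSpace.Completion X) := ⟨rfl⟩
  let : MeasurableSpace (UniformSpace.Completion Y) := borel _
  have : BorelSpace (UniformSpace.Completion Y) := ⟨rfl⟩
  have hiX : Isometry ((↑) : X → UniformSpace.Completion X) :=
    UniformSpace.Completion.coe_isometry
  have hiY : Isometry ((↑) : Y → UniformSpace.Completion Y) :=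
    UniformSpace.Completion.coe_isometry
  refine ⟨fun T X₀ Yc hX hY => ?_, fun cΩ cX cY hP => ?_⟩
  · have : Nonempty (UniformSpace.Completion X) := X₀.nonempty.map (↑)
    have : Nonempty (UniformSpace.Completion Y) := (Yc.nonempty X₀).map (↑)
    refine ⟨CondRV.exists_isApproximation hiX hX, fun S hS _ => ?_,
      CondRV.exists_joint_limit hiX hiY hX hY⟩
    obtain ⟨Z, hZ⟩ := CondRV.exists_isSimpleJoint (Yc := Yc) hiX hiY hS
    exact ⟨Z, hZ, fun Z' hZ' => CondRV.isSimpleJoint_unique hiX hiY hS hZ' hZ⟩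
  · obtain ⟨a, ha, h⟩ := CondRV.exists_joint_program (cX := cX) (cY := cY) hiX hiY hP
    exact ⟨a, ha, fun T X₀ Yc _ hY => h T X₀ Yc hY⟩
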